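/- Let $1<b\le 2$. For a positive integer $n$ let $$K_n=\Bigl\{x\in(0,\infty)^n:\ \sum_{i=1}^n x_i=n,\ \sum_{i=1}^n x_i^2=nb\Bigr\}.$$ The uniform distribution on $K_n$ is the probability measure carried by $K_n$ that is the weak limit, as $\varepsilon\downarrow0$, of the normalized Lebesgue measures on the shells $\{x\in(0,\infty)^n:\ |\sum_i x_i-n|<\varepsilon,\ |\sum_i x_i^2-nb|<\varepsilon\}$; for every $n\ge3$ this distribution exists and is unique. For $n\ge 3$ let $X=X^{(n)}=(X_1,\ldots,X_n)$ be a random vector with the uniform distribution on $K_n$. There exist unique $r,s\in\mathbb R$ such that $\exp(-rx^2-sx)$ is integrable on $[0,\infty)$ and the probability density on $[0,\infty)$ proportional to it has first moment $1$ and second moment $b$. Let $Z_1,Z_2,\ldots$ be i.i.d. random variables with this density. Then there is a constant $C$, depending only on $b$, such that the following hold. (a) For every fixed $k$, the random vector $(X_1,\ldots,X_k)$ converges in law to $(Z_1,\ldots,Z_k)$ as $n\to\infty$. (b) For every fixed $k$ and all non-negative integers $p_1,\ldots,p_k$, the moments $\mathbb E(X_1^{p_1}\cdots X_k^{p_k})$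 and $\mathbb E(Z_1^{p_1}\cdots Z_k^{p_k})$ are finite, and the former converges to the latter as $n\to\infty$. (c) If $b<2$, then $\lim_{n\to\infty}\mathbb P\bigl(\max_{1\le i\le n}X_i>C\sqrt{\log n}\bigr)=0$. (d) If $b=2$, then $\lim_{n\to\infty}\mathbb P\bigl(\max_{1\le i\le n}X_i>C\log n\bigr)=0$. -/

import Mathlib

open MeasureTheory ProbabilityTheory Filter Topology
open scoped BoundedContinuousFunction

noncomputable section

namespace SimplexSphere

/-- The intersection of a simplex and a sphere: points with positive coordinates,
`∑ xᵢ = n` and `∑ xᵢ² = n b`. -/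
def K (n : ℕ) (b : ℝ) : Set (Fin n → ℝ) :=
  {x | (∀ i, 0 < x i) ∧ ∑ i, x i = n ∧ ∑ i, x i ^ 2 = n * b}

/-- The thin shell of thickness `ε` around `K n b` in the positive orthant. -/
def shell (n : ℕ) (b ε : ℝ) : Set (Fin n → ℝ) :=
  {x | (∀ i, 0 < x i) ∧ |(∑ i, x i) - n| < ε ∧ |(∑ i, x i ^ 2) - n * b| < ε}

/-- `P` is the uniform distribution on `K n b`: a probability measure carried by `K n b` which is
the weak limit of the normalized Lebesgue measures on the shells as the thickness tends to `0`.
(`cond volume s` is Lebesgue measure restricted to `s` and divided by the volume of `s`.) -/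
structure IsUniformOnK (n : ℕ) (b : ℝ) (P : Measure (Fin n → ℝ)) : Prop where
  isProbabilityMeasure : IsProbabilityMeasure P
  ae_mem : ∀ᵐ x ∂P, x ∈ K n b
  tendsto_shell : ∀ f : (Fin n → ℝ) →ᵇ ℝ,
    Tendsto (fun ε : ℝ => ∫ x, f x ∂(cond volume (shell n b ε))) (𝓝[>] 0) (𝓝 (∫ x, f x ∂P))

/-- The unnormalized density `exp (-r x² - s x)`. -/
def weight (r s x : ℝ) : ℝ := Real.exp (-(r * x ^ 2) - s * x)

/-- The distribution on `[0, ∞)` with density proportional to `exp (-r x² - s x)`.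
It is a probability measure exactly when this function is integrable on `[0, ∞)`. -/
def G (r s : ℝ) : Measure ℝ :=
  (∫⁻ x in Set.Ici 0, ENNReal.ofReal (weight r s x))⁻¹ •
    (volume.restrict (Set.Ici 0)).withDensity (fun x => ENNReal.ofReal (weight r s x))

/-- The density proportional to `exp (-r x² - s x)` on `[0, ∞)` exists and has first moment `1`
and second moment `b`. -/
structure HasMoments (r s b : ℝ) : Prop where
  isProbabilityMeasure : IsProbabilityMeasure (G r s)
  integrable_id : Integrable (fun x : ℝ => x) (G r s)
  integrable_sq : Integrable (fun x : ℝ => x ^ 2) (G r s)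
  first_moment : ∫ x, x ∂(G r s) = 1
  second_moment : ∫ x, x ^ 2 ∂(G r s) = b

/-- The first `k` coordinates of a vector in `ℝⁿ` (coordinates with index `≥ n` are set to `0`;
this only matters for `n < k`). -/
def firstCoords (k : ℕ) {n : ℕ} (x : Fin n → ℝ) : Fin k → ℝ :=
  fun i => if h : (i : ℕ) < n then x ⟨i, h⟩ else 0

end SimplexSphere

end

noncomputable section

namespace SimplexSphere

open scoped ENNReal

/-! ### Splitting product measures -/

/-! The product density `∏ exp (-r xᵢ² - s xᵢ)` depends only on `∑ xᵢ` and `∑ xᵢ²`, so it is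
constant on `K n b`. The uniform law is therefore the law of `n` i.i.d. variables with law `G r s`,
conditioned on the values of these two sums. The moment conditions on `r, s` make the prescribed
values equal to the expectations, so the conditioning costs only a power of `n`. Any event that is
rarer than every power of `n` under the product law stays negligible under the uniform law.

To make this precise, `n - 3` coordinates are kept free. Once the two sums are fixed, the other
three lie on a circle, and Lebesgue measure on `ℝ³` has constant Jacobian in (sum, sum of squares,
angle). This disintegrates Lebesgue measure along the two sums (`lintegral_pt`). The slice integrals
are continuous at the centre (`continuousAt_sliceIntegral`), so the shell measures converge to the
normalized slice measure `unif`. Uniqueness of weak limits makes the uniform law exchangeable.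

The cost of conditioning is bounded in `exists_unif_map_le`: the law of the free coordinates is at
most `C (m + 1) ^ α` times the product law. The numerator is controlled because the weights of the
last three coordinates are bounded. The denominator needs a polynomial lower bound for the
probability that the planar walk with steps `(Z - 1, Z² - b)` ends in a bounded region. No local
limit theorem is used. In `exists_local_lower_bound` a fixed fraction of the steps brings the walk
within diffusive range of its target for the remaining time, with probability at least `c`;
iterating over logarithmically many scales costs a power of `n`.

For (a) and (b), exchangeability writes `E F(X₁, …, X_k)` as the mean of an average of `F` over many
disjoint blocks. After truncation, Hoeffding's inequality makes deviations under the product law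
exponentially rare, which beats the polynomial factor, and high moments control the truncation. For
(c) and (d), a union bound over the coordinates is combined with the Gaussian or exponential tail of
`G r s`.

The parameters come from the exponential law tilted by `exp (-t (x - 1)²)` and rescaled to mean `1`:
the normalized second moment is `2` at `t = 0` and gets arbitrarily close to `1` for large `t`. -/

lemma measurePreserving_append (μ : Measure ℝ) [SigmaFinite μ] (m k : ℕ) :
    MeasurePreserving (fun p : (Fin m → ℝ) × (Fin k → ℝ) => Fin.append p.1 p.2)
      ((Measure.pi fun _ => μ).prod (Measure.pi fun _ => μ)) (Measure.pi fun _ => μ) := by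
  have h1 := measurePreserving_sumPiEquivProdPi_symm (X := fun _ : Fin m ⊕ Fin k => ℝ)
    (fun _ => μ)
  have h2 := measurePreserving_piCongrLeft (α := fun _ : Fin (m + k) => ℝ) (fun _ => μ)
    finSumFinEquiv
  have h := h2.comp h1
  convert h using 1
  ext p i
  refine Fin.addCases (fun i => ?_) (fun i => ?_) i
  · have := MeasurableEquiv.piCongrLeft_apply_apply (β := fun _ : Fin (m + k) => ℝ)
      (finSumFinEquiv (m := m) (n := k)) ((MeasurableEquiv.sumPiEquivProdPi
        (fun _ : Fin m ⊕ Fin k => ℝ)).symm p) (Sum.inl i)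
    simp only [finSumFinEquiv_apply_left] at this
    simp only [Fin.append_left, Function.comp_apply]
    exact this.symm
  · have := MeasurableEquiv.piCongrLeft_apply_apply (β := fun _ : Fin (m + k) => ℝ)
      (finSumFinEquiv (m := m) (n := k)) ((MeasurableEquiv.sumPiEquivProdPi
        (fun _ : Fin m ⊕ Fin k => ℝ)).symm p) (Sum.inr i)
    simp only [finSumFinEquiv_apply_right] at this
    simp only [Fin.append_right, Function.comp_apply]
    exact this.symm

lemma measurePreserving_cons (μ : Measure ℝ) [SigmaFinite μ] (m : ℕ) :
    MeasurePreserving (fun p : ℝ × (Fin m → ℝ) => (Fin.cons p.1 p.2 : Fin (m + 1) → ℝ))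
      (μ.prod (Measure.pi fun _ => μ)) (Measure.pi fun _ => μ) := by
  have h := (measurePreserving_piFinSuccAbove (α := fun _ : Fin (m + 1) => ℝ) (fun _ => μ) 0).symm
  convert h using 1
  ext p i
  refine Fin.cases ?_ (fun i => ?_) i <;> simp

/-! ### Cylindrical coordinates around the diagonal of `ℝ³` -/

/-- The point with coordinate sum `p`, sum of squares `q` and angle `φ` around the diagonal. -/
def circ (p q φ : ℝ) : Fin 3 → ℝ :=
  ![p / 3 + √(q - p ^ 2 / 3) * ((√2)⁻¹ * Real.cos φ + (√6)⁻¹ * Real.sin φ),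
    p / 3 + √(q - p ^ 2 / 3) * (-(√2)⁻¹ * Real.cos φ + (√6)⁻¹ * Real.sin φ),
    p / 3 - √(q - p ^ 2 / 3) * (2 * (√6)⁻¹ * Real.sin φ)]

lemma sum_circ (p q φ : ℝ) : ∑ i, circ p q φ i = p := by
  simp [circ, Fin.sum_univ_three]; ring

lemma inv_sqrt_two_sq : ((√2 : ℝ)⁻¹) ^ 2 = 1 / 2 := by
  rw [inv_pow, Real.sq_sqrt (by norm_num)]; norm_num

lemma inv_sqrt_six_sq : ((√6 : ℝ)⁻¹) ^ 2 = 1 / 6 := by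
  rw [inv_pow, Real.sq_sqrt (by norm_num)]; norm_num

lemma sum_circ_sq {p q : ℝ} (φ : ℝ) (h : p ^ 2 ≤ 3 * q) : ∑ i, circ p q φ i ^ 2 = q := by
  have h1 : √(q - p ^ 2 / 3) ^ 2 = q - p ^ 2 / 3 := Real.sq_sqrt (by linarith)
  have h2 := inv_sqrt_two_sq
  have h3 := inv_sqrt_six_sq
  have h4 := Real.sin_sq_add_cos_sq φ
  simp only [circ, Fin.sum_univ_three, Matrix.cons_val_zero, Matrix.cons_val_one, Matrix.cons_val]
  generalize √(q - p ^ 2 / 3) = ρ at *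
  generalize (√2 : ℝ)⁻¹ = α at *
  generalize (√6 : ℝ)⁻¹ = β at *
  generalize Real.sin φ = y at *
  generalize Real.cos φ = x at *
  have : (p / 3 + ρ * (α * x + β * y)) ^ 2 + (p / 3 + ρ * (-α * x + β * y)) ^ 2 +
    (p / 3 - ρ * (2 * β * y)) ^ 2 = p ^ 2 / 3 + ρ ^ 2 * (2 * α ^ 2 * x ^ 2 + 6 * β ^ 2 * y ^ 2) := by
    ring
  rw [this, h1, h2, h3]
  have : 2 * (1 / 2) * x ^ 2 + 6 * (1 / 6) * y ^ 2 = 1 := by linarith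
  rw [this]; ring

lemma continuous_circ : Continuous fun t : (ℝ × ℝ) × ℝ => circ t.1.1 t.1.2 t.2 := by
  refine continuous_pi fun i => ?_
  fin_cases i <;> simp only [circ] <;> (simp; fun_prop)

/-- Linear coordinates `(p, a, b)` with `p` the coordinate sum. -/
def diagMatrix : Matrix (Fin 3) (Fin 3) ℝ :=
  !![1 / 3, (√2)⁻¹, (√6)⁻¹; 1 / 3, -(√2)⁻¹, (√6)⁻¹; 1 / 3, 0, -2 * (√6)⁻¹]

lemma det_diagMatrix : diagMatrix.det = 2 * (√2)⁻¹ * (√6)⁻¹ := by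
  rw [diagMatrix, Matrix.det_fin_three]
  simp; ring

/-- The Jacobian constant of the coordinates `(p, q, φ)`. -/
def jac : ℝ≥0∞ := ENNReal.ofReal ((√2)⁻¹ * (√6)⁻¹)

lemma jac_ne_zero : jac ≠ 0 := by
  rw [jac, ne_eq, ENNReal.ofReal_eq_zero, not_le]; positivity

lemma jac_ne_top : jac ≠ ∞ := ENNReal.ofReal_ne_top

/-- The columns of `diagMatrix` are orthogonal and the last two are unit vectors, so the sum of
squares becomes `p ^ 2 / 3 + a.1 ^ 2 + a.2 ^ 2`. The determinant is `2 * jac`; the factor `2` is set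
apart because the radial substitution absorbs it. -/
lemma lintegral_diag {F : (Fin 3 → ℝ) → ℝ≥0∞} (hF : Measurable F) :
    ∫⁻ z, F z = 2 * jac * ∫⁻ p : ℝ, ∫⁻ a : ℝ × ℝ, F (diagMatrix.mulVec ![p, a.1, a.2]) := by
  have hdet : 0 < diagMatrix.det := by rw [det_diagMatrix]; positivity
  have h1 := Real.map_matrix_volume_pi_eq_smul_volume_pi hdet.ne'
  have hlin : Measurable (Matrix.toLin' diagMatrix) :=
    (LinearMap.continuous_of_finiteDimensional _).measurable
  have h2 : ∫⁻ z, F (diagMatrix.mulVec z) = ENNReal.ofReal |diagMatrix.det⁻¹| * ∫⁻ z, F z := by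
    rw [← smul_eq_mul, ← lintegral_smul_measure, ← h1, lintegral_map hF hlin]
    rfl
  have h3 : ∫⁻ z : Fin 3 → ℝ, F (diagMatrix.mulVec z) =
      ∫⁻ p : ℝ, ∫⁻ a : ℝ × ℝ, F (diagMatrix.mulVec ![p, a.1, a.2]) := by
    have e1 := measurePreserving_cons (volume : Measure ℝ) 2
    have e2 := (volume_preserving_finTwoArrow ℝ).symm
    have hF' : Measurable fun z : Fin 3 → ℝ => F (diagMatrix.mulVec z) := hF.comp hlin
    rw [volume_pi, ← e1.lintegral_comp hF']
    rw [lintegral_prod]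
    swap
    · exact (hF'.comp e1.measurable).aemeasurable
    refine lintegral_congr fun p => ?_
    rw [← volume_pi, ← e2.lintegral_comp]
    · refine lintegral_congr fun a => ?_
      congr 2
    · exact hF'.comp (e1.measurable.comp measurable_prodMk_left)
  have h4 : 2 * jac = ENNReal.ofReal diagMatrix.det := by
    rw [jac, det_diagMatrix, show (2 : ℝ≥0∞) = ENNReal.ofReal 2 by simp,
      ← ENNReal.ofReal_mul (by norm_num)]
    ring_nf
  rw [← h3, h2, h4, ← mul_assoc, ← ENNReal.ofReal_mul hdet.le, abs_of_pos (inv_pos.2 hdet),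
    mul_inv_cancel₀ hdet.ne']
  simp

/-- The substitution `q = ρ² + c` turns `2 ρ dρ` into `dq`. The polar Jacobian disappears exactly
because the fibre is a circle, which is why three coordinates are eliminated. -/
lemma lintegral_radial (c : ℝ) (g : ℝ → ℝ≥0∞) :
    2 * ∫⁻ ρ in Set.Ioi (0 : ℝ), ENNReal.ofReal ρ * g ρ = ∫⁻ q in Set.Ioi c, g (√(q - c)) := by
  have himg : (fun ρ : ℝ => ρ ^ 2 + c) '' Set.Ioi 0 = Set.Ioi c := by
    ext q
    simp only [Set.mem_image, Set.mem_Ioi]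
    constructor
    · rintro ⟨x, hx, rfl⟩; nlinarith [pow_pos hx 2]
    · intro h
      exact ⟨√(q - c), Real.sqrt_pos.2 (by linarith), by rw [Real.sq_sqrt (by linarith)]; ring⟩
  have h := lintegral_image_eq_lintegral_abs_deriv_mul (s := Set.Ioi (0 : ℝ))
    (f := fun ρ => ρ ^ 2 + c) (f' := fun ρ => 2 * ρ) measurableSet_Ioi
    (fun x _ => by simpa using ((hasDerivAt_pow 2 x).add_const c).hasDerivWithinAt)
    (fun x hx y hy hxy => by
      have : x ^ 2 = y ^ 2 := by simpa using hxy
      exact (pow_left_inj₀ (le_of_lt hx) (le_of_lt hy) (by norm_num)).1 this)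
    (fun q => g (√(q - c)))
  rw [himg] at h
  rw [h, ← lintegral_const_mul' _ _ (by norm_num)]
  refine setLIntegral_congr_fun measurableSet_Ioi fun ρ hρ => ?_
  have hρ' : (0 : ℝ) ≤ ρ := le_of_lt hρ
  simp only [add_sub_cancel_right, Real.sqrt_sq hρ']
  rw [abs_of_nonneg (by positivity), ENNReal.ofReal_mul (by norm_num), ← mul_assoc]
  simp

lemma lintegral_circ {F : (Fin 3 → ℝ) → ℝ≥0∞} (hF : Measurable F) :
    ∫⁻ z, F z = jac * ∫⁻ p : ℝ, ∫⁻ q in Set.Ioi (p ^ 2 / 3),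
      ∫⁻ φ in Set.Ioo (-Real.pi) Real.pi, F (circ p q φ) := by
  rw [lintegral_diag hF, mul_comm 2 jac, mul_assoc]
  congr 1
  rw [← lintegral_const_mul' _ _ (by norm_num)]
  refine lintegral_congr fun p => ?_
  have hm : Measurable fun a : ℝ × ℝ => F (diagMatrix.mulVec ![p, a.1, a.2]) := by
    refine hF.comp ?_
    have h1 : Measurable fun z : Fin 3 → ℝ => diagMatrix.mulVec z :=
      (LinearMap.continuous_of_finiteDimensional (Matrix.toLin' diagMatrix)).measurable
    have h2 : Measurable fun a : ℝ × ℝ => (![p, a.1, a.2] : Fin 3 → ℝ) := by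
      refine measurable_pi_lambda _ fun i => ?_
      fin_cases i <;> simp <;> fun_prop
    exact h1.comp h2
  rw [← lintegral_comp_polarCoord_symm, polarCoord_target, Measure.volume_eq_prod,
    ← Measure.prod_restrict, lintegral_prod]
  · have hr := lintegral_radial (p ^ 2 / 3)
      (fun ρ => ∫⁻ φ in Set.Ioo (-Real.pi) Real.pi,
        F ![p / 3 + ρ * ((√2)⁻¹ * Real.cos φ + (√6)⁻¹ * Real.sin φ),
    p / 3 + ρ * (-(√2)⁻¹ * Real.cos φ + (√6)⁻¹ * Real.sin φ),
    p / 3 - ρ * (2 * (√6)⁻¹ * Real.sin φ)])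
    simp only [circ]
    rw [← hr]
    congr 1
    refine lintegral_congr fun ρ => ?_
    simp only [smul_eq_mul]
    rw [lintegral_const_mul' _ _ ENNReal.ofReal_ne_top]
    congr 1
    refine lintegral_congr fun φ => ?_
    congr 1
    ext i
    fin_cases i <;> simp [diagMatrix, Matrix.mulVec, dotProduct, Fin.sum_univ_three] <;> ring
  · refine Measurable.aemeasurable ?_
    refine Measurable.mul (by fun_prop) (hm.comp ?_)
    have : Continuous fun z : ℝ × ℝ => (z.1 * Real.cos z.2, z.1 * Real.sin z.2) := by fun_prop
    exact this.measurable

/-! ### Disintegration of Lebesgue measure along the sum and the sum of squares -/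

/-- Lebesgue measure on the free parameters `(y, φ)`. -/
def base (m : ℕ) : Measure ((Fin m → ℝ) × ℝ) :=
  (volume : Measure (Fin m → ℝ)).prod (volume.restrict (Set.Ioo (-Real.pi) Real.pi))

instance (m : ℕ) : SFinite (base m) := by unfold base; infer_instance

/-- The point with sum `s.1`, sum of squares `s.2` and free parameters `w`. -/
def pt {m : ℕ} (s : ℝ × ℝ) (w : (Fin m → ℝ) × ℝ) : Fin (m + 3) → ℝ :=
  Fin.append w.1 (circ (s.1 - ∑ i, w.1 i) (s.2 - ∑ i, w.1 i ^ 2) w.2)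

/-- Parameters for which the circle is nondegenerate. -/
def circDomain (m : ℕ) : Set ((ℝ × ℝ) × ((Fin m → ℝ) × ℝ)) :=
  {t | (t.1.1 - ∑ i, t.2.1 i) ^ 2 < 3 * (t.1.2 - ∑ i, t.2.1 i ^ 2)}

/-- Parameters of points in the open orthant. -/
def posDomain (m : ℕ) : Set ((ℝ × ℝ) × ((Fin m → ℝ) × ℝ)) :=
  {t | t ∈ circDomain m ∧ ∀ i, 0 < pt t.1 t.2 i}

lemma continuous_append {X : Type*} [TopologicalSpace X] {m k : ℕ} {f : X → Fin m → ℝ}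
    {g : X → Fin k → ℝ} (hf : Continuous f) (hg : Continuous g) :
    Continuous fun x => Fin.append (f x) (g x) := by
  refine continuous_pi fun i => ?_
  refine Fin.addCases (fun i => ?_) (fun i => ?_) i
  · simpa using continuous_pi_iff.1 hf i
  · simpa using continuous_pi_iff.1 hg i

lemma continuous_pt (m : ℕ) :
    Continuous fun t : (ℝ × ℝ) × ((Fin m → ℝ) × ℝ) => pt t.1 t.2 := by
  unfold pt
  refine continuous_append (by fun_prop) ?_
  exact continuous_circ.comp (f := fun t : (ℝ × ℝ) × ((Fin m → ℝ) × ℝ) =>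
    ((t.1.1 - ∑ i, t.2.1 i, t.1.2 - ∑ i, t.2.1 i ^ 2), t.2.2)) (by fun_prop)

lemma isOpen_circDomain (m : ℕ) : IsOpen (circDomain m) := by
  unfold circDomain
  exact isOpen_lt (by fun_prop) (by fun_prop)

lemma isOpen_posDomain (m : ℕ) : IsOpen (posDomain m) := by
  have h : IsOpen {t : (ℝ × ℝ) × ((Fin m → ℝ) × ℝ) | ∀ i, 0 < pt t.1 t.2 i} := by
    simp only [Set.ofPred_forall]
    exact isOpen_iInter_of_finite fun i =>
      isOpen_lt continuous_const ((continuous_apply i).comp (continuous_pt m))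
  exact (isOpen_circDomain m).inter h

lemma sum_pt {m : ℕ} (s : ℝ × ℝ) (w : (Fin m → ℝ) × ℝ) : ∑ i, pt s w i = s.1 := by
  rw [Fin.sum_univ_add]
  simp only [pt, Fin.append_left, Fin.append_right, sum_circ]
  ring

lemma sum_pt_sq {m : ℕ} {s : ℝ × ℝ} {w : (Fin m → ℝ) × ℝ} (h : (s, w) ∈ circDomain m) :
    ∑ i, pt s w i ^ 2 = s.2 := by
  rw [Fin.sum_univ_add]
  simp only [pt, Fin.append_left, Fin.append_right]
  rw [sum_circ_sq _ (le_of_lt h)]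
  ring

/-- For fixed free coordinates `y`, the sum and the sum of squares of the last three are translated
by those of `y`. The outer variable `s` then no longer depends on `y`, and the integrals can be
exchanged. -/
lemma lintegral_pt {m : ℕ} {F : (Fin (m + 3) → ℝ) → ℝ≥0∞} (hF : Measurable F) :
    ∫⁻ x, F x = jac * ∫⁻ s : ℝ × ℝ, ∫⁻ w,
      (circDomain m).indicator (fun t => F (pt t.1 t.2)) (s, w) ∂(base m) := by
  set h : (ℝ × ℝ) × ((Fin m → ℝ) × ℝ) → ℝ≥0∞ :=
    (circDomain m).indicator (fun t => F (pt t.1 t.2)) with hh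
  have hm : Measurable h :=
    (hF.comp (continuous_pt m).measurable).indicator (isOpen_circDomain m).measurableSet
  have happ := measurePreserving_append (volume : Measure ℝ) m 3
  have hA : Measurable fun z : (Fin m → ℝ) × (Fin 3 → ℝ) => F (Fin.append z.1 z.2) :=
    hF.comp happ.measurable
  have e1 : ∫⁻ x, F x = ∫⁻ y : Fin m → ℝ, ∫⁻ z : Fin 3 → ℝ, F (Fin.append y z) := by
    rw [volume_pi, ← happ.lintegral_comp hF, lintegral_prod _ hA.aemeasurable]
    rfl
  have e2 : ∀ y : Fin m → ℝ, ∫⁻ z : Fin 3 → ℝ, F (Fin.append y z) =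
      jac * ∫⁻ s : ℝ × ℝ, ∫⁻ φ in Set.Ioo (-Real.pi) Real.pi, h (s, (y, φ)) := by
    intro y
    have hA' : Measurable fun z : Fin 3 → ℝ => F (Fin.append y z) :=
      hA.comp measurable_prodMk_left
    rw [lintegral_circ hA']
    congr 1
    have hm' : Measurable fun s : ℝ × ℝ =>
        ∫⁻ φ in Set.Ioo (-Real.pi) Real.pi, h (s, (y, φ)) := by
      refine Measurable.lintegral_prod_right' (f := fun z : (ℝ × ℝ) × ℝ => h (z.1, (y, z.2))) ?_
      exact hm.comp (by fun_prop)
    rw [Measure.volume_eq_prod, lintegral_prod _ hm'.aemeasurable,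
      ← lintegral_sub_right_eq_self _ (∑ i, y i)]
    refine lintegral_congr fun s1 => ?_
    rw [← lintegral_indicator measurableSet_Ioi, ← lintegral_sub_right_eq_self _ (∑ i, y i ^ 2)]
    refine lintegral_congr fun s2 => ?_
    by_cases hs : (s1 - ∑ i, y i) ^ 2 < 3 * (s2 - ∑ i, y i ^ 2)
    · rw [Set.indicator_of_mem (by simp only [Set.mem_Ioi]; linarith)]
      refine lintegral_congr fun φ => ?_
      rw [hh, Set.indicator_of_mem (show _ ∈ circDomain m from hs)]
      rfl
    · rw [Set.indicator_of_notMem (by simp only [Set.mem_Ioi]; linarith)]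
      have : ∀ φ, h ((s1, s2), (y, φ)) = 0 := fun φ =>
        Set.indicator_of_notMem (show _ ∉ circDomain m from hs) _
      simp [this]
  have hm2 : Measurable fun t : (Fin m → ℝ) × (ℝ × ℝ) =>
      ∫⁻ φ in Set.Ioo (-Real.pi) Real.pi, h (t.2, (t.1, φ)) := by
    refine Measurable.lintegral_prod_right'
      (f := fun z : ((Fin m → ℝ) × (ℝ × ℝ)) × ℝ => h (z.1.2, (z.1.1, z.2))) ?_
    exact hm.comp (by fun_prop)
  rw [e1]
  simp_rw [e2]
  rw [lintegral_const_mul' _ _ jac_ne_top, lintegral_lintegral_swap hm2.aemeasurable]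
  congr 1
  refine lintegral_congr fun s => ?_
  have hms : Measurable fun w : (Fin m → ℝ) × ℝ => h (s, w) := hm.comp measurable_prodMk_left
  rw [base, lintegral_prod _ hms.aemeasurable]

lemma volume_restrict_pos (m : ℕ) :
    (volume : Measure (Fin (m + 3) → ℝ)).restrict {x | ∀ i, 0 < x i} =
      jac • (((volume : Measure (ℝ × ℝ)).prod (base m)).restrict (posDomain m)).map
        (fun t => pt t.1 t.2) := by
  have hpos : MeasurableSet {x : Fin (m + 3) → ℝ | ∀ i, 0 < x i} := by
    simp only [Set.ofPred_forall]
    exact MeasurableSet.iInter fun i => measurableSet_lt measurable_const (measurable_pi_apply i)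
  have hU := (isOpen_posDomain m).measurableSet
  have hpt := (continuous_pt m).measurable
  ext A hA
  rw [Measure.restrict_apply hA, ← lintegral_indicator_one (hA.inter hpos),
    lintegral_pt (measurable_one.indicator (hA.inter hpos)), Measure.smul_apply,
    Measure.map_apply hpt hA, Measure.restrict_apply (hpt hA), smul_eq_mul,
    ← lintegral_indicator_one ((hpt hA).inter hU), lintegral_prod]
  · congr 1
    refine lintegral_congr fun s => lintegral_congr fun w => ?_
    by_cases h1 : (s, w) ∈ circDomain m <;> by_cases h2 : pt s w ∈ A <;>
      by_cases h3 : ∀ i, 0 < pt s w i <;>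
      simp [posDomain, Set.indicator, h1, h2, h3]
  · exact (measurable_one.indicator ((hpt hA).inter hU)).aemeasurable

lemma shell_eq (n : ℕ) (b ε : ℝ) : shell n b ε =
    {x | ((∑ i, x i, ∑ i, x i ^ 2) : ℝ × ℝ) ∈ Metric.ball ((n : ℝ), n * b) ε} ∩
      {x | ∀ i, 0 < x i} := by
  ext x
  simp only [shell, Set.mem_ofPred_eq, Set.mem_inter_iff, Metric.mem_ball, Prod.dist_eq,
    Real.dist_eq, max_lt_iff]
  tauto

lemma measurable_sums (n : ℕ) :
    Measurable fun x : Fin n → ℝ => ((∑ i, x i, ∑ i, x i ^ 2) : ℝ × ℝ) := by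
  fun_prop

lemma volume_restrict_shell (m : ℕ) (b ε : ℝ) :
    (volume : Measure (Fin (m + 3) → ℝ)).restrict (shell (m + 3) b ε) =
      jac • (((volume : Measure (ℝ × ℝ)).prod (base m)).restrict
        (posDomain m ∩ Metric.ball (((m + 3 : ℕ) : ℝ), ((m + 3 : ℕ) : ℝ) * b) ε ×ˢ Set.univ)).map
        (fun t => pt t.1 t.2) := by
  have hpt := (continuous_pt m).measurable
  have hB := measurable_sums (m + 3) (Metric.isOpen_ball
    (x := (((m + 3 : ℕ) : ℝ), ((m + 3 : ℕ) : ℝ) * b)) (ε := ε)).measurableSet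
  rw [shell_eq]
  refine (Measure.restrict_restrict hB).symm.trans ?_
  rw [volume_restrict_pos, Measure.restrict_smul, Measure.restrict_map hpt hB,
    Measure.restrict_restrict (hpt hB)]
  congr 3
  ext t
  simp only [Set.mem_inter_iff, Set.mem_preimage, Set.mem_prod, Set.mem_univ, and_true, sum_pt]
  constructor
  · rintro ⟨h1, h2⟩
    rw [sum_pt_sq h2.1] at h1
    exact ⟨h2, h1⟩
  · rintro ⟨h1, h2⟩
    rw [sum_pt_sq h1.1]
    exact ⟨h2, h1⟩

/-! ### The boundary of the slices is negligible -/

lemma trig_ne {A B C : ℝ} (h : B ≠ 0 ∨ C ≠ 0) :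
    ∃ φ : ℝ, A + B * Real.cos φ + C * Real.sin φ ≠ 0 := by
  by_contra! hc
  have h0 := hc 0
  have h1 := hc Real.pi
  have h2 := hc (Real.pi / 2)
  have h3 := hc (-(Real.pi / 2))
  simp at h0 h1 h2 h3
  rcases h with h | h
  · exact h (by linarith)
  · exact h (by linarith)

/-- A real analytic function that is not identically zero on the line has a discrete, hence null,
zero set. -/
lemma ae_trig_ne {A B C : ℝ} (h : B ≠ 0 ∨ C ≠ 0) :
    ∀ᵐ φ : ℝ, A + B * Real.cos φ + C * Real.sin φ ≠ 0 := by
  obtain ⟨φ, hφ⟩ := trig_ne (A := A) h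
  have han : AnalyticOnNhd ℝ (fun φ : ℝ => A + B * Real.cos φ + C * Real.sin φ) Set.univ :=
    fun x _ => by fun_prop
  have h1 := han.preimage_zero_mem_codiscreteWithin hφ (Set.mem_univ _)
    isConnected_univ
  have h2 := ae_restrict_le_codiscreteWithin (μ := (volume : Measure ℝ)) MeasurableSet.univ h1
  rw [Measure.restrict_univ] at h2
  exact h2

lemma ae_circ_ne {p q : ℝ} (h : p ^ 2 < 3 * q) : ∀ᵐ φ : ℝ, ∀ i, circ p q φ i ≠ 0 := by
  rw [ae_all_iff]
  intro i
  have hρ : 0 < √(q - p ^ 2 / 3) := Real.sqrt_pos.2 (by linarith)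
  fin_cases i
  · filter_upwards [ae_trig_ne (A := p / 3) (B := √(q - p ^ 2 / 3) * (√2)⁻¹)
      (C := √(q - p ^ 2 / 3) * (√6)⁻¹) (Or.inl (by positivity))] with φ hφ
    convert hφ using 1
    simp [circ]; ring
  · filter_upwards [ae_trig_ne (A := p / 3) (B := -(√(q - p ^ 2 / 3) * (√2)⁻¹))
      (C := √(q - p ^ 2 / 3) * (√6)⁻¹) (Or.inl (neg_ne_zero.2 (by positivity)))] with φ hφ
    convert hφ using 1
    simp [circ]; ring
  · filter_upwards [ae_trig_ne (A := p / 3) (B := 0)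
      (C := -(√(q - p ^ 2 / 3) * 2 * (√6)⁻¹)) (Or.inr (neg_ne_zero.2 (by positivity)))] with φ hφ
    convert hφ using 1
    simp [circ]; ring

lemma finite_quadratic_zeros {A B C : ℝ} (hA : A ≠ 0) :
    {t : ℝ | A * t ^ 2 + B * t + C = 0}.Finite := by
  let P : Polynomial ℝ := Polynomial.C A * Polynomial.X ^ 2 + Polynomial.C B * Polynomial.X +
    Polynomial.C C
  have hP : P ≠ 0 := by
    intro h0
    have := congrArg (fun q : Polynomial ℝ => q.coeff 2) h0
    simp [P] at this
    exact hA this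
  refine (P.roots.toFinset.finite_toSet).subset fun t ht => ?_
  have ht' : A * t ^ 2 + B * t + C = 0 := ht
  simp only [Finset.mem_coe, Multiset.mem_toFinset, Polynomial.mem_roots hP, Polynomial.IsRoot]
  simpa [P] using ht'

/-- Equality is a quadratic equation in the first free coordinate with leading coefficient `4`, so
it has finitely many roots once the others are fixed. With no free coordinate the claim is the
strict inequality itself. -/
lemma ae_sphere_ne {m : ℕ} {a c : ℝ} (h : a ^ 2 < (m + 3) * c) :
    ∀ᵐ y : Fin m → ℝ, (a - ∑ i, y i) ^ 2 ≠ 3 * (c - ∑ i, y i ^ 2) := by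
  rcases m with _ | m
  · refine Eventually.of_forall fun y => ?_
    simp at h ⊢
    exact h.ne
  · have hcons := measurePreserving_cons (volume : Measure ℝ) m
    have hS : MeasurableSet {y : Fin (m + 1) → ℝ |
        (a - ∑ i, y i) ^ 2 ≠ 3 * (c - ∑ i, y i ^ 2)} :=
      (isOpen_ne_fun (by fun_prop) (by fun_prop)).measurableSet
    rw [volume_pi, ← hcons.map_eq, ae_map_iff hcons.measurable.aemeasurable hS]
    have hS' : MeasurableSet {x : ℝ × (Fin m → ℝ) |
        (a - ∑ i, (Fin.cons x.1 x.2 : Fin (m + 1) → ℝ) i) ^ 2 ≠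
          3 * (c - ∑ i, (Fin.cons x.1 x.2 : Fin (m + 1) → ℝ) i ^ 2)} := hcons.measurable hS
    rw [Measure.ae_prod_iff_ae_ae hS', Measure.ae_ae_comm hS']
    refine Eventually.of_forall fun y => ?_
    rw [ae_iff]
    refine Set.Finite.measure_zero ?_ _
    simp only [ne_eq, not_not, Fin.sum_univ_succ, Fin.cons_zero, Fin.cons_succ]
    set A := ∑ i, y i
    set B := ∑ i, y i ^ 2
    refine (finite_quadratic_zeros (A := 4) (B := -2 * (a - A)) (C := (a - A) ^ 2 - 3 * (c - B))
      (by norm_num)).subset fun t ht => ?_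
    have ht' : (a - (t + A)) ^ 2 = 3 * (c - (t ^ 2 + B)) := ht
    simp only [Set.mem_ofPred_eq]
    linarith

/-- Almost every parameter avoids the boundary of the slice, made up of degenerate circles and
points on a coordinate hyperplane. This is what makes slice integrals continuous. -/
lemma ae_base_regular {m : ℕ} {s : ℝ × ℝ} (h : s.1 ^ 2 < (m + 3) * s.2) :
    ∀ᵐ w ∂(base m), (s.1 - ∑ i, w.1 i) ^ 2 ≠ 3 * (s.2 - ∑ i, w.1 i ^ 2) ∧
      ((s, w) ∈ circDomain m → ∀ i, pt s w i ≠ 0) := by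
  have h1 : ∀ᵐ w ∂(base m), (s.1 - ∑ i, w.1 i) ^ 2 ≠ 3 * (s.2 - ∑ i, w.1 i ^ 2) :=
    Measure.quasiMeasurePreserving_fst.ae (ae_sphere_ne h)
  have h2 : ∀ᵐ w ∂(base m), ∀ i, w.1 i ≠ 0 := by
    refine Measure.quasiMeasurePreserving_fst.ae (p := fun y : Fin m → ℝ => ∀ i, y i ≠ 0) ?_
    rw [ae_all_iff]
    intro i
    rw [ae_iff]
    simp only [ne_eq, not_not]
    exact Measure.pi_hyperplane (fun _ : Fin m => (volume : Measure ℝ)) i 0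
  have h3 : ∀ᵐ w ∂(base m), (s, w) ∈ circDomain m →
      ∀ i, circ (s.1 - ∑ i, w.1 i) (s.2 - ∑ i, w.1 i ^ 2) w.2 i ≠ 0 := by
    rw [base, Measure.ae_prod_iff_ae_ae]
    · refine Eventually.of_forall fun y => ?_
      by_cases hy : (s.1 - ∑ i, y i) ^ 2 < 3 * (s.2 - ∑ i, y i ^ 2)
      · filter_upwards [ae_restrict_of_ae (ae_circ_ne hy)] with φ hφ _ using hφ
      · exact Eventually.of_forall fun φ hφ => absurd hφ hy
    · have hd : MeasurableSet {w : (Fin m → ℝ) × ℝ | (s, w) ∈ circDomain m} :=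
        measurable_prodMk_left (isOpen_circDomain m).measurableSet
      have hc : MeasurableSet {w : (Fin m → ℝ) × ℝ |
          ∀ i, circ (s.1 - ∑ i, w.1 i) (s.2 - ∑ i, w.1 i ^ 2) w.2 i ≠ 0} := by
        have hcont : Continuous fun w : (Fin m → ℝ) × ℝ =>
            circ (s.1 - ∑ i, w.1 i) (s.2 - ∑ i, w.1 i ^ 2) w.2 :=
          continuous_circ.comp (f := fun w : (Fin m → ℝ) × ℝ =>
            ((s.1 - ∑ i, w.1 i, s.2 - ∑ i, w.1 i ^ 2), w.2)) (by fun_prop)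
        simp only [Set.ofPred_forall]
        exact MeasurableSet.iInter fun i =>
          (isOpen_ne_fun ((continuous_apply i).comp hcont) continuous_const).measurableSet
      have : {w : (Fin m → ℝ) × ℝ | (s, w) ∈ circDomain m →
          ∀ i, circ (s.1 - ∑ i, w.1 i) (s.2 - ∑ i, w.1 i ^ 2) w.2 i ≠ 0} =
          {w | (s, w) ∈ circDomain m}ᶜ ∪ {w : (Fin m → ℝ) × ℝ |
          ∀ i, circ (s.1 - ∑ i, w.1 i) (s.2 - ∑ i, w.1 i ^ 2) w.2 i ≠ 0} := by
        ext w
        exact imp_iff_not_or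
      rw [this]
      exact hd.compl.union hc
  filter_upwards [h1, h2, h3] with w hw1 hw2 hw3
  refine ⟨hw1, fun hd i => ?_⟩
  refine Fin.addCases (fun i => ?_) (fun i => ?_) i
  · simpa [pt] using hw2 i
  · simpa [pt] using hw3 hd i

lemma fst_mem_Icc_of_mem_posDomain {m : ℕ} {s : ℝ × ℝ} {w : (Fin m → ℝ) × ℝ}
    (h : (s, w) ∈ posDomain m) : w.1 ∈ Set.Icc (0 : Fin m → ℝ) (fun _ => s.1) := by
  have hpos := h.2
  have hle : ∀ i, pt s w i ≤ s.1 := fun i => by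
    have h1 := Finset.single_le_sum (f := pt s w) (fun j _ => (hpos j).le) (Finset.mem_univ i)
    have h2 := sum_pt s w
    linarith
  constructor
  · intro i
    have := hpos (Fin.castAdd 3 i)
    simpa [pt] using this.le
  · intro i
    have := hle (Fin.castAdd 3 i)
    simpa [pt] using this

lemma base_Icc_lt_top (m : ℕ) (L : ℝ) :
    base m (Set.Icc (0 : Fin m → ℝ) (fun _ => L) ×ˢ Set.univ) < ∞ := by
  rw [base, Measure.prod_prod]
  exact ENNReal.mul_lt_top isCompact_Icc.measure_lt_top (measure_lt_top _ _)

/-- Integral of `f` over the slice of the orthant with sum `s.1` and sum of squares `s.2`. -/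
def sliceIntegral (m : ℕ) (f : (Fin (m + 3) → ℝ) → ℝ) (s : ℝ × ℝ) : ℝ :=
  ∫ w, (posDomain m).indicator (fun t => f (pt t.1 t.2)) (s, w) ∂(base m)

lemma measurable_slice_integrand {m : ℕ} (f : (Fin (m + 3) → ℝ) →ᵇ ℝ) :
    Measurable ((posDomain m).indicator (fun t => f (pt t.1 t.2))) :=
  (f.continuous.comp (continuous_pt m)).measurable.indicator (isOpen_posDomain m).measurableSet

lemma stronglyMeasurable_sliceIntegral {m : ℕ} (f : (Fin (m + 3) → ℝ) →ᵇ ℝ) :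
    StronglyMeasurable (sliceIntegral m f) :=
  (measurable_slice_integrand f).stronglyMeasurable.integral_prod_right'

/-- Dominated convergence: off the null set of `ae_base_regular`, membership in `posDomain` is
locally constant in `s`, since either its strict inequalities hold or one of them fails strictly.
The hypothesis is the strict Cauchy–Schwarz inequality. -/
lemma continuousAt_sliceIntegral {m : ℕ} (f : (Fin (m + 3) → ℝ) →ᵇ ℝ) {s₀ : ℝ × ℝ}
    (h : s₀.1 ^ 2 < (m + 3) * s₀.2) : ContinuousAt (sliceIntegral m f) s₀ := by
  refine continuousAt_of_dominated (bound := (Set.Icc (0 : Fin m → ℝ) (fun _ => s₀.1 + 1) ×ˢ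
    (Set.univ : Set ℝ)).indicator fun _ => ‖f‖) ?_ ?_ ?_ ?_
  · exact Eventually.of_forall fun s =>
      ((measurable_slice_integrand f).comp measurable_prodMk_left).aestronglyMeasurable
  · have hev : ∀ᶠ s : ℝ × ℝ in 𝓝 s₀, s.1 < s₀.1 + 1 :=
      continuousAt_fst.eventually_lt continuousAt_const (by simp)
    filter_upwards [hev] with s hs
    refine Eventually.of_forall fun w => ?_
    by_cases hw : (s, w) ∈ posDomain m
    · rw [Set.indicator_of_mem hw, Set.indicator_of_mem]
      · exact f.norm_coe_le_norm _
      · have := fst_mem_Icc_of_mem_posDomain hw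
        exact ⟨⟨this.1, fun i => (this.2 i).trans hs.le⟩, Set.mem_univ _⟩
    · rw [Set.indicator_of_notMem hw, norm_zero]
      exact Set.indicator_nonneg (fun _ _ => norm_nonneg _) _
  · rw [integrable_indicator_iff (measurableSet_Icc.prod MeasurableSet.univ)]
    exact integrableOn_const (base_Icc_lt_top m _).ne
  · filter_upwards [ae_base_regular h] with w hw
    have hcont : Continuous fun s : ℝ × ℝ => pt s w :=
      (continuous_pt m).comp (f := fun s : ℝ × ℝ => (s, w)) (by fun_prop)
    have hpair : ContinuousAt (fun s : ℝ × ℝ => (s, w)) s₀ := by fun_prop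
    by_cases hd : (s₀, w) ∈ posDomain m
    · have hev : ∀ᶠ s in 𝓝 s₀, (s, w) ∈ posDomain m :=
        hpair.eventually ((isOpen_posDomain m).mem_nhds hd)
      refine ContinuousAt.congr (f := fun s => f (pt s w)) ?_ ?_
      · exact (f.continuous.comp hcont).continuousAt
      · filter_upwards [hev] with s hs
        rw [Set.indicator_of_mem hs]
    · have hev : ∀ᶠ s in 𝓝 s₀, (s, w) ∉ posDomain m := by
        rcases lt_or_gt_of_ne hw.1 with hlt | hgt
        · have : ∃ i, pt s₀ w i < 0 := by
            by_contra! hc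
            exact hd ⟨hlt, fun i => lt_of_le_of_ne (hc i) (hw.2 hlt i).symm⟩
          obtain ⟨i, hi⟩ := this
          have : ∀ᶠ s in 𝓝 s₀, pt s w i < 0 :=
            ((continuous_apply i).comp hcont).continuousAt.eventually_lt continuousAt_const hi
          filter_upwards [this] with s hs hs'
          exact lt_asymm hs (hs'.2 i)
        · have : ∀ᶠ s : ℝ × ℝ in 𝓝 s₀,
              3 * (s.2 - ∑ i, w.1 i ^ 2) < (s.1 - ∑ i, w.1 i) ^ 2 := by
            refine ContinuousAt.eventually_lt ?_ ?_ hgt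
            · fun_prop
            · fun_prop
          filter_upwards [this] with s hs hs'
          exact lt_asymm hs hs'.1
      refine ContinuousAt.congr (f := fun _ => (0 : ℝ)) continuousAt_const ?_
      filter_upwards [hev] with s hs
      rw [Set.indicator_of_notMem hs]

lemma tendsto_average_ball {g : ℝ × ℝ → ℝ} {s₀ : ℝ × ℝ} (hg : StronglyMeasurable g)
    (hc : ContinuousAt g s₀) :
    Tendsto (fun ε : ℝ => (∫ s in Metric.ball s₀ ε, g s) / (volume.real (Metric.ball s₀ ε)))
      (𝓝[>] 0) (𝓝 (g s₀)) := by
  have hs : Tendsto (fun ε : ℝ => Metric.ball s₀ ε) (𝓝[>] 0) (𝓝 s₀).smallSets := by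
    rw [tendsto_smallSets_iff]
    intro t ht
    obtain ⟨δ, hδ, hsub⟩ := Metric.mem_nhds_iff.1 ht
    filter_upwards [Ioo_mem_nhdsGT hδ] with ε hε
    exact (Metric.ball_subset_ball hε.2.le).trans hsub
  have h := (hc.mono_left inf_le_left : Tendsto g (𝓝 s₀ ⊓ ae volume) (𝓝 (g s₀)))
    |>.integral_sub_linear_isLittleO_ae (hg.stronglyMeasurableAtFilter)
      ((volume : Measure (ℝ × ℝ)).finiteAt_nhds s₀) hs
  have h2 := h.tendsto_div_nhds_zero
  have h3 := h2.add_const (g s₀)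
  rw [zero_add] at h3
  refine h3.congr' ?_
  filter_upwards [self_mem_nhdsWithin] with ε hε
  have hpos : 0 < volume.real (Metric.ball s₀ ε) :=
    ENNReal.toReal_pos (Metric.measure_ball_pos volume _ hε).ne' measure_ball_lt_top.ne
  rw [smul_eq_mul]
  field_simp
  ring

lemma setIntegral_shell {m : ℕ} (b ε : ℝ) (f : (Fin (m + 3) → ℝ) →ᵇ ℝ) :
    ∫ x in shell (m + 3) b ε, f x = jac.toReal *
      ∫ s in Metric.ball (((m + 3 : ℕ) : ℝ), ((m + 3 : ℕ) : ℝ) * b) ε, sliceIntegral m f s := by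
  set s₀ : ℝ × ℝ := (((m + 3 : ℕ) : ℝ), ((m + 3 : ℕ) : ℝ) * b)
  have hU := (isOpen_posDomain m).measurableSet
  have hB : MeasurableSet (Metric.ball s₀ ε ×ˢ (Set.univ : Set ((Fin m → ℝ) × ℝ))) :=
    Metric.isOpen_ball.measurableSet.prod MeasurableSet.univ
  rw [volume_restrict_shell, integral_smul_measure, smul_eq_mul,
    integral_map (continuous_pt m).measurable.aemeasurable f.continuous.aestronglyMeasurable]
  congr 1
  have hfin : (volume : Measure (ℝ × ℝ)).prod (base m)
      (posDomain m ∩ Metric.ball s₀ ε ×ˢ Set.univ) < ∞ := by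
    refine lt_of_le_of_lt (measure_mono (t := Metric.ball s₀ ε ×ˢ
      (Set.Icc (0 : Fin m → ℝ) (fun _ => s₀.1 + ε) ×ˢ Set.univ)) ?_) ?_
    · rintro ⟨s, w⟩ ⟨h1, h2, -⟩
      have h3 := fst_mem_Icc_of_mem_posDomain h1
      have h4 : s.1 < s₀.1 + ε := by
        have := h2
        rw [Metric.mem_ball, Prod.dist_eq, max_lt_iff, Real.dist_eq] at this
        have := (abs_lt.1 this.1).2
        linarith
      exact ⟨h2, ⟨h3.1, fun i => (h3.2 i).trans h4.le⟩, Set.mem_univ _⟩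
    · rw [Measure.prod_prod]
      exact ENNReal.mul_lt_top measure_ball_lt_top (base_Icc_lt_top m _)
  have hint : Integrable ((posDomain m).indicator (fun t => f (pt t.1 t.2)))
      (((volume : Measure (ℝ × ℝ)).restrict (Metric.ball s₀ ε)).prod (base m)) := by
    have : ((volume : Measure (ℝ × ℝ)).restrict (Metric.ball s₀ ε)).prod (base m) =
        ((volume : Measure (ℝ × ℝ)).prod (base m)).restrict
          (Metric.ball s₀ ε ×ˢ Set.univ) := by
      rw [← Measure.prod_restrict, Measure.restrict_univ]
    rw [this, integrable_indicator_iff hU, IntegrableOn, Measure.restrict_restrict hU]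
    exact Measure.integrableOn_of_bounded hfin.ne
      (f.continuous.comp (continuous_pt m)).aestronglyMeasurable
      (Eventually.of_forall fun t => f.norm_coe_le_norm _)
  have h2 : ∫ s in Metric.ball s₀ ε, sliceIntegral m f s =
      ∫ t, (posDomain m).indicator (fun t => f (pt t.1 t.2)) t
        ∂(((volume : Measure (ℝ × ℝ)).restrict (Metric.ball s₀ ε)).prod (base m)) := by
    rw [integral_prod _ hint]
    rfl
  rw [h2, integral_indicator hU]
  congr 1
  rw [← Measure.restrict_restrict hU, ← Measure.prod_restrict, Measure.restrict_univ]

/-! ### Existence and uniqueness of the uniform distribution -/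

/-- The sum and the sum of squares of the points of `K (m + 3) b`. -/
def center (m : ℕ) (b : ℝ) : ℝ × ℝ := (((m + 3 : ℕ) : ℝ), ((m + 3 : ℕ) : ℝ) * b)

/-- Parameters of the points of `K (m + 3) b`. -/
def slice (m : ℕ) (b : ℝ) : Set ((Fin m → ℝ) × ℝ) := {w | (center m b, w) ∈ posDomain m}

lemma isOpen_slice (m : ℕ) (b : ℝ) : IsOpen (slice m b) :=
  (isOpen_posDomain m).preimage (by fun_prop)

lemma center_sq_lt {m : ℕ} {b : ℝ} (hb : 1 < b) :
    (center m b).1 ^ 2 < (m + 3) * (center m b).2 := by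
  simp only [center]
  push_cast
  have : (0 : ℝ) < (m + 3) ^ 2 := by positivity
  nlinarith

lemma base_slice_ne_top (m : ℕ) (b : ℝ) : base m (slice m b) ≠ ∞ := by
  refine (lt_of_le_of_lt (measure_mono ?_) (base_Icc_lt_top m (center m b).1)).ne
  exact fun w hw => ⟨fst_mem_Icc_of_mem_posDomain hw, Set.mem_univ _⟩

/-- At this angle two coordinates equal `p / 3 - √(q - p² / 3) / √6` and the third is larger. Their
positivity amounts to `q < p ^ 2`. -/
lemma circ_neg_pi_div_two_pos {p q : ℝ} (hp : 0 < p) (h1 : p ^ 2 < 3 * q) (h2 : q < p ^ 2) :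
    ∀ i, 0 < circ p q (-(Real.pi / 2)) i := by
  have hβ : 0 < (√6 : ℝ)⁻¹ := by positivity
  have hβ2 := inv_sqrt_six_sq
  have hρ0 : 0 ≤ √(q - p ^ 2 / 3) := Real.sqrt_nonneg _
  have hρ2 : √(q - p ^ 2 / 3) ^ 2 = q - p ^ 2 / 3 := Real.sq_sqrt (by linarith)
  have key : √(q - p ^ 2 / 3) * (√6)⁻¹ < p / 3 := by
    refine lt_of_pow_lt_pow_left₀ 2 (by positivity) ?_
    rw [mul_pow, hρ2, hβ2]
    nlinarith
  intro i
  fin_cases i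
  · simp [circ]; linarith
  · simp [circ]; linarith
  · simp [circ]
    have : 0 ≤ √(q - p ^ 2 / 3) * (2 * (√6)⁻¹) := by positivity
    linarith

/-- A point of the slice with all free coordinates equal to `t`. If `t = 1` leaves too large a sum
of squares, then `m ≥ 3`, and the intermediate value theorem gives a `t` at which the remainders
satisfy `2 q = p ^ 2`, strictly between the two constraints. -/
lemma exists_balanced {m : ℕ} {b : ℝ} (hb1 : 1 < b) (hb2 : b ≤ 2) :
    ∃ t : ℝ, 0 < t ∧ t ≤ 1 ∧
      ((center m b).1 - m * t) ^ 2 < 3 * ((center m b).2 - m * t ^ 2) ∧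
      (center m b).2 - m * t ^ 2 < ((center m b).1 - m * t) ^ 2 := by
  simp only [center]
  push_cast
  have hm : (0 : ℝ) ≤ m := Nat.cast_nonneg m
  by_cases h1 : (m + 3) * b - m * 1 ^ 2 < ((m + 3 : ℝ) - m * 1) ^ 2
  · refine ⟨1, one_pos, le_rfl, ?_, h1⟩
    nlinarith
  · have hcont : ContinuousOn (fun t : ℝ => 2 * ((m + 3) * b - m * t ^ 2) -
        ((m + 3 : ℝ) - m * t) ^ 2) (Set.Icc 0 1) := by fun_prop
    have hm3 : (3 : ℝ) ≤ m := by nlinarith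
    have h0 : 2 * ((m + 3) * b - m * (0 : ℝ) ^ 2) - ((m + 3 : ℝ) - m * 0) ^ 2 < 0 := by nlinarith
    obtain ⟨t, ht, hgt⟩ := intermediate_value_Icc (zero_le_one) hcont
      (show (0 : ℝ) ∈ _ from ⟨h0.le, by nlinarith⟩)
    simp only at hgt
    have ht0 : 0 < t := by
      refine lt_of_le_of_ne ht.1 fun h => ?_
      rw [← h] at hgt
      exact h0.ne hgt
    have hp : 0 < (m + 3 : ℝ) - m * t := by nlinarith [ht.2]
    have hp2 := pow_pos hp 2
    exact ⟨t, ht0, ht.2, by linarith, by linarith⟩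

lemma base_slice_ne_zero {m : ℕ} {b : ℝ} (hb1 : 1 < b) (hb2 : b ≤ 2) :
    base m (slice m b) ≠ 0 := by
  obtain ⟨t, ht0, ht1, h1, h2⟩ := exists_balanced (m := m) hb1 hb2
  have hmem : ((fun _ => t, -(Real.pi / 2)) : (Fin m → ℝ) × ℝ) ∈
      slice m b ∩ Set.univ ×ˢ Set.Ioo (-Real.pi) Real.pi := by
    refine ⟨⟨?_, ?_⟩, Set.mem_univ _, ?_⟩
    · simpa [circDomain] using h1
    · have hp : 0 < (center m b).1 - m * t := by
        simp only [center]
        push_cast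
        have : (0 : ℝ) ≤ m := Nat.cast_nonneg m
        nlinarith
      have h3 := circ_neg_pi_div_two_pos hp h1 h2
      intro i
      refine Fin.addCases (fun i => ?_) (fun i => ?_) i
      · simpa [pt] using ht0
      · simpa [pt] using h3 i
    · constructor <;> simp only <;> linarith [Real.pi_pos]
  have hopen : IsOpen (slice m b ∩ Set.univ ×ˢ Set.Ioo (-Real.pi) Real.pi) :=
    (isOpen_slice m b).inter (isOpen_univ.prod isOpen_Ioo)
  have hbase : base m = ((volume : Measure (Fin m → ℝ)).prod (volume : Measure ℝ)).restrict
      (Set.univ ×ˢ Set.Ioo (-Real.pi) Real.pi) := by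
    rw [base, ← Measure.prod_restrict, Measure.restrict_univ]
  rw [hbase, Measure.restrict_apply (isOpen_slice m b).measurableSet]
  exact (hopen.measure_pos _ ⟨_, hmem⟩).ne'

/-- The uniform distribution on `K (m + 3) b`. -/
def unif (m : ℕ) (b : ℝ) : Measure (Fin (m + 3) → ℝ) :=
  (cond (base m) (slice m b)).map (pt (center m b))

lemma continuous_pt_right {m : ℕ} (s : ℝ × ℝ) : Continuous (pt (m := m) s) :=
  (continuous_pt m).comp (f := fun w : (Fin m → ℝ) × ℝ => (s, w)) (by fun_prop)

lemma sliceIntegral_center {m : ℕ} {b : ℝ} (f : (Fin (m + 3) → ℝ) → ℝ) :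
    sliceIntegral m f (center m b) = ∫ w in slice m b, f (pt (center m b) w) ∂(base m) := by
  rw [sliceIntegral, ← integral_indicator (isOpen_slice m b).measurableSet]
  rfl

lemma integral_unif {m : ℕ} {b : ℝ} (f : (Fin (m + 3) → ℝ) →ᵇ ℝ) :
    ∫ x, f x ∂(unif m b) =
      sliceIntegral m f (center m b) / (base m).real (slice m b) := by
  rw [unif, integral_map (continuous_pt_right _).measurable.aemeasurable
    f.continuous.aestronglyMeasurable, ProbabilityTheory.cond, integral_smul_measure,
    sliceIntegral_center, ENNReal.toReal_inv, smul_eq_mul, div_eq_inv_mul]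
  rfl

lemma setIntegral_one_eq (m : ℕ) (b : ℝ) :
    sliceIntegral m (fun _ => (1 : ℝ)) (center m b) = (base m).real (slice m b) := by
  rw [sliceIntegral_center]
  simp

lemma measurableSet_K (n : ℕ) (b : ℝ) : MeasurableSet (K n b) := by
  have h1 : MeasurableSet {x : Fin n → ℝ | ∀ i, 0 < x i} := by
    simp only [Set.ofPred_forall]
    exact MeasurableSet.iInter fun i => measurableSet_lt measurable_const (measurable_pi_apply i)
  have h2 : MeasurableSet {x : Fin n → ℝ | ∑ i, x i = n ∧ ∑ i, x i ^ 2 = n * b} :=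
    (measurableSet_eq_fun (by fun_prop) (by fun_prop)).inter
      (measurableSet_eq_fun (by fun_prop) (by fun_prop))
  exact h1.inter h2

/-- In the plane of the two sums the shell lies over a sup-norm ball. The shell mean of `f` is the
ratio of the averages of two slice integrals over this ball; both converge by continuity at the
centre, and the Jacobian and the area cancel. -/
lemma isUniformOnK_unif {m : ℕ} {b : ℝ} (hb1 : 1 < b) (hb2 : b ≤ 2) :
    IsUniformOnK (m + 3) b (unif m b) := by
  have h0 := base_slice_ne_zero (m := m) hb1 hb2
  have ht := base_slice_ne_top m b
  have hreal : (base m).real (slice m b) ≠ 0 := (ENNReal.toReal_pos h0 ht).ne'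
  have hprob : IsProbabilityMeasure (cond (base m) (slice m b)) :=
    cond_isProbabilityMeasure_of_finite h0 ht
  refine ⟨?_, ?_, ?_⟩
  · exact Measure.isProbabilityMeasure_map (continuous_pt_right _).measurable.aemeasurable
  · refine (ae_map_iff (continuous_pt_right _).measurable.aemeasurable (measurableSet_K _ b)).2 ?_
    have h1 : ∀ᵐ w ∂(cond (base m) (slice m b)), w ∈ slice m b :=
      ae_cond_mem (isOpen_slice m b).measurableSet
    filter_upwards [h1] with w hw
    exact ⟨hw.2, sum_pt _ _, sum_pt_sq hw.1⟩
  · intro f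
    have hf := tendsto_average_ball (stronglyMeasurable_sliceIntegral f)
      (continuousAt_sliceIntegral f (center_sq_lt hb1 : (center m b).1 ^ 2 < _))
    have h1 := tendsto_average_ball (stronglyMeasurable_sliceIntegral
        (BoundedContinuousFunction.const (Fin (m + 3) → ℝ) (1 : ℝ)))
      (continuousAt_sliceIntegral _ (center_sq_lt hb1 : (center m b).1 ^ 2 < _))
    have hone : sliceIntegral m (BoundedContinuousFunction.const (Fin (m + 3) → ℝ) (1 : ℝ))
      (center m b) = (base m).real (slice m b) := setIntegral_one_eq m b
    have h2 := hf.div h1 (by rwa [hone])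
    rw [integral_unif, ← hone]
    refine h2.congr' ?_
    filter_upwards [self_mem_nhdsWithin] with ε hε
    have hpos : 0 < volume.real (Metric.ball (center m b) ε) :=
      ENNReal.toReal_pos (Metric.measure_ball_pos volume _ hε).ne' measure_ball_lt_top.ne
    have hjac : jac.toReal ≠ 0 := (ENNReal.toReal_pos jac_ne_zero jac_ne_top).ne'
    have e1 : ∫ x in shell (m + 3) b ε, f x = jac.toReal *
      ∫ s in Metric.ball (center m b) ε, sliceIntegral m f s := setIntegral_shell b ε f
    have e2 : ∫ x in shell (m + 3) b ε, (1 : ℝ) = jac.toReal *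
      ∫ s in Metric.ball (center m b) ε, sliceIntegral m
        (BoundedContinuousFunction.const (Fin (m + 3) → ℝ) (1 : ℝ)) s :=
      setIntegral_shell (m := m) b ε (BoundedContinuousFunction.const _ (1 : ℝ))
    simp only [integral_const, smul_eq_mul, mul_one,
      measureReal_restrict_apply_univ] at e2
    rw [ProbabilityTheory.cond, integral_smul_measure, ENNReal.toReal_inv, smul_eq_mul, e1,
      ← Measure.real, e2, Pi.div_apply]
    rw [div_div_div_cancel_right₀ hpos.ne', mul_inv, mul_mul_mul_comm, inv_mul_cancel₀ hjac,
      one_mul, div_eq_inv_mul]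

lemma IsUniformOnK.unique {n : ℕ} {b : ℝ} {P Q : Measure (Fin n → ℝ)}
    (hP : IsUniformOnK n b P) (hQ : IsUniformOnK n b Q) : P = Q := by
  have := hP.isProbabilityMeasure
  have := hQ.isProbabilityMeasure
  exact ext_of_forall_integral_eq_of_IsFiniteMeasure fun f =>
    tendsto_nhds_unique (hP.tendsto_shell f) (hQ.tendsto_shell f)

/-- The shells and Lebesgue measure are invariant under permutations, so the permuted law is a weak
limit of the same measures. -/
lemma IsUniformOnK.map_perm {n : ℕ} {b : ℝ} {P : Measure (Fin n → ℝ)} (hP : IsUniformOnK n b P)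
    (σ : Equiv.Perm (Fin n)) : P.map (fun x i => x (σ i)) = P := by
  have := hP.isProbabilityMeasure
  have hmeas : Measurable fun (x : Fin n → ℝ) i => x (σ i) := by fun_prop
  refine IsUniformOnK.unique (b := b) ⟨?_, ?_, ?_⟩ hP
  · exact Measure.isProbabilityMeasure_map hmeas.aemeasurable
  · refine (ae_map_iff hmeas.aemeasurable (measurableSet_K n b)).2 ?_
    filter_upwards [hP.ae_mem] with x hx
    exact ⟨fun i => hx.1 _, (Equiv.sum_comp σ x).trans hx.2.1,
      (Equiv.sum_comp σ fun i => x i ^ 2).trans hx.2.2⟩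
  · intro f
    have hcont : Continuous fun (x : Fin n → ℝ) i => x (σ i) := by fun_prop
    have h := hP.tendsto_shell (f.compContinuous ⟨_, hcont⟩)
    rw [integral_map hmeas.aemeasurable f.continuous.aestronglyMeasurable]
    refine h.congr fun ε => ?_
    rw [ProbabilityTheory.cond, integral_smul_measure, integral_smul_measure]
    congr 1
    have hpres := volume_measurePreserving_piCongrLeft (fun _ : Fin n => ℝ) σ.symm
    have hfun : ∀ x : Fin n → ℝ,
        MeasurableEquiv.piCongrLeft (fun _ : Fin n => ℝ) σ.symm x = fun i => x (σ i) := by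
      intro x
      ext i
      have := MeasurableEquiv.piCongrLeft_apply_apply (β := fun _ : Fin n => ℝ) σ.symm x (σ i)
      simpa using this
    have h2 := hpres.setIntegral_preimage_emb
      (MeasurableEquiv.measurableEmbedding _) f (shell n b ε)
    rw [← h2]
    have hpre : MeasurableEquiv.piCongrLeft (fun _ : Fin n => ℝ) σ.symm ⁻¹' shell n b ε =
        shell n b ε := by
      ext x
      simp only [Set.mem_preimage, hfun, shell, Set.mem_ofPred_eq]
      rw [Equiv.sum_comp σ x, Equiv.sum_comp σ fun i => x i ^ 2,
        Equiv.forall_congr_left σ]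
      simp
    rw [hpre]
    simp only [hfun]
    rfl

theorem existsUnique_isUniformOnK {n : ℕ} (hn : 3 ≤ n) {b : ℝ} (hb1 : 1 < b) (hb2 : b ≤ 2) :
    ∃! P : Measure (Fin n → ℝ), IsUniformOnK n b P := by
  obtain ⟨m, rfl⟩ := Nat.exists_eq_add_of_le' hn
  exact ⟨unif m b, isUniformOnK_unif hb1 hb2, fun Q hQ => hQ.unique (isUniformOnK_unif hb1 hb2)⟩

/-! ### The one-coordinate limit law -/

lemma integral_linear_comb {α : Type*} [MeasurableSpace α] {μ : Measure α} {f g h : α → ℝ}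
    (hf : Integrable f μ) (hg : Integrable g μ) (hh : Integrable h μ) (a b c : ℝ) :
    Integrable (fun x => a * f x + b * g x + c * h x) μ ∧
      ∫ x, (a * f x + b * g x + c * h x) ∂μ = a * ∫ x, f x ∂μ + b * ∫ x, g x ∂μ + c * ∫ x, h x ∂μ := by
  have hfg : Integrable (fun x => a * f x + b * g x) μ := (hf.const_mul a).add (hg.const_mul b)
  refine ⟨hfg.add (hh.const_mul c), ?_⟩
  rw [integral_add hfg (hh.const_mul c), integral_add (hf.const_mul a) (hg.const_mul b),
    integral_const_mul, integral_const_mul, integral_const_mul]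

lemma weight_pos (r s x : ℝ) : 0 < weight r s x := Real.exp_pos _

lemma continuous_weight (r s : ℝ) : Continuous (weight r s) := by
  unfold weight; fun_prop

/-- The normalizing constant of the density. -/
def mass (r s : ℝ) : ℝ≥0∞ := ∫⁻ x in Set.Ici 0, ENNReal.ofReal (weight r s x)

lemma mass_ne_zero (r s : ℝ) : mass r s ≠ 0 := by
  have hm : Measurable fun x => ENNReal.ofReal (weight r s x) :=
    (continuous_weight r s).measurable.ennreal_ofReal
  rw [mass, ne_eq, lintegral_eq_zero_iff hm]
  intro h
  have h2 : ∀ᵐ x ∂(volume.restrict (Set.Ici (0 : ℝ))), False := by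
    filter_upwards [h] with x hx
    have : ENNReal.ofReal (weight r s x) = 0 := hx
    rw [ENNReal.ofReal_eq_zero] at this
    exact absurd (weight_pos r s x) (not_lt.2 this)
  rw [eventually_false_iff_eq_bot, ae_eq_bot, Measure.restrict_eq_zero] at h2
  simp at h2

lemma mass_ne_top_of_integrableOn {r s : ℝ} (h : IntegrableOn (weight r s) (Set.Ici 0)) :
    mass r s ≠ ∞ := h.lintegral_lt_top.ne

lemma G_univ (r s : ℝ) : G r s Set.univ = (mass r s)⁻¹ * mass r s := by
  rw [G, Measure.smul_apply, withDensity_apply _ MeasurableSet.univ, Measure.restrict_univ,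
    smul_eq_mul, mass]

lemma isProbabilityMeasure_G {r s : ℝ} (h : mass r s ≠ ∞) : IsProbabilityMeasure (G r s) :=
  ⟨by rw [G_univ, ENNReal.inv_mul_cancel (mass_ne_zero r s) h]⟩

lemma mass_ne_top {r s : ℝ} (h : IsProbabilityMeasure (G r s)) : mass r s ≠ ∞ := by
  intro h1
  have := h.measure_univ
  -- With infinite normalizing constant the total mass of `G r s` is `0 * ∞ = 0`, not `1`.
  rw [G_univ, h1] at this
  simp at this

lemma integral_G (r s : ℝ) (f : ℝ → ℝ) :
    ∫ x, f x ∂(G r s) = (mass r s).toReal⁻¹ * ∫ x in Set.Ici 0, weight r s x * f x := by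
  rw [G, integral_smul_measure, integral_withDensity_eq_integral_toReal_smul
    (continuous_weight r s).measurable.ennreal_ofReal (by simp)]
  simp only [ENNReal.toReal_ofReal (weight_pos r s _).le, smul_eq_mul, ENNReal.toReal_inv]
  rfl

lemma integrable_G_iff {r s : ℝ} (h : mass r s ≠ ∞) (f : ℝ → ℝ) :
    Integrable f (G r s) ↔ IntegrableOn (fun x => weight r s x * f x) (Set.Ici 0) := by
  rw [G, ← mass, integrable_smul_measure (ENNReal.inv_ne_zero.2 h) (ENNReal.inv_ne_top.2
    (mass_ne_zero r s)), integrable_withDensity_iff_integrable_smul'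
    (continuous_weight r s).measurable.ennreal_ofReal (by simp)]
  simp only [ENNReal.toReal_ofReal (weight_pos r s _).le, smul_eq_mul]
  rfl

lemma mass_toReal {r s : ℝ} :
    (mass r s).toReal = ∫ x in Set.Ici 0, weight r s x := by
  rw [integral_eq_lintegral_of_nonneg_ae (Eventually.of_forall fun x => (weight_pos r s x).le)
    (continuous_weight r s).aestronglyMeasurable]
  rfl

lemma mass_toReal_pos {r s : ℝ} (h : mass r s ≠ ∞) : 0 < (mass r s).toReal :=
  ENNReal.toReal_pos (mass_ne_zero r s) h

lemma hasMoments_of_integral {r s b : ℝ} (h0 : IntegrableOn (weight r s) (Set.Ici 0))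
    (h1 : IntegrableOn (fun x => x * weight r s x) (Set.Ici 0))
    (h2 : IntegrableOn (fun x => x ^ 2 * weight r s x) (Set.Ici 0))
    (e1 : ∫ x in Set.Ici 0, x * weight r s x = ∫ x in Set.Ici 0, weight r s x)
    (e2 : ∫ x in Set.Ici 0, x ^ 2 * weight r s x = b * ∫ x in Set.Ici 0, weight r s x) :
    HasMoments r s b := by
  have ht := mass_ne_top_of_integrableOn h0
  have hpos := mass_toReal_pos ht
  refine ⟨isProbabilityMeasure_G ht, ?_, ?_, ?_, ?_⟩
  · rw [integrable_G_iff ht]; simpa only [mul_comm] using h1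
  · rw [integrable_G_iff ht]; simpa only [mul_comm] using h2
  · rw [integral_G]
    simp only [mul_comm (weight r s _)]
    rw [e1, ← mass_toReal, inv_mul_cancel₀ hpos.ne']
  · rw [integral_G]
    simp only [mul_comm (weight r s _)]
    rw [e2, ← mass_toReal, mul_left_comm, inv_mul_cancel₀ hpos.ne', mul_one]

/-- Symmetrized relative entropy: `D` is the logarithm of the ratio of the two densities and a
quadratic polynomial, so both laws give it the same mean. Hence the difference of the densities
times `D` has integral zero. This integrand is nonnegative, since `y (exp y - 1) ≥ 0`, so `D`
vanishes on the half-line and its coefficients are zero. -/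
lemma HasMoments.unique {r s r' s' b : ℝ} (h : HasMoments r s b) (h' : HasMoments r' s' b) :
    r = r' ∧ s = s' := by
  have := h.isProbabilityMeasure
  have := h'.isProbabilityMeasure
  have ht := mass_ne_top h.isProbabilityMeasure
  have ht' := mass_ne_top h'.isProbabilityMeasure
  have hA := mass_toReal_pos ht
  have hA' := mass_toReal_pos ht'
  set A := (mass r s).toReal
  set A' := (mass r' s').toReal
  set D : ℝ → ℝ := fun x => (r' - r) * x ^ 2 + (s' - s) * x + (Real.log A' - Real.log A) with hD
  have hDcont : Continuous D := by fun_prop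
  have hint : ∀ {u v : ℝ}, HasMoments u v b → Integrable D (G u v) ∧
      ∫ x, D x ∂(G u v) = (r' - r) * b + (s' - s) * 1 + (Real.log A' - Real.log A) := by
    intro u v hu
    have := hu.isProbabilityMeasure
    have h3 := integral_linear_comb hu.integrable_sq hu.integrable_id
      (integrable_const (μ := G u v) (1 : ℝ)) (r' - r) (s' - s) (Real.log A' - Real.log A)
    rw [hu.first_moment, hu.second_moment] at h3
    simp only [mul_one, integral_const, probReal_univ, smul_eq_mul] at h3
    simpa only [mul_one] using h3
  have hexp : ∀ x, A⁻¹ * weight r s x = A'⁻¹ * weight r' s' x * Real.exp (D x) := by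
    intro x
    have : Real.exp (D x) = Real.exp ((r' - r) * x ^ 2 + (s' - s) * x) * (A' / A) := by
      rw [hD]
      simp only
      rw [Real.exp_add, Real.exp_sub, Real.exp_log hA, Real.exp_log hA']
    rw [this, weight, weight]
    have e : Real.exp (-(r' * x ^ 2) - s' * x) * Real.exp ((r' - r) * x ^ 2 + (s' - s) * x) =
        Real.exp (-(r * x ^ 2) - s * x) := by
      rw [← Real.exp_add]; ring_nf
    rw [← e]
    field_simp
  have i1 := (integrable_G_iff ht D).1 (hint h).1
  have i2 := (integrable_G_iff ht' D).1 (hint h').1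
  have e1 := integral_G r s D
  have e2 := integral_G r' s' D
  rw [(hint h).2] at e1
  rw [(hint h').2] at e2
  have key : ∫ x in Set.Ici 0, (A⁻¹ * (weight r s x * D x) - A'⁻¹ * (weight r' s' x * D x)) = 0 := by
    rw [integral_sub (i1.const_mul _) (i2.const_mul _), integral_const_mul, integral_const_mul,
      ← e1, ← e2, sub_self]
  have hform : ∀ x, A⁻¹ * (weight r s x * D x) - A'⁻¹ * (weight r' s' x * D x) =
      A'⁻¹ * weight r' s' x * (D x * (Real.exp (D x) - 1)) := by
    intro x
    rw [← mul_assoc, hexp]; ring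
  have hnn : ∀ y : ℝ, 0 ≤ y * (Real.exp y - 1) := by
    intro y
    rcases le_total 0 y with hy | hy
    · exact mul_nonneg hy (by linarith [Real.add_one_le_exp y])
    · exact mul_nonneg_of_nonpos_of_nonpos hy (by linarith [Real.exp_le_one_iff.2 hy])
  have hw : ∀ x, 0 < A'⁻¹ * weight r' s' x := fun x => mul_pos (inv_pos.2 hA') (weight_pos _ _ _)
  rw [integral_eq_zero_iff_of_nonneg] at key
  rotate_left
  · intro x
    simp only [Pi.zero_apply]
    rw [hform]
    exact mul_nonneg (hw x).le (hnn _)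
  · exact (i1.const_mul _).sub (i2.const_mul _)
  have hzero : ∀ᵐ x ∂(volume.restrict (Set.Ioi (0 : ℝ))), D x = (fun _ => (0 : ℝ)) x := by
    have := ae_restrict_of_ae_restrict_of_subset Set.Ioi_subset_Ici_self key
    filter_upwards [this] with x hx
    have hx' : A⁻¹ * (weight r s x * D x) - A'⁻¹ * (weight r' s' x * D x) = 0 := hx
    rw [hform] at hx'
    rcases mul_eq_zero.1 ((mul_eq_zero.1 hx').resolve_left (hw x).ne') with h0 | h0
    · exact h0
    · exact Real.exp_eq_one_iff _ |>.1 (by linarith)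
  have hEq := Measure.eqOn_open_of_ae_eq hzero isOpen_Ioi hDcont.continuousOn continuousOn_const
  have d1 := hEq (show (1 : ℝ) ∈ Set.Ioi 0 by simp)
  have d2 := hEq (show (2 : ℝ) ∈ Set.Ioi 0 by simp)
  have d3 := hEq (show (3 : ℝ) ∈ Set.Ioi 0 by simp)
  simp only [hD] at d1 d2 d3
  constructor <;> linarith

/-- Moments of the exponential density tilted towards `1`. -/
def tilt (k : ℕ) (t : ℝ) : ℝ :=
  ∫ x in Set.Ioi (0 : ℝ), x ^ k * (Real.exp (-x) * Real.exp (-(t * (x - 1) ^ 2)))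

lemma integrableOn_pow_mul_exp (k : ℕ) :
    IntegrableOn (fun x : ℝ => x ^ k * Real.exp (-x)) (Set.Ioi 0) := by
  have h := Real.GammaIntegral_convergent (s := k + 1) (by positivity)
  refine h.congr_fun (fun x hx => ?_) measurableSet_Ioi
  simp only [add_sub_cancel_right, Real.rpow_natCast]
  ring

lemma integral_pow_mul_exp (k : ℕ) :
    ∫ x in Set.Ioi (0 : ℝ), x ^ k * Real.exp (-x) = k.factorial := by
  rw [← Real.Gamma_nat_eq_factorial, Real.Gamma_eq_integral (by positivity)]
  refine setIntegral_congr_fun measurableSet_Ioi fun x hx => ?_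
  simp only [add_sub_cancel_right, Real.rpow_natCast]
  ring

lemma integrableOn_tilt (k : ℕ) {t : ℝ} (ht : 0 ≤ t) :
    IntegrableOn (fun x : ℝ => x ^ k * (Real.exp (-x) * Real.exp (-(t * (x - 1) ^ 2))))
      (Set.Ioi 0) := by
  refine (integrableOn_pow_mul_exp k).mono' (by fun_prop) ?_
  refine (ae_restrict_iff' measurableSet_Ioi).2 (Eventually.of_forall fun x hx => ?_)
  have hx' : (0 : ℝ) < x := hx
  rw [Real.norm_of_nonneg (by positivity)]
  refine mul_le_mul_of_nonneg_left ?_ (by positivity)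
  refine mul_le_of_le_one_right (Real.exp_pos _).le ?_
  rw [Real.exp_le_one_iff]
  have : 0 ≤ t * (x - 1) ^ 2 := by positivity
  linarith

lemma tilt_zero (k : ℕ) : tilt k 0 = k.factorial := by
  rw [← integral_pow_mul_exp, tilt]
  simp

lemma continuousOn_tilt (k : ℕ) : ContinuousOn (tilt k) (Set.Ici 0) := by
  unfold tilt
  refine continuousOn_of_dominated (bound := fun x => x ^ k * Real.exp (-x)) ?_ ?_
    (integrableOn_pow_mul_exp k) ?_
  · exact fun t ht => (integrableOn_tilt k ht).aestronglyMeasurable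
  · intro t ht
    refine (ae_restrict_iff' measurableSet_Ioi).2 (Eventually.of_forall fun x hx => ?_)
    have hx' : (0 : ℝ) < x := hx
    rw [Real.norm_of_nonneg (by positivity)]
    refine mul_le_mul_of_nonneg_left ?_ (by positivity)
    refine mul_le_of_le_one_right (Real.exp_pos _).le ?_
    rw [Real.exp_le_one_iff]
    have : 0 ≤ t * (x - 1) ^ 2 := mul_nonneg ht (sq_nonneg _)
    linarith
  · exact Eventually.of_forall fun x => by fun_prop

lemma tilt_pos (k : ℕ) {t : ℝ} (ht : 0 ≤ t) : 0 < tilt k t := by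
  rw [tilt, setIntegral_pos_iff_support_of_nonneg_ae]
  · have : Function.support (fun x : ℝ => x ^ k * (Real.exp (-x) *
        Real.exp (-(t * (x - 1) ^ 2)))) ∩ Set.Ioi 0 = Set.Ioi 0 := by
      refine Set.inter_eq_right.2 fun x hx => ?_
      have hx' : (0 : ℝ) < x := hx
      exact (by positivity : (0 : ℝ) < x ^ k * (Real.exp (-x) * Real.exp (-(t * (x - 1) ^ 2)))).ne'
    rw [this]
    simp
  · refine (ae_restrict_iff' measurableSet_Ioi).2 (Eventually.of_forall fun x hx => ?_)
    have hx' : (0 : ℝ) < x := hx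
    simp only [Pi.zero_apply]
    positivity
  · exact integrableOn_tilt k ht

/-- Split at `(x - 1) ^ 2 = 2 * η ^ 2`; beyond it the tilt is at most `exp (-2 t η²)`, and the
exponential law has variance `1`. Compared with `tilt_zero_ge`, where the exponent is only `t η²`,
the second term becomes negligible relative to the mass as `t → ∞`. -/
lemma tilt_variance_le {η t : ℝ} (hη : 0 < η) (ht : 0 ≤ t) :
    tilt 2 t - 2 * tilt 1 t + tilt 0 t ≤ 2 * η ^ 2 * tilt 0 t + Real.exp (-(t * (2 * η ^ 2))) := by
  have h0 := integrableOn_tilt 0 ht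
  have h1 := integrableOn_tilt 1 ht
  have h2 := integrableOn_tilt 2 ht
  have g0 := integrableOn_pow_mul_exp 0
  have g1 := integrableOn_pow_mul_exp 1
  have g2 := integrableOn_pow_mul_exp 2
  obtain ⟨iL, eL⟩ := integral_linear_comb h2 h1 h0 1 (-2) 1
  obtain ⟨iR, eR⟩ := integral_linear_comb g2 g1 g0 1 (-2) 1
  have eL' : tilt 2 t - 2 * tilt 1 t + tilt 0 t = 1 * tilt 2 t + -2 * tilt 1 t + 1 * tilt 0 t := by
    ring
  have eR' := integral_add (h0.const_mul (2 * η ^ 2)) (iR.const_mul (Real.exp (-(t * (2 * η ^ 2)))))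
  rw [integral_const_mul, integral_const_mul, eR, integral_pow_mul_exp, integral_pow_mul_exp,
    integral_pow_mul_exp] at eR'
  have hfac : (1 : ℝ) * (Nat.factorial 2 : ℕ) + -2 * (Nat.factorial 1 : ℕ) +
    1 * (Nat.factorial 0 : ℕ) = 1 := by norm_num
  rw [hfac, mul_one] at eR'
  rw [eL', tilt, tilt, tilt, ← eL, ← eR']
  refine setIntegral_mono_on iL ((h0.const_mul _).add (iR.const_mul _)) measurableSet_Ioi
    fun x hx => ?_
  have hE := Real.exp_pos (-x)
  have key : (x - 1) ^ 2 * Real.exp (-(t * (x - 1) ^ 2)) ≤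
      2 * η ^ 2 * Real.exp (-(t * (x - 1) ^ 2)) + Real.exp (-(t * (2 * η ^ 2))) * (x - 1) ^ 2 := by
    have hE2 := Real.exp_pos (-(t * (x - 1) ^ 2))
    rcases le_total ((x - 1) ^ 2) (2 * η ^ 2) with h | h
    · have : 0 ≤ Real.exp (-(t * (2 * η ^ 2))) * (x - 1) ^ 2 := by positivity
      nlinarith
    · have h3 : Real.exp (-(t * (x - 1) ^ 2)) ≤ Real.exp (-(t * (2 * η ^ 2))) :=
        Real.exp_le_exp.2 (neg_le_neg (mul_le_mul_of_nonneg_left h ht))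
      have : 0 ≤ 2 * η ^ 2 * Real.exp (-(t * (x - 1) ^ 2)) := by positivity
      nlinarith [sq_nonneg (x - 1)]
  have := mul_le_mul_of_nonneg_left key hE.le
  simp only [pow_zero, pow_one]
  nlinarith

lemma tilt_zero_ge {η t : ℝ} (hη : 0 < η) (ht : 0 ≤ t) :
    η * (Real.exp (-(1 + η)) * Real.exp (-(t * η ^ 2))) ≤ tilt 0 t := by
  have h0 := integrableOn_tilt 0 ht
  have hsub : Set.Icc 1 (1 + η) ⊆ Set.Ioi (0 : ℝ) := fun x hx => lt_of_lt_of_le one_pos hx.1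
  calc η * (Real.exp (-(1 + η)) * Real.exp (-(t * η ^ 2)))
      = ∫ x in Set.Icc 1 (1 + η), Real.exp (-(1 + η)) * Real.exp (-(t * η ^ 2)) := by
        simp [hη.le]
    _ ≤ ∫ x in Set.Icc 1 (1 + η), x ^ 0 * (Real.exp (-x) * Real.exp (-(t * (x - 1) ^ 2))) := by
        refine setIntegral_mono_on (integrableOn_const (by simp)) (h0.mono_set hsub)
          measurableSet_Icc fun x hx => ?_
        rw [pow_zero, one_mul]
        have : (x - 1) ^ 2 ≤ η ^ 2 := by
          have h1 := hx.1
          have h2 := hx.2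
          exact pow_le_pow_left₀ (by linarith) (by linarith) 2
        exact mul_le_mul (Real.exp_le_exp.2 (by linarith [hx.2]))
          (Real.exp_le_exp.2 (neg_le_neg (mul_le_mul_of_nonneg_left this ht)))
          (Real.exp_pos _).le (Real.exp_pos _).le
    _ ≤ tilt 0 t := by
        refine setIntegral_mono_set h0 ?_ (Eventually.of_forall hsub)
        refine (ae_restrict_iff' measurableSet_Ioi).2 (Eventually.of_forall fun x hx => ?_)
        simp only [Pi.zero_apply]
        positivity

lemma exists_tilt_le {b : ℝ} (hb : 1 < b) :
    ∃ t : ℝ, 0 ≤ t ∧ tilt 2 t * tilt 0 t ≤ b * tilt 1 t ^ 2 := by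
  -- `v` bounds the normalized second moment about `1`. The bound `1 / 4` forces the mean to be at
  -- least `1 / 2`, and `(b - 1) / 4` is then at most `b - 1` times the squared mean.
  obtain ⟨v, hv0, hv4, hvb⟩ : ∃ v : ℝ, 0 < v ∧ v ≤ 1 / 4 ∧ v ≤ (b - 1) / 4 :=
    ⟨min (1 / 4) ((b - 1) / 4), lt_min (by norm_num) (by linarith), min_le_left _ _,
      min_le_right _ _⟩
  obtain ⟨η, hη, hη2⟩ : ∃ η : ℝ, 0 < η ∧ 2 * η ^ 2 = v / 2 := by
    refine ⟨√(v / 4), Real.sqrt_pos.2 (by linarith), ?_⟩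
    rw [Real.sq_sqrt (by linarith)]; ring
  have hlim : Tendsto (fun t : ℝ => Real.exp (-(t * η ^ 2))) atTop (𝓝 0) := by
    refine Real.tendsto_exp_neg_atTop_nhds_zero.comp ?_
    exact tendsto_id.atTop_mul_const (by positivity)
  have hc : 0 < v / 2 * (η * Real.exp (-(1 + η))) := by positivity
  obtain ⟨t, ht0, ht⟩ := ((eventually_ge_atTop (0 : ℝ)).and (hlim.eventually (gt_mem_nhds hc))).exists
  refine ⟨t, ht0, ?_⟩
  have h0 := tilt_pos 0 ht0
  have hV := tilt_variance_le hη ht0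
  have hI := tilt_zero_ge hη ht0
  have hE := Real.exp_pos (-(t * η ^ 2))
  have hEE : Real.exp (-(t * (2 * η ^ 2))) = Real.exp (-(t * η ^ 2)) * Real.exp (-(t * η ^ 2)) := by
    rw [← Real.exp_add]; ring_nf
  have hV2 : tilt 2 t - 2 * tilt 1 t + tilt 0 t ≤ v * tilt 0 t := by
    have : Real.exp (-(t * (2 * η ^ 2))) ≤ v / 2 * tilt 0 t := by
      rw [hEE]
      calc Real.exp (-(t * η ^ 2)) * Real.exp (-(t * η ^ 2))
          ≤ v / 2 * (η * Real.exp (-(1 + η))) * Real.exp (-(t * η ^ 2)) :=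
            mul_le_mul_of_nonneg_right ht.le hE.le
        _ = v / 2 * (η * (Real.exp (-(1 + η)) * Real.exp (-(t * η ^ 2)))) := by ring
        _ ≤ v / 2 * tilt 0 t := mul_le_mul_of_nonneg_left hI (by linarith)
    have h5 : 2 * η ^ 2 * tilt 0 t = v / 2 * tilt 0 t := by rw [hη2]
    linarith
  -- This is the nonnegative second moment about `1 / 2`. Subtracting the bound on the second moment
  -- about `1` leaves a lower bound for the mean.
  have hquad : 0 ≤ tilt 2 t - tilt 1 t + 1 / 4 * tilt 0 t := by
    have h0 := integrableOn_tilt 0 ht0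
    have h1 := integrableOn_tilt 1 ht0
    have h2 := integrableOn_tilt 2 ht0
    have e := (integral_linear_comb h2 h1 h0 1 (-1) (1 / 4)).2
    have : tilt 2 t - tilt 1 t + 1 / 4 * tilt 0 t =
      1 * tilt 2 t + -1 * tilt 1 t + 1 / 4 * tilt 0 t := by ring
    rw [this, tilt, tilt, tilt, ← e]
    refine integral_nonneg fun x => ?_
    have : 1 * (x ^ 2 * (Real.exp (-x) * Real.exp (-(t * (x - 1) ^ 2)))) +
        -1 * (x ^ 1 * (Real.exp (-x) * Real.exp (-(t * (x - 1) ^ 2)))) +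
        1 / 4 * (x ^ 0 * (Real.exp (-x) * Real.exp (-(t * (x - 1) ^ 2)))) =
        (x - 1 / 2) ^ 2 * (Real.exp (-x) * Real.exp (-(t * (x - 1) ^ 2))) := by ring
    simp only [Pi.zero_apply]
    rw [this]
    positivity
  have h1 : 1 / 2 * tilt 0 t ≤ tilt 1 t := by nlinarith
  have h3 : tilt 2 t * tilt 0 t ≤ (v * tilt 0 t + 2 * tilt 1 t - tilt 0 t) * tilt 0 t :=
    mul_le_mul_of_nonneg_right (by linarith) h0.le
  have h4 : (1 / 2 * tilt 0 t) ^ 2 ≤ tilt 1 t ^ 2 := pow_le_pow_left₀ (by linarith) h1 2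
  nlinarith [sq_nonneg (tilt 1 t - tilt 0 t), sq_nonneg (tilt 1 t), sq_nonneg (tilt 0 t)]

lemma exists_tilt_eq {b : ℝ} (hb1 : 1 < b) (hb2 : b ≤ 2) :
    ∃ t : ℝ, 0 ≤ t ∧ tilt 2 t * tilt 0 t = b * tilt 1 t ^ 2 := by
  obtain ⟨T, hT0, hT⟩ := exists_tilt_le hb1
  have hcont : ContinuousOn (fun t => b * tilt 1 t ^ 2 - tilt 2 t * tilt 0 t) (Set.Icc 0 T) := by
    refine ContinuousOn.mono ?_ Set.Icc_subset_Ici_self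
    exact (((continuousOn_tilt 1).pow 2).const_mul b).sub
      ((continuousOn_tilt 2).mul (continuousOn_tilt 0))
  obtain ⟨t, ht, hte⟩ := intermediate_value_Icc hT0 hcont (show (0 : ℝ) ∈ _ from
    ⟨by simp [tilt_zero]; linarith, by linarith⟩)
  exact ⟨t, ht.1, by linarith⟩

/-- Completing the square shows that the rescaled tilted exponentials belong to the family `weight r
s`. The scale `l` adjusts the first moment and `t` the ratio of moments. -/
lemma weight_scaled (t l x : ℝ) : weight (t * l ^ 2) ((1 - 2 * t) * l) x =
    Real.exp t * (Real.exp (-(l * x)) * Real.exp (-(t * (l * x - 1) ^ 2))) := by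
  rw [weight, ← Real.exp_add, ← Real.exp_add]
  ring_nf

lemma integral_pow_mul_weight_scaled (k : ℕ) (t : ℝ) {l : ℝ} (hl : 0 < l) :
    ∫ x in Set.Ici (0 : ℝ), x ^ k * weight (t * l ^ 2) ((1 - 2 * t) * l) x =
      Real.exp t * (l⁻¹ ^ (k + 1) * tilt k t) := by
  have h := integral_comp_mul_left_Ioi
    (fun x => x ^ k * (Real.exp (-x) * Real.exp (-(t * (x - 1) ^ 2)))) 0 hl
  rw [mul_zero] at h
  rw [integral_Ici_eq_integral_Ioi, pow_succ l⁻¹, mul_assoc (l⁻¹ ^ k), tilt, ← smul_eq_mul (a := l⁻¹), ← h,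
    ← integral_const_mul, ← integral_const_mul]
  refine setIntegral_congr_fun measurableSet_Ioi fun x _ => ?_
  simp only [weight_scaled]
  rw [mul_pow, inv_pow]
  field_simp

lemma integrableOn_pow_mul_weight_scaled (k : ℕ) {t l : ℝ} (ht : 0 ≤ t) (hl : 0 < l) :
    IntegrableOn (fun x => x ^ k * weight (t * l ^ 2) ((1 - 2 * t) * l) x) (Set.Ici 0) := by
  rw [integrableOn_Ici_iff_integrableOn_Ioi]
  have h := (integrableOn_Ioi_comp_mul_left_iff
    (fun x => x ^ k * (Real.exp (-x) * Real.exp (-(t * (x - 1) ^ 2)))) 0 hl).2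
    (by rw [mul_zero]; exact integrableOn_tilt k ht)
  refine (h.const_mul (Real.exp t * l⁻¹ ^ k)).congr (Eventually.of_forall fun x => ?_)
  simp only [weight_scaled]
  rw [mul_pow, inv_pow]
  field_simp

/-- The value `t = 0` gives scale `1`, thus the exponential law, and it can occur only for `b = 2`;
otherwise `r = t * l ^ 2` is positive. This dichotomy is the form in which the parameters are used
below. -/
theorem exists_hasMoments {b : ℝ} (hb1 : 1 < b) (hb2 : b ≤ 2) :
    ∃ r s : ℝ, HasMoments r s b ∧ (0 < r ∨ r = 0 ∧ s = 1) ∧ (b < 2 → 0 < r) := by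
  obtain ⟨t, ht, hte⟩ := exists_tilt_eq hb1 hb2
  have p0 := tilt_pos 0 ht
  have p1 := tilt_pos 1 ht
  set l := tilt 1 t / tilt 0 t with hl
  have hl0 : 0 < l := div_pos p1 p0
  refine ⟨t * l ^ 2, (1 - 2 * t) * l, ?_, ?_, ?_⟩
  · have i0 := integrableOn_pow_mul_weight_scaled 0 ht hl0
    have i1 := integrableOn_pow_mul_weight_scaled 1 ht hl0
    have e0 := integral_pow_mul_weight_scaled 0 t hl0
    have e1 := integral_pow_mul_weight_scaled 1 t hl0
    simp only [pow_zero, pow_one, one_mul] at i0 i1 e0 e1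
    refine hasMoments_of_integral i0 i1 (integrableOn_pow_mul_weight_scaled 2 ht hl0) ?_ ?_
    · rw [e0, e1, hl]
      simp only [zero_add, pow_succ, pow_zero, one_mul]
      field_simp
    · rw [e0, integral_pow_mul_weight_scaled 2 t hl0, hl]
      simp only [zero_add, pow_succ, pow_zero, one_mul]
      field_simp
      linarith
  · rcases ht.eq_or_lt with h | h
    · right
      subst h
      rw [hl, tilt_zero, tilt_zero]
      simp
    · left; positivity
  · intro hb
    rcases ht.eq_or_lt with h | h
    · subst h
      simp [tilt_zero] at hte
      exact absurd hte hb.ne'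
    · positivity

theorem existsUnique_hasMoments {b : ℝ} (hb1 : 1 < b) (hb2 : b ≤ 2) :
    ∃! rs : ℝ × ℝ, HasMoments rs.1 rs.2 b := by
  obtain ⟨r, s, h, -⟩ := exists_hasMoments hb1 hb2
  exact ⟨(r, s), h, fun q hq => Prod.ext (hq.unique h).1 (hq.unique h).2⟩

/-! ### Moments and tails of the limit law -/

/-- Completing the square for `r > 0`. The comparison gives all moments of `G r s` and, later, a
uniform bound on the weights of the three eliminated coordinates. -/
lemma exists_weight_le {r s : ℝ} (h : 0 < r ∨ r = 0 ∧ s = 1) :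
    ∃ W : ℝ, 0 < W ∧ ∀ x, weight r s x ≤ W * Real.exp (-x) := by
  rcases h with h | ⟨rfl, rfl⟩
  · refine ⟨Real.exp ((1 - s) ^ 2 / (4 * r)), Real.exp_pos _, fun x => ?_⟩
    rw [weight, ← Real.exp_add, Real.exp_le_exp]
    have : (1 - s) ^ 2 / (4 * r) + -x - (-(r * x ^ 2) - s * x) =
        (2 * r * x - (1 - s)) ^ 2 / (4 * r) := by field_simp; ring
    have h2 : 0 ≤ (2 * r * x - (1 - s)) ^ 2 / (4 * r) := by positivity
    linarith
  · exact ⟨1, one_pos, fun x => by simp [weight]⟩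

lemma integrableOn_weight_mul_pow {r s : ℝ} (h : 0 < r ∨ r = 0 ∧ s = 1) (k : ℕ) :
    IntegrableOn (fun x => weight r s x * x ^ k) (Set.Ici 0) := by
  obtain ⟨W, hW, hle⟩ := exists_weight_le h
  rw [integrableOn_Ici_iff_integrableOn_Ioi]
  refine ((integrableOn_pow_mul_exp k).const_mul W).mono'
    ((continuous_weight r s).mul (continuous_pow k)).aestronglyMeasurable ?_
  refine (ae_restrict_iff' measurableSet_Ioi).2 (Eventually.of_forall fun x hx => ?_)
  have hx' : (0 : ℝ) < x := hx
  have hw := weight_pos r s x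
  rw [Real.norm_of_nonneg (by positivity)]
  have := mul_le_mul_of_nonneg_right (hle x) (pow_nonneg hx'.le k)
  linarith

lemma mass_ne_top_of_param {r s : ℝ} (h : 0 < r ∨ r = 0 ∧ s = 1) : mass r s ≠ ∞ := by
  have := integrableOn_weight_mul_pow h 0
  simp only [pow_zero, mul_one] at this
  exact mass_ne_top_of_integrableOn this

lemma integrable_pow_G {r s : ℝ} (h : 0 < r ∨ r = 0 ∧ s = 1) (k : ℕ) :
    Integrable (fun x : ℝ => x ^ k) (G r s) :=
  (integrable_G_iff (mass_ne_top_of_param h) _).2 (integrableOn_weight_mul_pow h k)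

lemma integrable_polynomial_G {r s : ℝ} (h : 0 < r ∨ r = 0 ∧ s = 1) (p : Polynomial ℝ) :
    Integrable (fun x : ℝ => p.eval x) (G r s) := by
  simp only [Polynomial.eval_eq_sum_range]
  exact integrable_finsetSum _ fun i _ => (integrable_pow_G h i).const_mul _

lemma G_absolutelyContinuous (r s : ℝ) : G r s ≪ volume.restrict (Set.Ici 0) :=
  (Measure.smul_absolutelyContinuous).trans (withDensity_absolutelyContinuous _ _)

/-- Nondegeneracy of the covariance: a nonzero polynomial of degree at most two has finitely many
zeros, while `G r s` is absolutely continuous. -/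
lemma integral_quadratic_sq_pos {r s b : ℝ} (h : 0 < r ∨ r = 0 ∧ s = 1) {u v : ℝ}
    (huv : u ≠ 0 ∨ v ≠ 0) : 0 < ∫ x, (u * (x - 1) + v * (x ^ 2 - b)) ^ 2 ∂(G r s) := by
  have := isProbabilityMeasure_G (mass_ne_top_of_param h)
  have hint : Integrable (fun x => (u * (x - 1) + v * (x ^ 2 - b)) ^ 2) (G r s) := by
    have := integrable_polynomial_G h ((Polynomial.C u * (Polynomial.X - 1) +
      Polynomial.C v * (Polynomial.X ^ 2 - Polynomial.C b)) ^ 2)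
    simpa using this
  refine lt_of_le_of_ne (integral_nonneg fun x => sq_nonneg _) fun h0 => ?_
  rw [eq_comm, integral_eq_zero_iff_of_nonneg (fun x => sq_nonneg _) hint] at h0
  have hfin : {x : ℝ | (u * (x - 1) + v * (x ^ 2 - b)) ^ 2 = 0}.Finite := by
    have hsub : {x : ℝ | (u * (x - 1) + v * (x ^ 2 - b)) ^ 2 = 0} ⊆
        {x : ℝ | v * x ^ 2 + u * x + (-u - v * b) = 0} := fun x hx => by
      have : u * (x - 1) + v * (x ^ 2 - b) = 0 := pow_eq_zero_iff (two_ne_zero) |>.1 hx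
      simp only [Set.mem_ofPred_eq]
      linarith
    by_cases hv : v = 0
    · have hu : u ≠ 0 := huv.resolve_right (not_not.2 hv)
      subst hv
      refine (Set.finite_singleton (1 : ℝ)).subset fun x hx => ?_
      have h2 := hsub hx
      simp only [Set.mem_ofPred_eq] at h2
      have : u * (x - 1) = 0 := by linarith
      have := (mul_eq_zero.1 this).resolve_left hu
      simp only [Set.mem_singleton_iff]
      linarith
    · exact (finite_quadratic_zeros hv).subset hsub
  have h1 : ∀ᵐ x ∂(G r s), x ∉ {x : ℝ | (u * (x - 1) + v * (x ^ 2 - b)) ^ 2 = 0} := by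
    refine (G_absolutelyContinuous r s).ae_le (ae_restrict_of_ae ?_)
    exact measure_eq_zero_iff_ae_notMem.1 (hfin.measure_zero _)
  have h2 : ∀ᵐ x ∂(G r s), False := by
    filter_upwards [h0, h1] with x hx hx'
    exact hx' hx
  rw [eventually_false_iff_eq_bot, ae_eq_bot] at h2
  exact IsProbabilityMeasure.ne_zero (G r s) h2

lemma integrable_exp_sq_G {r s : ℝ} (h : 0 < r) :
    Integrable (fun x => Real.exp (r / 2 * x ^ 2)) (G r s) := by
  rw [integrable_G_iff (mass_ne_top_of_param (Or.inl h))]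
  have := integrableOn_weight_mul_pow (r := r / 2) (s := s) (Or.inl (by positivity)) 0
  refine this.congr_fun (fun x _ => ?_) measurableSet_Ici
  simp only [weight, pow_zero, mul_one]
  rw [← Real.exp_add]
  ring_nf

lemma integrable_exp_half_G : Integrable (fun x => Real.exp (x / 2)) (G 0 1) := by
  rw [integrable_G_iff (mass_ne_top_of_param (Or.inr ⟨rfl, rfl⟩)),
    integrableOn_Ici_iff_integrableOn_Ioi]
  refine (exp_neg_integrableOn_Ioi 0 (b := 1 / 2) (by norm_num)).congr_fun (fun x _ => ?_)
    measurableSet_Ioi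
  simp only [weight]
  rw [← Real.exp_add]
  ring_nf

/-! ### A local lower bound for centered random walks in the plane -/

/-- The quartic is a minorant for a Paley–Zygmund argument on a signed variable. The constant `4 /
27` is where the part without `η` touches zero at `l * t = -3 / 2`, so it stays nonpositive for all
negative `t`. -/
lemma poly_le_zero {l t η : ℝ} (hl : 0 < l) (hl1 : l ≤ 1) (hη1 : η ≤ 1) (hη : 0 < η)
    (ht : t < η / 2) : t + l * t ^ 2 - 4 * l ^ 3 / 27 * t ^ 4 - η ≤ 0 := by
  rcases le_total t 0 with h | h
  · have h1 : 0 ≤ (l * -t - 3 / 2) ^ 2 * (4 * (l * -t) + 12) := by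
      have : 0 ≤ l * -t := mul_nonneg hl.le (by linarith)
      positivity
    have h2 : 0 ≤ (-t) * ((l * -t - 3 / 2) ^ 2 * (4 * (l * -t) + 12)) :=
      mul_nonneg (by linarith) h1
    nlinarith
  · have h1 : t ^ 2 ≤ (η / 2) * t := by nlinarith
    have h2 : 0 ≤ 4 * l ^ 3 / 27 * t ^ 4 := by positivity
    have h3 : l * t ^ 2 ≤ t ^ 2 := by nlinarith [sq_nonneg t]
    nlinarith

lemma poly_le_const {l t η : ℝ} (hl : 0 < l) (hη : 0 < η) :
    t + l * t ^ 2 - 4 * l ^ 3 / 27 * t ^ 4 - η ≤ 1 + (1 + l) ^ 2 / (16 * l ^ 3 / 27) := by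
  set k := 4 * l ^ 3 / 27 with hk
  have hk0 : 0 < k := by positivity
  have e : 16 * l ^ 3 / 27 = 4 * k := by rw [hk]; ring
  rw [e]
  have h1 : (1 + l) ^ 2 / (4 * k) - ((1 + l) * t ^ 2 - k * t ^ 4) =
      (2 * k * t ^ 2 - (1 + l)) ^ 2 / (4 * k) := by field_simp; ring
  have h2 : 0 ≤ (2 * k * t ^ 2 - (1 + l)) ^ 2 / (4 * k) := by positivity
  nlinarith [sq_nonneg (t - 1 / 2)]

/-- A centered variable with variance bounded below and fourth moment bounded above is
positive, with a uniform margin, with uniformly positive probability. -/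
lemma exists_prob_ge {v κ : ℝ} (hv : 0 < v) (hκ : 0 < κ) :
    ∃ η c : ℝ, 0 < η ∧ 0 < c ∧ ∀ {Ω : Type} [MeasurableSpace Ω] (P : Measure Ω)
      [IsProbabilityMeasure P] (T : Ω → ℝ), Measurable T → Integrable T P →
      Integrable (fun ω => T ω ^ 2) P → Integrable (fun ω => T ω ^ 4) P → ∫ ω, T ω ∂P = 0 →
      v ≤ ∫ ω, T ω ^ 2 ∂P → ∫ ω, T ω ^ 4 ∂P ≤ κ → c ≤ P.real {ω | η ≤ T ω} := by
  -- With `l * κ ≤ v` and `l ≤ 1` the fourth-moment term is at most `4 / 27` of `l * v`, and `η`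
  -- takes at most half; more than a quarter of `l * v` remains.
  obtain ⟨l, hl, hl1, hlκ⟩ : ∃ l : ℝ, 0 < l ∧ l ≤ 1 ∧ l * κ ≤ v := by
    refine ⟨min 1 (v / κ), lt_min one_pos (by positivity), min_le_left _ _, ?_⟩
    calc min 1 (v / κ) * κ ≤ v / κ * κ := mul_le_mul_of_nonneg_right (min_le_right _ _) hκ.le
      _ = v := by field_simp
  obtain ⟨η, hη, hη1, hηv⟩ : ∃ η : ℝ, 0 < η ∧ η ≤ 1 ∧ η ≤ l * v / 2 :=
    ⟨min 1 (l * v / 2), lt_min one_pos (by positivity), min_le_left _ _, min_le_right _ _⟩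
  set M := 1 + (1 + l) ^ 2 / (16 * l ^ 3 / 27) with hM
  have hM0 : 0 < M := by positivity
  refine ⟨η / 2, l * v / 4 / M, by positivity, by positivity, ?_⟩
  intro Ω _ P _ T hT i1 i2 i4 e1 e2 e4
  have hset : MeasurableSet {ω | η / 2 ≤ T ω} := measurableSet_le measurable_const hT
  have hle : ∀ ω, T ω + l * T ω ^ 2 + (-(4 * l ^ 3 / 27)) * T ω ^ 4 - η ≤
      {ω | η / 2 ≤ T ω}.indicator (fun _ => M) ω := by
    intro ω
    by_cases h : η / 2 ≤ T ω
    · rw [Set.indicator_of_mem (by exact h)]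
      have := poly_le_const (t := T ω) hl hη
      linarith
    · rw [Set.indicator_of_notMem (by exact h)]
      have := poly_le_zero hl hl1 hη1 hη (not_le.1 h)
      linarith
  obtain ⟨i, e⟩ := integral_linear_comb i1 i2 i4 1 l (-(4 * l ^ 3 / 27))
  simp only [one_mul] at i e
  have h1 := integral_mono (i.sub (integrable_const (μ := P) η))
    ((integrable_const M).indicator hset) hle
  rw [integral_indicator hset, setIntegral_const, smul_eq_mul] at h1
  have h2 : ∫ ω, (T ω + l * T ω ^ 2 + (-(4 * l ^ 3 / 27)) * T ω ^ 4 - η) ∂P =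
      (l * ∫ ω, T ω ^ 2 ∂P) + (-(4 * l ^ 3 / 27)) * ∫ ω, T ω ^ 4 ∂P - η := by
    rw [integral_sub i (integrable_const _), e, e1]
    simp
  have h3 : l * v / 4 ≤ P.real {ω | η / 2 ≤ T ω} * M := by
    refine le_trans ?_ h1
    have h4 : l ^ 3 * κ ≤ l * v := by
      have : l ^ 3 * κ = l ^ 2 * (l * κ) := by ring
      rw [this]
      have : l ^ 2 * (l * κ) ≤ l ^ 2 * v := mul_le_mul_of_nonneg_left hlκ (by positivity)
      have : l ^ 2 * v ≤ l * v := by nlinarith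
      linarith
    have h5 : l ^ 3 * ∫ ω, T ω ^ 4 ∂P ≤ l ^ 3 * κ := mul_le_mul_of_nonneg_left e4 (by positivity)
    have h6 : l * v ≤ l * ∫ ω, T ω ^ 2 ∂P := mul_le_mul_of_nonneg_left e2 hl.le
    have h7 : 0 < l * v := by positivity
    refine le_of_le_of_eq ?_ h2.symm
    nlinarith
  rw [div_le_iff₀ hM0]
  exact h3

section Moments

variable {μ : Measure ℝ} [IsProbabilityMeasure μ] {h : ℝ → ℝ}

lemma measurable_sum_comp (hm : Measurable h) (n : ℕ) :
    Measurable fun y : Fin n → ℝ => ∑ i, h (y i) := by fun_prop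

/-- Induction with the binomial expansion, where odd cross terms vanish. For the fourth moment, `(E
h²)² ≤ E h⁴` gives the step `3 n² + 6 n + 1 ≤ 3 (n + 1)²`. -/
lemma moments_sum (hm : Measurable h) (hint : ∀ k : ℕ, Integrable (fun x => h x ^ k) μ)
    (h0 : ∫ x, h x ∂μ = 0) (n : ℕ) :
    (∀ k ≤ 4, Integrable (fun y : Fin n → ℝ => (∑ i, h (y i)) ^ k) (Measure.pi fun _ => μ)) ∧
    ∫ y : Fin n → ℝ, (∑ i, h (y i)) ∂(Measure.pi fun _ => μ) = 0 ∧
    ∫ y : Fin n → ℝ, (∑ i, h (y i)) ^ 2 ∂(Measure.pi fun _ => μ) = n * ∫ x, h x ^ 2 ∂μ ∧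
    ∫ y : Fin n → ℝ, (∑ i, h (y i)) ^ 4 ∂(Measure.pi fun _ => μ) ≤
      3 * n ^ 2 * ∫ x, h x ^ 4 ∂μ := by
  have hvar : (∫ x, h x ^ 2 ∂μ) ^ 2 ≤ ∫ x, h x ^ 4 ∂μ := by
    have := integral_linear_comb (hint 4) (hint 2) (integrable_const (μ := μ) (1 : ℝ)) 1
      (-2 * ∫ x, h x ^ 2 ∂μ) ((∫ x, h x ^ 2 ∂μ) ^ 2)
    have h2 : 0 ≤ ∫ x, (1 * h x ^ 4 + (-2 * ∫ x, h x ^ 2 ∂μ) * h x ^ 2 +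
        (∫ x, h x ^ 2 ∂μ) ^ 2 * 1) ∂μ := by
      refine integral_nonneg fun x => ?_
      have : 1 * h x ^ 4 + (-2 * ∫ x, h x ^ 2 ∂μ) * h x ^ 2 +
        (∫ x, h x ^ 2 ∂μ) ^ 2 * 1 = (h x ^ 2 - ∫ x, h x ^ 2 ∂μ) ^ 2 := by ring
      simp only [Pi.zero_apply]
      rw [this]
      positivity
    rw [this.2] at h2
    simp only [integral_const, probReal_univ, smul_eq_mul, mul_one] at h2
    nlinarith
  induction n with
  | zero => simp
  | succ n ih =>
    obtain ⟨ih1, ih2, ih3, ih4⟩ := ih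
    have hcons := measurePreserving_cons μ n
    set ν := (Measure.pi fun _ : Fin n => μ)
    have hprod : ∀ j k : ℕ, k ≤ 4 → Integrable (fun p : ℝ × (Fin n → ℝ) =>
        h p.1 ^ j * (∑ i, h (p.2 i)) ^ k) (μ.prod ν) := fun j k hk =>
      (hint j).mul_prod (ih1 k hk)
    have eprod : ∀ j k : ℕ, ∫ p : ℝ × (Fin n → ℝ), h p.1 ^ j * (∑ i, h (p.2 i)) ^ k ∂(μ.prod ν) =
        (∫ x, h x ^ j ∂μ) * ∫ y : Fin n → ℝ, (∑ i, h (y i)) ^ k ∂ν := fun j k =>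
      integral_prod_mul (fun x => h x ^ j) (fun y : Fin n → ℝ => (∑ i, h (y i)) ^ k)
    have hmeas : ∀ k : ℕ, Measurable fun y : Fin (n + 1) → ℝ => (∑ i, h (y i)) ^ k := fun k =>
      (measurable_sum_comp hm _).pow_const k
    have einteg : ∀ k : ℕ, ∫ y : Fin (n + 1) → ℝ, (∑ i, h (y i)) ^ k ∂(Measure.pi fun _ => μ) =
        ∫ p : ℝ × (Fin n → ℝ), (h p.1 + ∑ i, h (p.2 i)) ^ k ∂(μ.prod ν) := by
      intro k
      rw [← hcons.map_eq, integral_map hcons.measurable.aemeasurable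
        (hmeas k).aestronglyMeasurable]
      simp only [Fin.sum_univ_succ, Fin.cons_zero, Fin.cons_succ]
    have hpow : ∀ k : ℕ, ∀ p : ℝ × (Fin n → ℝ), (h p.1 + ∑ i, h (p.2 i)) ^ k =
        ∑ j ∈ Finset.range (k + 1),
          (h p.1 ^ j * (∑ i, h (p.2 i)) ^ (k - j)) * (k.choose j : ℝ) := fun k p => add_pow _ _ _
    have einteg2 : ∀ k ≤ 4, ∫ y : Fin (n + 1) → ℝ, (∑ i, h (y i)) ^ k
        ∂(Measure.pi fun _ => μ) = ∑ j ∈ Finset.range (k + 1),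
          ((∫ x, h x ^ j ∂μ) * ∫ y : Fin n → ℝ, (∑ i, h (y i)) ^ (k - j) ∂ν) *
            (k.choose j : ℝ) := by
      intro k hk
      rw [einteg]
      simp only [hpow]
      rw [integral_finsetSum]
      · refine Finset.sum_congr rfl fun j _ => ?_
        rw [integral_mul_const, eprod]
      · exact fun j _ => (hprod j (k - j) (by omega)).mul_const _
    refine ⟨fun k hk => ?_, ?_, ?_, ?_⟩
    · rw [← hcons.map_eq, integrable_map_measure (hmeas k).aestronglyMeasurable
        hcons.measurable.aemeasurable]
      have : ((fun y : Fin (n + 1) → ℝ => (∑ i, h (y i)) ^ k) ∘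
          fun p : ℝ × (Fin n → ℝ) => (Fin.cons p.1 p.2 : Fin (n + 1) → ℝ)) =
          fun p => ∑ j ∈ Finset.range (k + 1),
          (h p.1 ^ j * (∑ i, h (p.2 i)) ^ (k - j)) * (k.choose j : ℝ) := by
        ext p
        rw [← hpow]
        simp [Fin.sum_univ_succ]
      rw [this]
      exact integrable_finsetSum _ fun j _ => (hprod j (k - j) (by omega)).mul_const _
    · have := einteg2 1 (by norm_num)
      simpa [Finset.sum_range_succ, ih2, h0] using this
    · have := einteg2 2 (by norm_num)
      rw [this]
      simp [Finset.sum_range_succ, ih2, ih3, h0]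
      ring
    · rw [einteg2 4 le_rfl]
      simp [Finset.sum_range_succ, ih2, ih3, h0, Nat.choose]
      have : 0 ≤ (n : ℝ) := Nat.cast_nonneg n
      nlinarith

end Moments

/-- A pair of functions whose linear combinations are centered, nondegenerate and have all
moments under `μ`. -/
structure IsCenteredPair (μ : Measure ℝ) (f g : ℝ → ℝ) : Prop where
  measurable_left : Measurable f
  measurable_right : Measurable g
  integrable : ∀ (u v : ℝ) (k : ℕ), Integrable (fun x => (u * f x + v * g x) ^ k) μ
  integral_eq_zero : ∀ u v : ℝ, ∫ x, (u * f x + v * g x) ∂μ = 0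
  integral_sq_pos : ∀ u v : ℝ, u ≠ 0 ∨ v ≠ 0 → 0 < ∫ x, (u * f x + v * g x) ^ 2 ∂μ

section Walk

variable {μ : Measure ℝ} {f g : ℝ → ℝ}

/-- The smallest eigenvalue of the covariance matrix is at least determinant over trace. The
determinant is positive by testing the form on `(B, -A)`. -/
lemma IsCenteredPair.exists_variance_ge (H : IsCenteredPair μ f g) :
    ∃ l : ℝ, 0 < l ∧ ∀ u v : ℝ, u ^ 2 + v ^ 2 = 1 → l ≤ ∫ x, (u * f x + v * g x) ^ 2 ∂μ := by
  have i1 : Integrable (fun x => f x ^ 2) μ := by simpa using H.integrable 1 0 2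
  have i3 : Integrable (fun x => g x ^ 2) μ := by simpa using H.integrable 0 1 2
  have i2 : Integrable (fun x => f x * g x) μ := by
    have := ((H.integrable 1 1 2).sub (i1.add i3)).const_mul (1 / 2)
    refine this.congr (Eventually.of_forall fun x => ?_)
    simp only [Pi.sub_apply, Pi.add_apply]
    ring
  have key : ∀ u v : ℝ, ∫ x, (u * f x + v * g x) ^ 2 ∂μ =
      u ^ 2 * ∫ x, f x ^ 2 ∂μ + 2 * u * v * ∫ x, f x * g x ∂μ + v ^ 2 * ∫ x, g x ^ 2 ∂μ := by
    intro u v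
    rw [← (integral_linear_comb i1 i2 i3 (u ^ 2) (2 * u * v) (v ^ 2)).2]
    congr 1
    ext x
    ring
  set A := ∫ x, f x ^ 2 ∂μ
  set B := ∫ x, f x * g x ∂μ
  set D := ∫ x, g x ^ 2 ∂μ
  have hA : 0 < A := by
    have := H.integral_sq_pos 1 0 (Or.inl one_ne_zero)
    rw [key] at this
    linarith
  have hD : 0 < D := by
    have := H.integral_sq_pos 0 1 (Or.inr one_ne_zero)
    rw [key] at this
    linarith
  have hdet : 0 < A * D - B ^ 2 := by
    have := H.integral_sq_pos B (-A) (Or.inr (neg_ne_zero.2 hA.ne'))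
    rw [key] at this
    have h2 : 0 < A * (A * D - B ^ 2) := by linarith
    exact pos_of_mul_pos_right h2 hA.le
  refine ⟨(A * D - B ^ 2) / (A + D), by positivity, fun u v huv => ?_⟩
  rw [key, div_le_iff₀ (by positivity)]
  have h1 : (A * D - B ^ 2) = (A * D - B ^ 2) * (u ^ 2 + v ^ 2) := by rw [huv, mul_one]
  rw [h1]
  nlinarith [sq_nonneg (A * u + B * v), sq_nonneg (B * u + D * v)]

variable [IsProbabilityMeasure μ]

lemma IsCenteredPair.exists_fourth_le (H : IsCenteredPair μ f g) :
    ∃ κ : ℝ, 0 < κ ∧ ∀ u v : ℝ, u ^ 2 + v ^ 2 = 1 → ∫ x, (u * f x + v * g x) ^ 4 ∂μ ≤ κ := by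
  have i1 : Integrable (fun x => f x ^ 4) μ := by simpa using H.integrable 1 0 4
  have i2 : Integrable (fun x => g x ^ 4) μ := by simpa using H.integrable 0 1 4
  obtain ⟨i, e⟩ := integral_linear_comb i1 i2 (integrable_const (μ := μ) (1 : ℝ)) 2 2 1
  refine ⟨∫ x, (2 * f x ^ 4 + 2 * g x ^ 4 + 1 * 1) ∂μ, ?_, fun u v huv => ?_⟩
  · rw [e]
    have h1 : 0 ≤ ∫ x, f x ^ 4 ∂μ := integral_nonneg fun x => by positivity
    have h2 : 0 ≤ ∫ x, g x ^ 4 ∂μ := integral_nonneg fun x => by positivity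
    simp
    positivity
  · refine integral_mono (H.integrable u v 4) i fun x => ?_
    have h1 : (u * f x + v * g x) ^ 2 ≤ f x ^ 2 + g x ^ 2 := by
      have : f x ^ 2 + g x ^ 2 = (u ^ 2 + v ^ 2) * (f x ^ 2 + g x ^ 2) := by rw [huv, one_mul]
      nlinarith [sq_nonneg (u * g x - v * f x)]
    have h2 : ((u * f x + v * g x) ^ 2) ^ 2 ≤ (f x ^ 2 + g x ^ 2) ^ 2 :=
      pow_le_pow_left₀ (sq_nonneg _) h1 2
    simp only
    nlinarith [sq_nonneg (f x ^ 2 - g x ^ 2)]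

lemma sum_linear_comb (u v : ℝ) {n : ℕ} (y : Fin n → ℝ) :
    ∑ i, (u * f (y i) + v * g (y i)) = u * ∑ i, f (y i) + v * ∑ i, g (y i) := by
  rw [Finset.sum_add_distrib, Finset.mul_sum, Finset.mul_sum]

lemma IsCenteredPair.exists_norm_le (H : IsCenteredPair μ f g) :
    ∃ τ : ℝ, 0 < τ ∧ ∀ (n : ℕ) (K : ℝ), 0 < K →
      (Measure.pi fun _ : Fin n => μ).real
        {y | K < (∑ i, f (y i)) ^ 2 + (∑ i, g (y i)) ^ 2} ≤ τ * n / K := by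
  have h1 := H.integral_sq_pos 1 0 (Or.inl one_ne_zero)
  have h2 := H.integral_sq_pos 0 1 (Or.inr one_ne_zero)
  refine ⟨_, add_pos h1 h2, fun n K hK => ?_⟩
  have m1 := moments_sum (μ := μ) (h := f) H.measurable_left
    (by simpa using H.integrable 1 0) (by simpa using H.integral_eq_zero 1 0) n
  have m2 := moments_sum (μ := μ) (h := g) H.measurable_right
    (by simpa using H.integrable 0 1) (by simpa using H.integral_eq_zero 0 1) n
  set π := Measure.pi fun _ : Fin n => μ
  have i1 := m1.1 2 (by norm_num)
  have i2 := m2.1 2 (by norm_num)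
  have hmk := mul_meas_ge_le_integral_of_nonneg (μ := π)
    (f := fun y => (∑ i, f (y i)) ^ 2 + (∑ i, g (y i)) ^ 2)
    (Eventually.of_forall fun y => by positivity) (i1.add i2) K
  rw [integral_add i1 i2, m1.2.2.1, m2.2.2.1] at hmk
  rw [le_div_iff₀ hK]
  have hsub : π.real {y | K < (∑ i, f (y i)) ^ 2 + (∑ i, g (y i)) ^ 2} ≤
      π.real {y | K ≤ (∑ i, f (y i)) ^ 2 + (∑ i, g (y i)) ^ 2} :=
    measureReal_mono fun y (hy : K < _) => hy.le
  simp only [one_mul, zero_mul, add_zero, zero_add]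
  nlinarith

/-- In every direction the walk advances by a multiple of `√n` with probability bounded below, by
`exists_prob_ge` applied to the normalized projection. Markov's inequality then removes the paths
that travel too far. -/
lemma IsCenteredPair.exists_drift (H : IsCenteredPair μ f g) :
    ∃ η c K : ℝ, 0 < η ∧ 0 < c ∧ 0 < K ∧ ∀ (n : ℕ), 1 ≤ n → ∀ a d : ℝ,
      c ≤ (Measure.pi fun _ : Fin n => μ).real
        {y | η * (√(a ^ 2 + d ^ 2) * √n) ≤ a * ∑ i, f (y i) + d * ∑ i, g (y i) ∧
          (∑ i, f (y i)) ^ 2 + (∑ i, g (y i)) ^ 2 ≤ K * n} := by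
  obtain ⟨l, hl, hl'⟩ := H.exists_variance_ge
  obtain ⟨κ, hκ, hκ'⟩ := H.exists_fourth_le
  obtain ⟨τ, hτ, hτ'⟩ := H.exists_norm_le
  obtain ⟨η, c, hη, hc, hPZ⟩ := exists_prob_ge hl (show 0 < 3 * κ by positivity)
  -- `K` makes the discarded event have probability at most `min c 1 / 2`. The minimum with `1`
  -- covers the zero direction, where the first condition holds surely.
  refine ⟨η, min c 1 / 2, 2 * τ / min c 1, hη, by positivity, by positivity, ?_⟩
  intro n hn a d
  have hc1 : 0 < min c 1 := lt_min hc one_pos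
  have hn0 : (0 : ℝ) < n := by exact_mod_cast hn
  set π := Measure.pi fun _ : Fin n => μ
  have hmf := measurable_sum_comp H.measurable_left n
  have hmg := measurable_sum_comp H.measurable_right n
  have hA : c ⊓ 1 ≤ π.real {y | η * (√(a ^ 2 + d ^ 2) * √n) ≤
      a * ∑ i, f (y i) + d * ∑ i, g (y i)} := by
    rcases (add_nonneg (sq_nonneg a) (sq_nonneg d)).eq_or_lt with h0 | h0
    · have ha : a = 0 := by nlinarith
      have hd : d = 0 := by nlinarith
      subst ha hd
      simp
    · set ρ := √(a ^ 2 + d ^ 2) with hρ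
      have hρ0 : 0 < ρ := Real.sqrt_pos.2 h0
      have hρ2 : ρ ^ 2 = a ^ 2 + d ^ 2 := Real.sq_sqrt h0.le
      have huv : (a / ρ) ^ 2 + (d / ρ) ^ 2 = 1 := by
        rw [div_pow, div_pow, ← add_div, hρ2, div_self h0.ne']
      have hs0 : 0 < √(n : ℝ) := Real.sqrt_pos.2 hn0
      have hs2 : √(n : ℝ) ^ 2 = n := Real.sq_sqrt hn0.le
      have m := moments_sum (μ := μ) (h := fun x => a / ρ * f x + d / ρ * g x)
        ((H.measurable_left.const_mul _).add (H.measurable_right.const_mul _))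
        (H.integrable _ _) (H.integral_eq_zero _ _) n
      have hres := hPZ π (fun y => (√(n : ℝ))⁻¹ * ∑ i, (a / ρ * f (y i) + d / ρ * g (y i)))
        (by have := H.measurable_left; have := H.measurable_right; fun_prop)
        (by simpa using (m.1 1 (by norm_num)).const_mul _)
        (by simpa only [mul_pow] using (m.1 2 (by norm_num)).const_mul _)
        (by simpa only [mul_pow] using (m.1 4 (by norm_num)).const_mul _)
        (by rw [integral_const_mul, m.2.1, mul_zero])
        (by
          simp only [mul_pow]
          rw [integral_const_mul, m.2.2.1, inv_pow, hs2, inv_mul_cancel_left₀ hn0.ne']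
          exact hl' _ _ huv)
        (by
          simp only [mul_pow]
          rw [integral_const_mul, inv_pow, show √(n : ℝ) ^ 4 = (√(n : ℝ) ^ 2) ^ 2 by ring, hs2]
          calc ((n : ℝ) ^ 2)⁻¹ * _ ≤ ((n : ℝ) ^ 2)⁻¹ * (3 * n ^ 2 *
                ∫ x, (a / ρ * f x + d / ρ * g x) ^ 4 ∂μ) :=
                mul_le_mul_of_nonneg_left m.2.2.2 (by positivity)
            _ = 3 * ∫ x, (a / ρ * f x + d / ρ * g x) ^ 4 ∂μ := by field_simp
            _ ≤ 3 * κ := by linarith [hκ' _ _ huv])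
      refine (min_le_left _ _).trans (hres.trans (measureReal_mono fun y hy => ?_))
      have hy' : η ≤ (√(n : ℝ))⁻¹ * ∑ i, (a / ρ * f (y i) + d / ρ * g (y i)) := hy
      rw [sum_linear_comb] at hy'
      have e : (√(n : ℝ))⁻¹ * (a / ρ * ∑ i, f (y i) + d / ρ * ∑ i, g (y i)) =
          (a * ∑ i, f (y i) + d * ∑ i, g (y i)) / (ρ * √n) := by field_simp
      rw [e, le_div_iff₀ (by positivity)] at hy'
      exact hy'
  have hB := hτ' n (2 * τ / min c 1 * n) (by positivity)
  have hB' : τ * n / (2 * τ / min c 1 * n) = min c 1 / 2 := by field_simp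
  rw [hB'] at hB
  have hsetA : MeasurableSet {y : Fin n → ℝ | 2 * τ / min c 1 * n <
      (∑ i, f (y i)) ^ 2 + (∑ i, g (y i)) ^ 2} :=
    measurableSet_lt measurable_const ((hmf.pow_const 2).add (hmg.pow_const 2))
  have hdiff := le_measureReal_sdiff (μ := π)
    (s₂ := {y | 2 * τ / min c 1 * n < (∑ i, f (y i)) ^ 2 + (∑ i, g (y i)) ^ 2})
    (s₁ := {y | η * (√(a ^ 2 + d ^ 2) * √n) ≤ a * ∑ i, f (y i) + d * ∑ i, g (y i)})
  have hle : π.real ({y | η * (√(a ^ 2 + d ^ 2) * √n) ≤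
      a * ∑ i, f (y i) + d * ∑ i, g (y i)} \
      {y | 2 * τ / min c 1 * n < (∑ i, f (y i)) ^ 2 + (∑ i, g (y i)) ^ 2}) ≤
      π.real {y | η * (√(a ^ 2 + d ^ 2) * √n) ≤ a * ∑ i, f (y i) + d * ∑ i, g (y i) ∧
          (∑ i, f (y i)) ^ 2 + (∑ i, g (y i)) ^ 2 ≤ 2 * τ / min c 1 * n} :=
    measureReal_mono fun y hy => ⟨hy.1, not_lt.1 hy.2⟩
  linarith

/-- Being within diffusive range of the target is preserved: after `k` steps the squared distance is
at most `ρ² - 2 η ρ √k + K k`, which has to be at most `m`. A large ratio `(k + m) / k` makes the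
drift `2 η ρ √k` beat `(1 + K) k` when `ρ` is near the maximal `√(k + m)`, and `K k ≤ m` settles
small `ρ`. -/
lemma IsCenteredPair.exists_step (H : IsCenteredPair μ f g) :
    ∃ (L : ℕ) (c : ℝ), 2 ≤ L ∧ 0 < c ∧ ∀ k m : ℕ, 1 ≤ k → L * k ≤ k + m → ∀ a d : ℝ,
      a ^ 2 + d ^ 2 ≤ k + m → c ≤ (Measure.pi fun _ : Fin k => μ).real
        {y | (a - ∑ i, f (y i)) ^ 2 + (d - ∑ i, g (y i)) ^ 2 ≤ m} := by
  obtain ⟨η, c, K, hη, hc, hK, h⟩ := H.exists_drift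
  obtain ⟨L₀, hL₀⟩ := exists_nat_ge ((1 + K) ^ 2 / (4 * η ^ 2) + (1 + K))
  refine ⟨L₀ + 2, c, by omega, hc, fun k m hk hkm a d had => ?_⟩
  refine (h k hk a d).trans (measureReal_mono fun y hy => ?_)
  obtain ⟨h1, h2⟩ := hy
  set S := ∑ i, f (y i)
  set T := ∑ i, g (y i)
  set ρ := √(a ^ 2 + d ^ 2) with hρ
  have hρ0 : 0 ≤ ρ := Real.sqrt_nonneg _
  have hρ2 : ρ ^ 2 = a ^ 2 + d ^ 2 := Real.sq_sqrt (by positivity)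
  have hk0 : (0 : ℝ) < k := by exact_mod_cast hk
  have hq0 : 0 < √(k : ℝ) := Real.sqrt_pos.2 hk0
  have hq2 : √(k : ℝ) ^ 2 = k := Real.sq_sqrt hk0.le
  set q := √(k : ℝ)
  have hN : ((L₀ : ℝ) + 2) * k ≤ k + m := by exact_mod_cast hkm
  have hpos1 : 0 ≤ (1 + K) ^ 2 / (4 * η ^ 2) := by positivity
  have hc1 : (1 + K) * k ≤ k + m := by nlinarith
  have hc2 : (1 + K) ^ 2 * k ≤ 4 * η ^ 2 * (k + m) := by
    have : (1 + K) ^ 2 / (4 * η ^ 2) * k ≤ k + m := by nlinarith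
    have h3 := mul_le_mul_of_nonneg_left this (show 0 ≤ 4 * η ^ 2 by positivity)
    have h4 : 4 * η ^ 2 * ((1 + K) ^ 2 / (4 * η ^ 2) * k) = (1 + K) ^ 2 * k := by field_simp
    linarith
  set t := √((k : ℝ) + m) with ht
  have ht0 : 0 < t := Real.sqrt_pos.2 (by positivity)
  have ht2 : t ^ 2 = k + m := Real.sq_sqrt (by positivity)
  have hρt : ρ ≤ t := Real.sqrt_le_sqrt had
  have hc3 : (1 + K) * q ≤ 2 * η * t := by
    refine le_of_sq_le_sq ?_ (by positivity)
    rw [mul_pow, hq2, mul_pow, ht2]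
    linarith
  have key : ρ ^ 2 - 2 * (η * (ρ * q)) + K * k ≤ m := by
    rcases le_total ρ (2 * η * q) with hcase | hcase
    · have : ρ ^ 2 ≤ 2 * (η * (ρ * q)) := by nlinarith
      linarith
    · have h5 : ρ * (ρ - 2 * η * q) ≤ t * (t - 2 * η * q) :=
        mul_le_mul hρt (by linarith) (by linarith) ht0.le
      have h6 : ((1 + K) * q) * q ≤ 2 * η * t * q := mul_le_mul_of_nonneg_right hc3 hq0.le
      nlinarith
  simp only [Set.mem_ofPred_eq]
  nlinarith

/-- A centered planar random walk visits each bounded neighbourhood of every point within its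
diffusive range with polynomially bounded below probability. -/
theorem IsCenteredPair.exists_local_lower_bound (H : IsCenteredPair μ f g) :
    ∃ (R c : ℝ) (α : ℕ), 0 < R ∧ 0 < c ∧ ∀ (n : ℕ) (a d : ℝ), a ^ 2 + d ^ 2 ≤ n →
      c / (n + 1) ^ α ≤ (Measure.pi fun _ : Fin n => μ).real
        {y | (a - ∑ i, f (y i)) ^ 2 + (d - ∑ i, g (y i)) ^ 2 ≤ R} := by
  obtain ⟨L, c, hL, hc, hstep⟩ := H.exists_step
  obtain ⟨τ, hτ, hτ'⟩ := H.exists_norm_le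
  have hL0 : (0 : ℝ) < L := by positivity
  have hL2 : (2 : ℝ) ≤ L := by exact_mod_cast hL
  -- Each stage uses up at least the fraction `1 / (4 L)` of `n + 1` and costs a factor `c`. The
  -- choice of `α` with `θ ^ α < c` makes the bound `(n + 1) ^ (-α)` reproduce itself.
  set θ : ℝ := 1 - 1 / (4 * L) with hθ
  have hθ0 : 0 ≤ θ := by
    have : 1 / (4 * (L : ℝ)) ≤ 1 := by rw [div_le_one (by positivity)]; linarith
    linarith
  have hθ1 : θ < 1 := by
    have : 0 < 1 / (4 * (L : ℝ)) := by positivity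
    linarith
  obtain ⟨α, hα⟩ := exists_pow_lt_of_lt_one hc hθ1
  -- Base case `n < L`: the squared distance is at most `2 (a² + d²) + 2 |S|²`, with `|S|² ≤ 2 τ L +
  -- 1` on an event of probability at least `1 / 2`.
  set R : ℝ := 2 * L + 2 * (2 * τ * L + 1) with hR
  refine ⟨R, 1 / 2, α, by positivity, by norm_num, ?_⟩
  intro n
  induction n using Nat.strong_induction_on with
  | _ n ih =>
    intro a d had
    have hn0 : (0 : ℝ) ≤ n := Nat.cast_nonneg n
    rcases lt_or_ge n L with hn | hn
    · have hnL : (n : ℝ) ≤ L := by exact_mod_cast hn.le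
      have h1 := hτ' n (2 * τ * n + 1) (by positivity)
      have h2 : τ * n / (2 * τ * n + 1) ≤ 1 / 2 := by
        rw [div_le_div_iff₀ (by positivity) (by norm_num)]
        nlinarith
      have hset : MeasurableSet {y : Fin n → ℝ | 2 * τ * n + 1 <
          (∑ i, f (y i)) ^ 2 + (∑ i, g (y i)) ^ 2} :=
        measurableSet_lt measurable_const (((measurable_sum_comp H.measurable_left n).pow_const 2).add
          ((measurable_sum_comp H.measurable_right n).pow_const 2))
      have h3 := probReal_compl_eq_one_sub (μ := Measure.pi fun _ : Fin n => μ) hset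
      have h4 : (1 : ℝ) / 2 / (n + 1) ^ α ≤ 1 / 2 :=
        div_le_self (by norm_num) (one_le_pow₀ (by linarith))
      have h5 : 1 / 2 ≤ (Measure.pi fun _ : Fin n => μ).real {y : Fin n → ℝ | 2 * τ * n + 1 <
          (∑ i, f (y i)) ^ 2 + (∑ i, g (y i)) ^ 2}ᶜ := by
        rw [h3]; linarith
      refine h4.trans (h5.trans (measureReal_mono (fun y hy => ?_)))
      have hy' : (∑ i, f (y i)) ^ 2 + (∑ i, g (y i)) ^ 2 ≤ 2 * τ * n + 1 := not_lt.1 hy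
      have hτn : τ * n ≤ τ * L := mul_le_mul_of_nonneg_left hnL hτ.le
      simp only [Set.mem_ofPred_eq]
      nlinarith [sq_nonneg (a + ∑ i, f (y i)), sq_nonneg (d + ∑ i, g (y i))]
    · obtain ⟨k, hk1, hk2, hk3⟩ : ∃ k : ℕ, 1 ≤ k ∧ L * k ≤ n ∧ n < L * (k + 1) :=
        ⟨n / L, Nat.div_pos hn (by omega), Nat.mul_div_le n L, Nat.lt_mul_div_succ n (by omega)⟩
      have hkn : k < n := by nlinarith
      obtain ⟨m, rfl⟩ := Nat.exists_eq_add_of_le hkn.le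
      have hih := ih m (by omega)
      have hst := hstep k m hk1 hk2 a d (by push_cast at had; exact had)
      have happ := measurePreserving_append μ k m
      set E : Set (Fin k → ℝ) := {y | (a - ∑ i, f (y i)) ^ 2 + (d - ∑ i, g (y i)) ^ 2 ≤ m}
      have hmf := fun j => measurable_sum_comp H.measurable_left j
      have hmg := fun j => measurable_sum_comp H.measurable_right j
      have hE : MeasurableSet E :=
        measurableSet_le ((((hmf k).const_sub a).pow_const 2).add
          (((hmg k).const_sub d).pow_const 2)) measurable_const
      have hV : ∀ j, ∀ a' d' : ℝ, MeasurableSet {y : Fin j → ℝ |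
          (a' - ∑ i, f (y i)) ^ 2 + (d' - ∑ i, g (y i)) ^ 2 ≤ R} := fun j a' d' =>
        measurableSet_le ((((hmf j).const_sub a').pow_const 2).add
          (((hmg j).const_sub d').pow_const 2)) measurable_const
      set V : Set (Fin (k + m) → ℝ) :=
        {y | (a - ∑ i, f (y i)) ^ 2 + (d - ∑ i, g (y i)) ^ 2 ≤ R}
      have hVm : MeasurableSet V := hV _ a d
      have hlow : ENNReal.ofReal (1 / 2 / (m + 1) ^ α) * (Measure.pi fun _ : Fin k => μ) E ≤
          (Measure.pi fun _ : Fin (k + m) => μ) V := by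
        rw [← happ.map_eq, Measure.map_apply happ.measurable hVm,
          Measure.prod_apply (happ.measurable hVm), ← setLIntegral_const]
        refine (setLIntegral_mono_ae' hE (Eventually.of_forall fun y hy => ?_)).trans
          (setLIntegral_le_lintegral E _)
        have h1 := hih (a - ∑ i, f (y i)) (d - ∑ i, g (y i)) hy
        refine (ENNReal.ofReal_le_ofReal h1).trans ?_
        rw [ofReal_measureReal]
        refine measure_mono fun z hz => ?_
        have hz' : (a - ∑ i, f (y i) - ∑ i, f (z i)) ^ 2 +
          (d - ∑ i, g (y i) - ∑ i, g (z i)) ^ 2 ≤ R := hz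
        simp only [V, Set.mem_preimage, Set.mem_ofPred_eq, Fin.sum_univ_add, Fin.append_left,
          Fin.append_right]
        rw [← sub_sub, ← sub_sub]
        exact hz'
      have hlow' : 1 / 2 / (m + 1) ^ α * (Measure.pi fun _ : Fin k => μ).real E ≤
          (Measure.pi fun _ : Fin (k + m) => μ).real V := by
        have := ENNReal.toReal_mono (measure_ne_top _ _) hlow
        rwa [ENNReal.toReal_mul, ENNReal.toReal_ofReal (by positivity)] at this
      refine le_trans ?_ hlow'
      have hm1 : (m : ℝ) + 1 ≤ θ * ((k + m : ℕ) + 1) := by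
        have h1 : ((k + m : ℕ) : ℝ) < L * (k + 1) := by exact_mod_cast hk3
        have h2 : (1 : ℝ) ≤ k := by exact_mod_cast hk1
        have h3 : ((k + m : ℕ) : ℝ) + 1 ≤ 4 * L * k := by nlinarith
        have h4 : 1 / (4 * (L : ℝ)) * ((k + m : ℕ) + 1) ≤ k := by
          rw [one_div, inv_mul_le_iff₀ (by positivity)]
          exact h3
        rw [hθ]
        push_cast at h4 ⊢
        linarith
      have hm2 : ((m : ℝ) + 1) ^ α ≤ c * ((k + m : ℕ) + 1) ^ α := by
        calc ((m : ℝ) + 1) ^ α ≤ (θ * ((k + m : ℕ) + 1)) ^ α :=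
              pow_le_pow_left₀ (by positivity) hm1 α
          _ = θ ^ α * ((k + m : ℕ) + 1) ^ α := mul_pow _ _ _
          _ ≤ c * ((k + m : ℕ) + 1) ^ α := mul_le_mul_of_nonneg_right hα.le (by positivity)
      calc (1 : ℝ) / 2 / ((k + m : ℕ) + 1) ^ α ≤ 1 / 2 / (m + 1) ^ α * c := by
            rw [div_mul_eq_mul_div, div_le_div_iff₀ (by positivity) (by positivity)]
            linarith
        _ ≤ _ := mul_le_mul_of_nonneg_left hst (by positivity)

end Walk

/-! ### Comparison of the uniform distribution with the product law -/

lemma lintegral_fin_prod_eq_prod {μ : Measure ℝ} [SigmaFinite μ] {m : ℕ} (f : Fin m → ℝ → ℝ≥0∞)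
    (hf : ∀ i, Measurable (f i)) :
    ∫⁻ y : Fin m → ℝ, ∏ i, f i (y i) ∂(Measure.pi fun _ => μ) = ∏ i, ∫⁻ x, f i x ∂μ := by
  induction m with
  | zero => simp
  | succ m ih =>
    have hcons := measurePreserving_cons μ m
    have hmeas : Measurable fun y : Fin (m + 1) → ℝ => ∏ i, f i (y i) :=
      Finset.measurable_prod _ fun i _ => (hf i).comp (measurable_pi_apply i)
    rw [← hcons.map_eq, lintegral_map hmeas hcons.measurable, Fin.prod_univ_succ,
      ← ih (fun i => f i.succ) fun i => hf _, ← lintegral_prod_mul (hf 0).aemeasurable]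
    · simp only [Fin.prod_univ_succ, Fin.cons_zero, Fin.cons_succ]
    · exact (Finset.measurable_prod _ fun i _ =>
        (hf i.succ).comp (measurable_pi_apply i)).aemeasurable

/-- The unnormalized density of `G r s` on the open half-line. -/
def dens (r s x : ℝ) : ℝ≥0∞ := (Set.Ioi 0).indicator (fun x => ENNReal.ofReal (weight r s x)) x

lemma measurable_dens (r s : ℝ) : Measurable (dens r s) :=
  ((continuous_weight r s).measurable.ennreal_ofReal).indicator measurableSet_Ioi

lemma G_apply (r s : ℝ) {A : Set ℝ} (hA : MeasurableSet A) :
    G r s A = (mass r s)⁻¹ * ∫⁻ x in A, dens r s x := by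
  rw [G, Measure.smul_apply, smul_eq_mul, ← mass, ← restrict_Ioi_eq_restrict_Ici,
    withDensity_apply _ hA, Measure.restrict_restrict hA]
  congr 1
  rw [← lintegral_indicator hA, ← lintegral_indicator (hA.inter measurableSet_Ioi)]
  rw [← Set.indicator_indicator]
  rfl

lemma pi_G_eq {r s : ℝ} (h : mass r s ≠ ∞) (m : ℕ) :
    Measure.pi (fun _ : Fin m => G r s) = ((mass r s)⁻¹ ^ m) •
      (volume : Measure (Fin m → ℝ)).withDensity (fun y => ∏ i, dens r s (y i)) := by
  have := isProbabilityMeasure_G h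
  refine Measure.pi_eq fun A hA => ?_
  rw [Measure.smul_apply, withDensity_apply _ (MeasurableSet.univ_pi hA), smul_eq_mul,
    ← lintegral_indicator (MeasurableSet.univ_pi hA)]
  have hind : ∀ y : Fin m → ℝ, (Set.univ.pi A).indicator (fun y => ∏ i, dens r s (y i)) y =
      ∏ i, (A i).indicator (dens r s) (y i) := by
    intro y
    by_cases hy : y ∈ Set.univ.pi A
    · rw [Set.indicator_of_mem hy]
      exact Finset.prod_congr rfl fun i _ => (Set.indicator_of_mem (hy i (Set.mem_univ i)) _).symm
    · rw [Set.indicator_of_notMem hy]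
      simp only [Set.mem_pi, Set.mem_univ, true_imp_iff, not_forall] at hy
      obtain ⟨i, hi⟩ := hy
      exact (Finset.prod_eq_zero (Finset.mem_univ i) (Set.indicator_of_notMem hi _)).symm
  simp only [hind]
  rw [volume_pi, lintegral_fin_prod_eq_prod _ fun i => (measurable_dens r s).indicator (hA i)]
  simp only [lintegral_indicator (hA _), G_apply r s (hA _), Finset.prod_mul_distrib,
    Finset.prod_const, Finset.card_univ, Fintype.card_fin]

lemma setLIntegral_dens {r s : ℝ} (h : mass r s ≠ ∞) {m : ℕ} {A : Set (Fin m → ℝ)}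
    (hA : MeasurableSet A) : ∫⁻ y in A, ∏ i, dens r s (y i) =
      mass r s ^ m * Measure.pi (fun _ : Fin m => G r s) A := by
  rw [pi_G_eq h, Measure.smul_apply, withDensity_apply _ hA, smul_eq_mul, ← mul_assoc, ← mul_pow,
    ENNReal.mul_inv_cancel (mass_ne_zero r s) h, one_pow, one_mul]

/-- If one coordinate were nonpositive, the other two would have sum at least `p` and sum of squares
at most `q`, contradicting `2 * q < p ^ 2`. Under these conditions the whole circle lies in the
orthant. -/
lemma circ_pos {p q : ℝ} (hp : 0 < p) (h1 : p ^ 2 < 3 * q) (h2 : 2 * q < p ^ 2) (φ : ℝ) :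
    ∀ i, 0 < circ p q φ i := by
  have hs := sum_circ p q φ
  have hq := sum_circ_sq φ h1.le
  rw [Fin.sum_univ_three] at hs hq
  intro i
  by_contra! hi
  fin_cases i
  · simp only [Fin.zero_eta] at hi
    nlinarith [sq_nonneg (circ p q φ 1 - circ p q φ 2)]
  · simp only [Fin.mk_one] at hi
    nlinarith [sq_nonneg (circ p q φ 0 - circ p q φ 2)]
  · simp only [Fin.reduceFinMk] at hi
    nlinarith [sq_nonneg (circ p q φ 0 - circ p q φ 1)]

lemma prod_weight {r s : ℝ} {n : ℕ} (x : Fin n → ℝ) :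
    ∏ i, weight r s (x i) = Real.exp (-(r * ∑ i, x i ^ 2) - s * ∑ i, x i) := by
  simp only [weight, ← Real.exp_sum, Finset.sum_sub_distrib, Finset.sum_neg_distrib,
    Finset.mul_sum]

/-- The constant value of the product weight on `K (m + 3) b`. -/
def level (m : ℕ) (b r s : ℝ) : ℝ≥0∞ :=
  ENNReal.ofReal (Real.exp (-(r * (center m b).2) - s * (center m b).1))

lemma level_eq {m : ℕ} {b : ℝ} (r s : ℝ) {w : (Fin m → ℝ) × ℝ} (hw : w ∈ slice m b) :
    level m b r s = (∏ i, dens r s (w.1 i)) * ENNReal.ofReal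
      (Real.exp (-(r * ((center m b).2 - ∑ i, w.1 i ^ 2)) -
        s * ((center m b).1 - ∑ i, w.1 i))) := by
  have hpos : ∀ i, 0 < w.1 i := fun i => by
    simpa [pt] using hw.2 (Fin.castAdd 3 i)
  have h1 : ∏ i, dens r s (w.1 i) = ENNReal.ofReal (∏ i, weight r s (w.1 i)) := by
    rw [ENNReal.ofReal_prod_of_nonneg fun i _ => (weight_pos r s _).le]
    exact Finset.prod_congr rfl fun i _ => Set.indicator_of_mem (hpos i) _
  rw [h1, prod_weight, ← ENNReal.ofReal_mul (Real.exp_pos _).le, ← Real.exp_add, level]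
  ring_nf

lemma base_prod_univ {m : ℕ} (A : Set (Fin m → ℝ)) (F : (Fin m → ℝ) → ℝ≥0∞) (hF : Measurable F) :
    ∫⁻ w in A ×ˢ Set.univ, F w.1 ∂(base m) = ENNReal.ofReal (2 * Real.pi) * ∫⁻ y in A, F y := by
  have hF' : Measurable fun w : (Fin m → ℝ) × ℝ => F w.1 := hF.comp measurable_fst
  rw [base, ← Measure.prod_restrict, Measure.restrict_univ, lintegral_prod _ hF'.aemeasurable]
  simp only [lintegral_const, Measure.restrict_apply MeasurableSet.univ, Set.univ_inter,
    Real.volume_Ioo]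
  rw [lintegral_mul_const _ hF, mul_comm]
  ring_nf

/-- On the slice the constant `level` factors into the product density of the free coordinates and
the weights of the last three, each at most `W`. Integrating over the slice turns base measure into
product law. -/
lemma level_mul_base_le {r s b : ℝ} (h : 0 < r ∨ r = 0 ∧ s = 1) : ∃ W : ℝ, 0 < W ∧
    ∀ (m : ℕ) (A : Set (Fin m → ℝ)), MeasurableSet A →
      level m b r s * base m (slice m b ∩ A ×ˢ Set.univ) ≤ ENNReal.ofReal W *
        (ENNReal.ofReal (2 * Real.pi) * (mass r s ^ m *
          Measure.pi (fun _ : Fin m => G r s) A)) := by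
  obtain ⟨W, hW, hle⟩ := exists_weight_le h
  refine ⟨W ^ 3, by positivity, fun m A hA => ?_⟩
  have hmeas : Measurable fun y : Fin m → ℝ => ∏ i, dens r s (y i) :=
    Finset.measurable_prod _ fun i _ => (measurable_dens r s).comp (measurable_pi_apply i)
  have hmeas' : Measurable fun w : (Fin m → ℝ) × ℝ => ∏ i, dens r s (w.1 i) :=
    hmeas.comp measurable_fst
  have hAu : MeasurableSet (A ×ˢ (Set.univ : Set ℝ)) := hA.prod MeasurableSet.univ
  have hS := (isOpen_slice m b).measurableSet
  calc level m b r s * base m (slice m b ∩ A ×ˢ Set.univ)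
      = ∫⁻ w in slice m b ∩ A ×ˢ Set.univ, level m b r s ∂(base m) := by
        rw [setLIntegral_const]
    _ ≤ ∫⁻ w in slice m b ∩ A ×ˢ Set.univ,
          ENNReal.ofReal (W ^ 3) * ∏ i, dens r s (w.1 i) ∂(base m) := by
        refine setLIntegral_mono_ae' (hS.inter hAu) (Eventually.of_forall fun w hw => ?_)
        rw [level_eq r s hw.1, mul_comm]
        refine mul_le_mul_left (ENNReal.ofReal_le_ofReal ?_) _
        have hd : (center m b, w) ∈ circDomain m := hw.1.1
        have hz : ∀ i, 0 < circ ((center m b).1 - ∑ i, w.1 i)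
            ((center m b).2 - ∑ i, w.1 i ^ 2) w.2 i := fun i => by
          simpa [pt] using hw.1.2 (Fin.natAdd m i)
        have e := prod_weight (r := r) (s := s) (circ ((center m b).1 - ∑ i, w.1 i)
            ((center m b).2 - ∑ i, w.1 i ^ 2) w.2)
        rw [sum_circ, sum_circ_sq _ (le_of_lt hd)] at e
        rw [← e]
        calc ∏ i, weight r s (circ ((center m b).1 - ∑ i, w.1 i)
              ((center m b).2 - ∑ i, w.1 i ^ 2) w.2 i) ≤ ∏ _i : Fin 3, W := by
              refine Finset.prod_le_prod (fun i _ => (weight_pos r s _).le) fun i _ => ?_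
              refine (hle _).trans (mul_le_of_le_one_right hW.le ?_)
              exact Real.exp_le_one_iff.2 (by linarith [hz i])
          _ = W ^ 3 := by simp
    _ ≤ ∫⁻ w in A ×ˢ Set.univ, ENNReal.ofReal (W ^ 3) * ∏ i, dens r s (w.1 i) ∂(base m) :=
        lintegral_mono_set Set.inter_subset_right
    _ = _ := by
        rw [lintegral_const_mul _ hmeas', base_prod_univ A _ hmeas,
          setLIntegral_dens (mass_ne_top_of_param h) hA]

lemma isCenteredPair_G {r s b : ℝ} (h : 0 < r ∨ r = 0 ∧ s = 1) (hm : HasMoments r s b) :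
    IsCenteredPair (G r s) (fun x => x - 1) (fun x => x ^ 2 - b) where
  measurable_left := by fun_prop
  measurable_right := by fun_prop
  integrable u v k := by
    have := integrable_polynomial_G h ((Polynomial.C u * (Polynomial.X - 1) +
      Polynomial.C v * (Polynomial.X ^ 2 - Polynomial.C b)) ^ k)
    simpa using this
  integral_eq_zero u v := by
    have := hm.isProbabilityMeasure
    have e := (integral_linear_comb hm.integrable_id hm.integrable_sq
      (integrable_const (μ := G r s) (1 : ℝ)) u v (-u - v * b)).2
    rw [hm.first_moment, hm.second_moment] at e
    simp only [integral_const, probReal_univ, smul_eq_mul, mul_one] at e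
    have e2 : ∀ x : ℝ, u * (x - 1) + v * (x ^ 2 - b) = u * x + v * x ^ 2 + (-u - v * b) :=
      fun x => by ring
    simp only [e2, e]
    ring
  integral_sq_pos u v huv := integral_quadratic_sq_pos h huv

/-- With at least polynomial probability the free coordinates leave remainders `p, q` in a bounded
region where every angle is admissible. There the weight of the last three coordinates is at least
`c₁`. -/
lemma le_level_mul_base {r s b : ℝ} (h : 0 < r ∨ r = 0 ∧ s = 1) (hm : HasMoments r s b) :
    ∃ (c : ℝ) (α m₀ : ℕ), 0 < c ∧ ∀ m, m₀ ≤ m →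
      ENNReal.ofReal (c / (m + 1) ^ α) * (ENNReal.ofReal (2 * Real.pi) * mass r s ^ m) ≤
        level m b r s * base m (slice m b) := by
  have := hm.isProbabilityMeasure
  obtain ⟨R, c, α, hR, hc, hlow⟩ := (isCenteredPair_G h hm).exists_local_lower_bound
  set ρ := √R with hρ
  have hρ0 : 0 < ρ := Real.sqrt_pos.2 hR
  have hρ2 : ρ ^ 2 = R := Real.sq_sqrt hR.le
  -- The remainders `p, q` will be within `ρ` of `M, M₂`. Since `1 / 3 < 2 / 5 < 1 / 2`, a large
  -- multiple of `ρ + 1` keeps both `p ^ 2 < 3 * q` and `2 * q < p ^ 2` despite this error.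
  set M : ℝ := 20 * (ρ + 1) with hM
  set M₂ : ℝ := 2 / 5 * M ^ 2 with hM₂
  set c₁ : ℝ := Real.exp (-(|r| * (M₂ + ρ)) - |s| * (M + ρ)) with hc₁
  -- In centred steps the target is `(3 - M, 3 b - M₂)`, because the totals are those of `m + 3`
  -- coordinates. It is within diffusive range once `m ≥ m₀`.
  obtain ⟨m₀, hm₀⟩ := exists_nat_ge ((3 - M) ^ 2 + (3 * b - M₂) ^ 2)
  refine ⟨c₁ * c, α, m₀, mul_pos (Real.exp_pos _) hc, fun m hmm => ?_⟩
  have hlow' := hlow m (3 - M) (3 * b - M₂) (hm₀.trans (by exact_mod_cast hmm))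
  set V : Set (Fin m → ℝ) :=
    {y | (3 - M - ∑ i, (y i - 1)) ^ 2 + (3 * b - M₂ - ∑ i, (y i ^ 2 - b)) ^ 2 ≤ R} with hVdef
  have hV : MeasurableSet V := measurableSet_le (by fun_prop) measurable_const
  have hmeas : Measurable fun y : Fin m → ℝ => ∏ i, dens r s (y i) :=
    Finset.measurable_prod _ fun i _ => (measurable_dens r s).comp (measurable_pi_apply i)
  have hmeas' : Measurable fun w : (Fin m → ℝ) × ℝ => ∏ i, dens r s (w.1 i) :=
    hmeas.comp measurable_fst
  have hpos : MeasurableSet {y : Fin m → ℝ | ∀ i, 0 < y i} := by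
    simp only [Set.ofPred_forall]
    exact MeasurableSet.iInter fun i => measurableSet_lt measurable_const (measurable_pi_apply i)
  have hbox : ∀ y ∈ V, |(center m b).1 - ∑ i, y i - M| ≤ ρ ∧
      |(center m b).2 - ∑ i, y i ^ 2 - M₂| ≤ ρ := by
    intro y hy
    have hy' : (3 - M - ∑ i, (y i - 1)) ^ 2 + (3 * b - M₂ - ∑ i, (y i ^ 2 - b)) ^ 2 ≤ R := hy
    have e1 : (center m b).1 - ∑ i, y i - M = 3 - M - ∑ i, (y i - 1) := by
      simp [center, Finset.sum_sub_distrib]; ring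
    have e2 : (center m b).2 - ∑ i, y i ^ 2 - M₂ = 3 * b - M₂ - ∑ i, (y i ^ 2 - b) := by
      simp [center, Finset.sum_sub_distrib]; ring
    rw [e1, e2]
    constructor
    · refine abs_le_of_sq_le_sq ?_ hρ0.le
      nlinarith [sq_nonneg (3 * b - M₂ - ∑ i, (y i ^ 2 - b))]
    · refine abs_le_of_sq_le_sq ?_ hρ0.le
      nlinarith [sq_nonneg (3 - M - ∑ i, (y i - 1))]
  have hmem : ∀ w : (Fin m → ℝ) × ℝ, w.1 ∈ V → (∀ i, 0 < w.1 i) → w ∈ slice m b := by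
    intro w hwV hw0
    obtain ⟨h1, h2⟩ := hbox _ hwV
    rw [abs_le] at h1 h2
    set p := (center m b).1 - ∑ i, w.1 i
    set q := (center m b).2 - ∑ i, w.1 i ^ 2
    have hp : 0 < p := by linarith [h1.1]
    have hMρ : 4 * (ρ + 1) * M = 1 / 5 * M ^ 2 := by rw [hM]; ring
    have hM20 : 20 ≤ M := by linarith
    have hp1 : p ^ 2 ≤ (M + ρ) ^ 2 := pow_le_pow_left₀ hp.le (by linarith) 2
    have hp2 : (M - ρ) ^ 2 ≤ p ^ 2 := pow_le_pow_left₀ (by linarith) (by linarith) 2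
    have hpq : p ^ 2 < 3 * q := by nlinarith
    have hpq2 : 2 * q < p ^ 2 := by nlinarith
    refine ⟨hpq, fun i => ?_⟩
    refine Fin.addCases (fun i => ?_) (fun i => ?_) i
    · simpa [pt] using hw0 i
    · simpa [pt] using circ_pos hp hpq hpq2 w.2 i
  have hle : ∀ w : (Fin m → ℝ) × ℝ, w.1 ∈ V → (∀ i, 0 < w.1 i) →
      ENNReal.ofReal c₁ * ∏ i, dens r s (w.1 i) ≤ level m b r s := by
    intro w hwV hw0
    rw [level_eq r s (hmem w hwV hw0), mul_comm]
    refine mul_le_mul_right (ENNReal.ofReal_le_ofReal (Real.exp_le_exp.2 ?_)) _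
    obtain ⟨h1, h2⟩ := hbox _ hwV
    rw [abs_le] at h1 h2
    have hM0 : 0 < M := by positivity
    have hM₂0 : 0 < M₂ := by positivity
    set p := (center m b).1 - ∑ i, w.1 i
    set q := (center m b).2 - ∑ i, w.1 i ^ 2
    have hq' : |q| ≤ M₂ + ρ := abs_le.2 ⟨by linarith, by linarith⟩
    have hp' : |p| ≤ M + ρ := abs_le.2 ⟨by linarith, by linarith⟩
    have h3 : r * q ≤ |r| * (M₂ + ρ) := (le_abs_self _).trans
      (by rw [abs_mul]; exact mul_le_mul_of_nonneg_left hq' (abs_nonneg _))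
    have h4 : s * p ≤ |s| * (M + ρ) := (le_abs_self _).trans
      (by rw [abs_mul]; exact mul_le_mul_of_nonneg_left hp' (abs_nonneg _))
    linarith
  have hVp := hV.inter hpos
  calc ENNReal.ofReal (c₁ * c / (m + 1) ^ α) * (ENNReal.ofReal (2 * Real.pi) * mass r s ^ m)
      = ENNReal.ofReal c₁ * (ENNReal.ofReal (2 * Real.pi) * (mass r s ^ m *
          ENNReal.ofReal (c / (m + 1) ^ α))) := by
        rw [mul_div_assoc, ENNReal.ofReal_mul (Real.exp_pos _).le]
        ring
    _ ≤ ENNReal.ofReal c₁ * (ENNReal.ofReal (2 * Real.pi) * (mass r s ^ m *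
          Measure.pi (fun _ : Fin m => G r s) V)) := by
        gcongr
        rw [← ofReal_measureReal]
        exact ENNReal.ofReal_le_ofReal hlow'
    _ = ENNReal.ofReal c₁ * (ENNReal.ofReal (2 * Real.pi) *
          ∫⁻ y in V ∩ {y | ∀ i, 0 < y i}, ∏ i, dens r s (y i)) := by
        rw [← setLIntegral_dens (mass_ne_top_of_param h) hV, ← lintegral_indicator hV,
          ← lintegral_indicator hVp]
        congr 3
        ext y
        by_cases hy : ∀ i, 0 < y i
        · by_cases hyV : y ∈ V <;> simp [Set.indicator, hy, hyV]
        · have : ∏ i, dens r s (y i) = 0 := by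
            push Not at hy
            obtain ⟨i, hi⟩ := hy
            exact Finset.prod_eq_zero (Finset.mem_univ i)
              (Set.indicator_of_notMem (by simpa using hi) _)
          simp [Set.indicator, this]
    _ = ∫⁻ w in (V ∩ {y | ∀ i, 0 < y i}) ×ˢ Set.univ,
          ENNReal.ofReal c₁ * ∏ i, dens r s (w.1 i) ∂(base m) := by
        rw [lintegral_const_mul _ hmeas', base_prod_univ _ _ hmeas]
    _ ≤ ∫⁻ w in (V ∩ {y | ∀ i, 0 < y i}) ×ˢ Set.univ, level m b r s ∂(base m) :=
        setLIntegral_mono_ae' (hVp.prod MeasurableSet.univ)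
          (Eventually.of_forall fun w hw => hle w hw.1.1 hw.1.2)
    _ ≤ level m b r s * base m (slice m b) := by
        rw [setLIntegral_const]
        gcongr
        exact fun w hw => hmem w hw.1.1 hw.1.2

/-- The law of all but three coordinates of the uniform distribution on `K (m + 3) b` is dominated
by a polynomial multiple of the product law. -/
theorem exists_unif_map_le {r s b : ℝ} (hb1 : 1 < b) (hb2 : b ≤ 2) (h : 0 < r ∨ r = 0 ∧ s = 1)
    (hm : HasMoments r s b) : ∃ (C : ℝ) (α m₀ : ℕ), 0 < C ∧ ∀ m, m₀ ≤ m →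
      (unif m b).map (fun x i => x (Fin.castAdd 3 i)) ≤
        ENNReal.ofReal (C * (m + 1) ^ α) • Measure.pi (fun _ : Fin m => G r s) := by
  obtain ⟨W, hW, hup⟩ := level_mul_base_le (b := b) h
  obtain ⟨c, α, m₀, hc, hlow⟩ := le_level_mul_base h hm
  have hmass := mass_ne_top_of_param h
  refine ⟨W / c, α, m₀, by positivity, fun m hmm => ?_⟩
  have hS := (isOpen_slice m b).measurableSet
  have hS0 := base_slice_ne_zero (m := m) hb1 hb2
  have hSt := base_slice_ne_top m b
  have hproj : Measurable fun (x : Fin (m + 3) → ℝ) (i : Fin m) => x (Fin.castAdd 3 i) := by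
    fun_prop
  refine Measure.le_iff.2 fun A hA => ?_
  rw [unif, Measure.map_map hproj (continuous_pt_right _).measurable,
    Measure.map_apply (hproj.comp (continuous_pt_right _).measurable) hA, cond_apply hS,
    Measure.smul_apply, smul_eq_mul]
  have hpre : ((fun (x : Fin (m + 3) → ℝ) (i : Fin m) => x (Fin.castAdd 3 i)) ∘
      pt (center m b)) ⁻¹' A = A ×ˢ Set.univ := by
    ext w
    simp [pt]
  rw [hpre]
  set B := base m (slice m b)
  set BA := base m (slice m b ∩ A ×ˢ Set.univ)
  set P := Measure.pi (fun _ : Fin m => G r s) A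
  set Q := ENNReal.ofReal (2 * Real.pi) * mass r s ^ m with hQ
  have hQ0 : Q ≠ 0 := mul_ne_zero (by simpa using Real.pi_pos)
    (pow_ne_zero _ (mass_ne_zero r s))
  have hQt : Q ≠ ∞ := ENNReal.mul_ne_top ENNReal.ofReal_ne_top (ENNReal.pow_ne_top hmass)
  set l := ENNReal.ofReal (c / (m + 1) ^ α)
  have hl0 : l ≠ 0 := by
    simp only [l, ne_eq, ENNReal.ofReal_eq_zero, not_le]
    positivity
  have hlt : l ≠ ∞ := ENNReal.ofReal_ne_top
  -- Both estimates carry the common factor `Q` and the unknown constant `level`; these drop out of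
  -- the ratio of base measures.
  have hkey : (B⁻¹ * BA) * l * Q ≤ ENNReal.ofReal W * P * Q := by
    calc (B⁻¹ * BA) * l * Q = (B⁻¹ * BA) * (l * Q) := by ring
      _ ≤ (B⁻¹ * BA) * (level m b r s * B) := mul_le_mul_right (hlow m hmm) _
      _ = (B⁻¹ * B) * (level m b r s * BA) := by ring
      _ = level m b r s * BA := by rw [ENNReal.inv_mul_cancel hS0 hSt, one_mul]
      _ ≤ ENNReal.ofReal W * (ENNReal.ofReal (2 * Real.pi) * (mass r s ^ m * P)) := hup m A hA
      _ = ENNReal.ofReal W * P * Q := by rw [hQ]; ring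
  have hkey2 := (ENNReal.mul_le_mul_iff_left hQ0 hQt).1 hkey
  have e : ENNReal.ofReal (W / c * (m + 1) ^ α) = ENNReal.ofReal W / l := by
    rw [← ENNReal.ofReal_div_of_pos (by positivity)]
    congr 1
    field_simp
  rw [e, ← ENNReal.mul_le_mul_iff_left hl0 hlt]
  calc (B⁻¹ * BA) * l ≤ ENNReal.ofReal W * P := hkey2
    _ = ENNReal.ofReal W / l * P * l := by
      rw [mul_right_comm, ENNReal.div_mul_cancel hl0 hlt]

/-! ### Concentration of empirical averages under a dominated law -/

lemma measurePreserving_precomp {ι κ E : Type*} [Fintype ι] [Fintype κ] [MeasurableSpace E]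
    (ρ : Measure E) [IsProbabilityMeasure ρ] {g : κ → ι} (hg : g.Injective) :
    MeasurePreserving (fun (y : ι → E) i => y (g i)) (Measure.pi fun _ => ρ)
      (Measure.pi fun _ => ρ) := by
  have h := (iIndepFun_pi (μ := fun _ : ι => ρ) (X := fun _ x => x)
    fun _ => aemeasurable_id).precomp hg
  refine ⟨by fun_prop, ?_⟩
  rw [(iIndepFun_iff_map_fun_eq_pi_map fun i =>
    (measurable_pi_apply (g i)).aemeasurable).1 h]
  congr 1
  ext1 i
  exact (measurePreserving_eval (fun _ : ι => ρ) (g i)).map_eq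

lemma measurePreserving_curry {ι κ E : Type*} [Fintype ι] [Fintype κ] [MeasurableSpace E]
    (ρ : Measure E) [IsProbabilityMeasure ρ] :
    MeasurePreserving (MeasurableEquiv.curry ι κ E) (Measure.pi fun _ => ρ)
      (Measure.pi fun _ => Measure.pi fun _ => ρ) := by
  refine ⟨(MeasurableEquiv.curry ι κ E).measurable, ?_⟩
  simpa only [Measure.infinitePi_eq_pi] using Measure.infinitePi_map_curry (fun (_ : ι) (_ : κ) => ρ)

lemma pi_sum_ge_le {E : Type*} [MeasurableSpace E] (ρ : Measure E) [IsProbabilityMeasure ρ]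
    {f : E → ℝ} (hf : Measurable f) {T : ℝ} (hT : 0 < T) (hfT : ∀ x, |f x| ≤ T) {M : ℕ}
    (hM : 0 < M) {δ : ℝ} (hδ : 0 ≤ δ) :
    (Measure.pi fun _ : Fin M => ρ).real {y | M * δ ≤ ∑ j, (f (y j) - ∫ x, f x ∂ρ)} ≤
      Real.exp (-(M * δ ^ 2 / (2 * T ^ 2))) := by
  set π := Measure.pi fun _ : Fin M => ρ
  have hsub : HasSubgaussianMGF (fun x => f x - ∫ x, f x ∂ρ) ((‖T - -T‖₊ / 2) ^ 2) ρ :=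
    hasSubgaussianMGF_of_mem_Icc hf.aemeasurable
      (Eventually.of_forall fun x => ⟨(abs_le.1 (hfT x)).1, (abs_le.1 (hfT x)).2⟩)
  have hind : iIndepFun (fun j (y : Fin M → E) => f (y j) - ∫ x, f x ∂ρ) π :=
    iIndepFun_pi (X := fun _ x => f x - ∫ x, f x ∂ρ) fun _ => (hf.sub_const _).aemeasurable
  have hj : ∀ j ∈ (Finset.univ : Finset (Fin M)),
      HasSubgaussianMGF (fun y : Fin M → E => f (y j) - ∫ x, f x ∂ρ) ((‖T - -T‖₊ / 2) ^ 2) π := by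
    intro j _
    have he := measurePreserving_eval (fun _ : Fin M => ρ) j
    exact HasSubgaussianMGF.of_map (X := fun x => f x - ∫ x, f x ∂ρ) he.measurable.aemeasurable
      (he.map_eq.symm ▸ hsub)
  refine (HasSubgaussianMGF.measure_sum_ge_le_of_iIndepFun hind hj
    (by positivity : 0 ≤ M * δ)).trans (Real.exp_le_exp.2 (le_of_eq ?_))
  have hn : ((‖T - -T‖₊ / 2) ^ 2 : NNReal) = (T.toNNReal) ^ 2 := by
    ext
    simp [abs_of_pos hT, hT.le, ← two_mul]
  have hM' : (0 : ℝ) < M := by exact_mod_cast hM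
  rw [hn]
  simp only [Finset.sum_const, Finset.card_univ, Fintype.card_fin, nsmul_eq_mul]
  push_cast
  rw [Real.coe_toNNReal _ hT.le]
  field_simp

lemma pi_abs_sum_ge_le {E : Type*} [MeasurableSpace E] (ρ : Measure E) [IsProbabilityMeasure ρ]
    {f : E → ℝ} (hf : Measurable f) {T : ℝ} (hT : 0 < T) (hfT : ∀ x, |f x| ≤ T) {M : ℕ}
    (hM : 0 < M) {δ : ℝ} (hδ : 0 ≤ δ) :
    (Measure.pi fun _ : Fin M => ρ).real {y | M * δ ≤ |∑ j, (f (y j) - ∫ x, f x ∂ρ)|} ≤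
      2 * Real.exp (-(M * δ ^ 2 / (2 * T ^ 2))) := by
  have h1 := pi_sum_ge_le ρ hf hT hfT hM hδ
  have h2 := pi_sum_ge_le ρ hf.neg hT (by simpa using hfT) hM hδ
  rw [two_mul]
  refine le_trans ?_ (add_le_add h1 h2)
  refine (measureReal_mono ?_).trans (measureReal_union_le _ _)
  intro y hy
  rcases le_abs.1 (Set.mem_ofPred_eq ▸ hy) with h | h
  · exact Or.inl h
  · refine Or.inr ?_
    change M * δ ≤ ∑ j, (-f (y j) - ∫ x, -f x ∂ρ)
    rw [integral_neg]
    refine h.trans (le_of_eq ?_)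
    rw [← Finset.sum_neg_distrib]
    exact Finset.sum_congr rfl fun _ _ => by ring

lemma le_smul_of_map_eval {E : Type*} [MeasurableSpace E] {ρ L : Measure E}
    [IsProbabilityMeasure ρ] {M : ℕ} {R : Measure (Fin M → E)} {c : ℝ} (hM : 0 < M)
    (hR : R ≤ ENNReal.ofReal c • Measure.pi fun _ => ρ)
    (hL : ∀ j, R.map (fun y => y j) = L) : L ≤ ENNReal.ofReal c • ρ := by
  have he := measurePreserving_eval (fun _ : Fin M => ρ) ⟨0, hM⟩
  rw [← hL ⟨0, hM⟩, ← he.map_eq, ← Measure.map_smul]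
  exact Measure.map_mono hR he.measurable

lemma abs_sub_clamp_le {x T : ℝ} (hT : 0 < T) (j : ℕ) :
    |x - max (-T) (min T x)| ≤ |x| ^ (j + 1) / T ^ j := by
  by_cases hx : |x| ≤ T
  · have := abs_le.1 hx
    rw [min_eq_right this.2, max_eq_right this.1, sub_self, abs_zero]
    positivity
  · have h1 : |x - max (-T) (min T x)| ≤ |x| := by
      rcases le_total x T with h | h <;> rcases le_total (-T) x with h' | h'
      · exact absurd (abs_le.2 ⟨h', h⟩) hx
      · rw [min_eq_right h, max_eq_left h', abs_of_nonpos (by linarith),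
          abs_of_nonpos (by linarith)]
        linarith
      · rw [min_eq_left h, max_eq_right (by linarith), abs_of_nonneg (by linarith),
          abs_of_nonneg (by linarith)]
        linarith
      · linarith
    refine h1.trans ?_
    rw [le_div_iff₀ (by positivity), pow_succ, mul_comm]
    gcongr
    exact (not_le.1 hx).le

section Dominated

variable {E : Type*} [MeasurableSpace E] {ρ L : Measure E} [IsProbabilityMeasure ρ]
  [IsProbabilityMeasure L] {M : ℕ} {R : Measure (Fin M → E)} [IsProbabilityMeasure R] {c : ℝ}

/-- All marginals of `R` equal `L`, so the difference of means is the `R`-mean of a centred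
empirical average. That average is below `δ` off a Hoeffding event and at most `2 T` on it, and
domination multiplies the probability of the event by at most `c`. -/
lemma abs_integral_sub_le_of_bounded (hM : 0 < M) (hc : 0 ≤ c)
    (hR : R ≤ ENNReal.ofReal c • Measure.pi fun _ => ρ)
    (hL : ∀ j, R.map (fun y => y j) = L) {f : E → ℝ} (hf : Measurable f) {T : ℝ} (hT : 0 < T)
    (hfT : ∀ x, |f x| ≤ T) {δ : ℝ} (hδ : 0 ≤ δ) :
    |∫ x, f x ∂L - ∫ x, f x ∂ρ| ≤ δ + 4 * T * c * Real.exp (-(M * δ ^ 2 / (2 * T ^ 2))) := by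
  have hM' : (0 : ℝ) < M := by exact_mod_cast hM
  set e := ∫ x, f x ∂ρ with he
  have hbd : ∀ {ν : Measure E} [IsProbabilityMeasure ν], Integrable f ν := fun {ν} _ =>
    Integrable.of_bound hf.aestronglyMeasurable T (Eventually.of_forall hfT)
  have heT : |e| ≤ T := by
    simpa using norm_integral_le_of_norm_le_const (μ := ρ) (f := f) (C := T) (Eventually.of_forall hfT)
  set S : (Fin M → E) → ℝ := fun y => ∑ j, (f (y j) - e)
  have hS : Measurable S := by fun_prop
  set A := {y | M * δ ≤ |S y|}
  have hA : MeasurableSet A := measurableSet_le measurable_const hS.abs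
  have hSle : ∀ y, |S y| ≤ M * (2 * T) := fun y => by
    refine (Finset.abs_sum_le_sum_abs _ _).trans ((Finset.sum_le_card_nsmul _ _ (2 * T)
      fun j _ => ?_).trans_eq (by simp))
    exact (abs_sub _ _).trans (by linarith [hfT (y j)])
  have hint : ∫ y, S y ∂ R = M * (∫ x, f x ∂L - e) := by
    have hj : ∀ j, ∫ y, (f (y j) - e) ∂ R = ∫ x, f x ∂L - e := fun j => by
      have := integral_map (μ := R) (measurable_pi_apply j).aemeasurable
        (hf.sub_const e).aestronglyMeasurable
      rw [← this, hL j, integral_sub hbd (integrable_const _)]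
      simp
    rw [integral_finsetSum]
    · simp [hj, mul_sub]
    · intro j _
      refine Integrable.of_bound
        ((hf.comp (measurable_pi_apply j)).sub_const e).aestronglyMeasurable (2 * T) (Eventually.of_forall fun y => ?_)
      exact (abs_sub _ _).trans (by linarith [hfT (y j)])
  have hRA : R.real A ≤ c * (2 * Real.exp (-(M * δ ^ 2 / (2 * T ^ 2)))) := by
    refine le_trans ?_ (mul_le_mul_of_nonneg_left (pi_abs_sum_ge_le ρ hf hT hfT hM hδ) hc)
    have := ENNReal.toReal_mono 
      (ENNReal.mul_ne_top ENNReal.ofReal_ne_top (measure_ne_top _ A)) (hR A)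
    rwa [ENNReal.toReal_mul, ENNReal.toReal_ofReal hc] at this
  have hpt : ∀ y, |S y| ≤ M * δ + A.indicator (fun _ => M * (2 * T)) y := fun y => by
    by_cases hy : y ∈ A
    · rw [Set.indicator_of_mem hy]
      exact (hSle y).trans (by nlinarith)
    · rw [Set.indicator_of_notMem hy, add_zero]
      exact (not_le.1 hy).le
  have hfin : M * |∫ x, f x ∂L - e| ≤ M * δ + M * (2 * T) * R.real A := by
    calc M * |∫ x, f x ∂L - e| = |∫ y, S y ∂ R| := by rw [hint, abs_mul, abs_of_pos hM']
      _ ≤ ∫ y, |S y| ∂ R := abs_integral_le_integral_abs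
      _ ≤ ∫ y, (M * δ + A.indicator (fun _ => M * (2 * T)) y) ∂ R := by
          refine integral_mono_of_nonneg (Eventually.of_forall fun _ => abs_nonneg _)
            ((integrable_const _).add ((integrable_const _).indicator hA))
            (Eventually.of_forall hpt)
      _ = M * δ + M * (2 * T) * R.real A := by
          rw [integral_add (integrable_const _) ((integrable_const _).indicator hA),
            integral_indicator hA]
          simp [mul_comm]
  have h3 : |∫ x, f x ∂L - e| ≤ δ + 2 * T * R.real A := by
    refine le_of_mul_le_mul_left (hfin.trans_eq ?_) hM'
    ring
  refine h3.trans ?_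
  have := mul_le_mul_of_nonneg_left hRA (by positivity : 0 ≤ 2 * T)
  linarith

/-- Clamp `f` to `[-T, T]` and apply the bounded case. The clamping error costs an absolute moment
over `T ^ j`, once under `ρ` and `c` times under `L`. -/
lemma abs_integral_sub_le (hM : 0 < M) (hc : 0 ≤ c)
    (hR : R ≤ ENNReal.ofReal c • Measure.pi fun _ => ρ)
    (hL : ∀ j, R.map (fun y => y j) = L) {f : E → ℝ} (hf : Measurable f)
    (hint : ∀ j : ℕ, Integrable (fun x => |f x| ^ j) ρ) (j : ℕ) {T : ℝ} (hT : 0 < T)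
    {δ : ℝ} (hδ : 0 ≤ δ) :
    |∫ x, f x ∂L - ∫ x, f x ∂ρ| ≤ δ + 4 * T * c * Real.exp (-(M * δ ^ 2 / (2 * T ^ 2))) +
      (c + 1) * ((∫ x, |f x| ^ (j + 1) ∂ρ) / T ^ j) := by
  have hLρ := le_smul_of_map_eval hM hR hL
  have hintL : ∀ {g : E → ℝ}, Integrable g ρ → Integrable g L := fun hg =>
    (hg.smul_measure ENNReal.ofReal_ne_top).mono_measure hLρ
  set g : E → ℝ := fun x => max (-T) (min T (f x))
  have hg : Measurable g := by fun_prop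
  have hgT : ∀ x, |g x| ≤ T := fun x =>
    abs_le.2 ⟨le_max_left _ _, max_le (by linarith) (min_le_left _ _)⟩
  have hfρ : Integrable f ρ := (integrable_norm_iff hf.aestronglyMeasurable).1
    (by simpa using hint 1)
  have hbd : ∀ {ν : Measure E} [IsProbabilityMeasure ν], Integrable g ν := fun {ν} _ =>
    Integrable.of_bound hg.aestronglyMeasurable T (Eventually.of_forall hgT)
  have hq := hint (j + 1)
  have hqT : Integrable (fun x => |f x| ^ (j + 1) / T ^ j) ρ := hq.div_const _
  set I := (∫ x, |f x| ^ (j + 1) ∂ρ) / T ^ j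
  have key : ∀ {ν : Measure E} [IsProbabilityMeasure ν], Integrable f ν →
      Integrable (fun x => |f x| ^ (j + 1) / T ^ j) ν →
      |∫ x, f x ∂ν - ∫ x, g x ∂ν| ≤ ∫ x, |f x| ^ (j + 1) / T ^ j ∂ν := by
    intro ν _ hfν hqν
    rw [← integral_sub hfν hbd]
    exact abs_integral_le_integral_abs.trans (integral_mono_of_nonneg
      (Eventually.of_forall fun _ => abs_nonneg _) hqν
      (Eventually.of_forall fun x => abs_sub_clamp_le hT j))
  have h1 := key hfρ hqT
  have h2 := key (hintL hfρ) (hintL hqT)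
  have h3 : ∫ x, |f x| ^ (j + 1) / T ^ j ∂L ≤ c * I := by
    refine (integral_mono_measure hLρ (Eventually.of_forall fun x => by positivity)
      (hqT.smul_measure ENNReal.ofReal_ne_top)).trans_eq ?_
    rw [integral_smul_measure, ENNReal.toReal_ofReal hc, integral_div, smul_eq_mul]
  rw [integral_div] at h1
  have h4 := abs_integral_sub_le_of_bounded hM hc hR hL hg hT hgT hδ
  rw [abs_le] at *
  constructor <;> linarith [h1.1, h1.2, h2.1, h2.2, h4.1, h4.2]

end Dominated

/-! ### Convergence of the finite-dimensional laws -/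

lemma measurable_firstCoords (k n : ℕ) : Measurable (firstCoords k (n := n)) := by
  refine measurable_pi_lambda _ fun i => ?_
  unfold firstCoords
  split_ifs
  · exact measurable_pi_apply _
  · exact measurable_const

lemma firstCoords_eq {k n : ℕ} (h : k ≤ n) (x : Fin n → ℝ) :
    firstCoords k x = fun i => x (Fin.castLE h i) := by
  ext i
  simp [firstCoords, i.2.trans_le h, Fin.castLE]

lemma IsUniformOnK.map_precomp_eq {n : ℕ} {b : ℝ} {P : Measure (Fin n → ℝ)}
    (hP : IsUniformOnK n b P) {κ : Type*} [Fintype κ] {f g : κ → Fin n} (hf : f.Injective)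
    (hg : g.Injective) : P.map (fun x i => x (f i)) = P.map (fun x i => x (g i)) := by
  obtain ⟨σ, hσ⟩ := Equiv.Perm.exists_extending_pair f g hf hg
  conv_lhs => rw [← hP.map_perm σ]
  rw [Measure.map_map (by fun_prop) (by fun_prop)]
  congr 1
  ext x i
  simp [hσ]

/-- The `j`-th of `M` consecutive blocks of `k` indices below `m`. -/
def block {M k m : ℕ} (h : M * k ≤ m) (p : Fin M × Fin k) : Fin m :=
  Fin.castLE h (finProdFinEquiv p)

lemma block_injective {M k m : ℕ} (h : M * k ≤ m) : (block h).Injective :=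
  (Fin.castLE_injective h).comp finProdFinEquiv.injective

/-- Cut the free coordinates into disjoint blocks of length `k`. Under the product law the blocks
are i.i.d.; under the uniform law exchangeability gives each of them the law of the first `k`
coordinates. -/
lemma abs_integral_unif_sub_le {b : ℝ} (hb1 : 1 < b) (hb2 : b ≤ 2) {ν : Measure ℝ}
    [IsProbabilityMeasure ν] {m : ℕ} {c : ℝ} (hc : 0 ≤ c)
    (hle : (unif m b).map (fun x i => x (Fin.castAdd 3 i)) ≤
      ENNReal.ofReal c • Measure.pi (fun _ : Fin m => ν)) {k M : ℕ} (hM : 0 < M) (hMk : M * k ≤ m)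
    {F : (Fin k → ℝ) → ℝ} (hF : Measurable F)
    (hint : ∀ j : ℕ, Integrable (fun x => |F x| ^ j) (Measure.pi fun _ => ν)) (j : ℕ) {T : ℝ}
    (hT : 0 < T) {δ : ℝ} (hδ : 0 ≤ δ) :
    |∫ x, F (firstCoords k x) ∂(unif m b) - ∫ x, F x ∂(Measure.pi fun _ => ν)| ≤
      δ + 4 * T * c * Real.exp (-(M * δ ^ 2 / (2 * T ^ 2))) +
      (c + 1) * ((∫ x, |F x| ^ (j + 1) ∂(Measure.pi fun _ : Fin k => ν)) / T ^ j) := by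
  have hU := isUniformOnK_unif (m := m) hb1 hb2
  have := hU.isProbabilityMeasure
  have hproj : Measurable fun (x : Fin (m + 3) → ℝ) (i : Fin m) => x (Fin.castAdd 3 i) := by
    fun_prop
  set B : (Fin m → ℝ) → Fin M → Fin k → ℝ := fun y => Function.curry fun p => y (block hMk p)
  have hB : MeasurePreserving B (Measure.pi fun _ => ν)
      (Measure.pi fun _ => Measure.pi fun _ => ν) :=
    (measurePreserving_curry ν).comp (measurePreserving_precomp ν (block_injective hMk))
  have hfc := measurable_firstCoords k (m + 3)
  set R := ((unif m b).map (fun x i => x (Fin.castAdd 3 i))).map B with hRdef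
  have : IsProbabilityMeasure ((unif m b).map (fun x (i : Fin m) => x (Fin.castAdd 3 i))) :=
    Measure.isProbabilityMeasure_map hproj.aemeasurable
  have : IsProbabilityMeasure R := Measure.isProbabilityMeasure_map hB.measurable.aemeasurable
  have : IsProbabilityMeasure ((unif m b).map (firstCoords k)) :=
    Measure.isProbabilityMeasure_map hfc.aemeasurable
  have hR : R ≤ ENNReal.ofReal c • Measure.pi fun _ => Measure.pi fun _ => ν := by
    rw [← hB.map_eq, ← Measure.map_smul]
    exact Measure.map_mono hle hB.measurable
  have hkm : k ≤ m + 3 := by nlinarith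
  have hL : ∀ j, R.map (fun y => y j) = (unif m b).map (firstCoords k) := by
    intro j
    rw [hRdef, Measure.map_map (measurable_pi_apply j) hB.measurable,
      Measure.map_map ((measurable_pi_apply j).comp hB.measurable) hproj]
    rw [show firstCoords k (n := m + 3) = fun x i => x (Fin.castLE hkm i) from
      funext (firstCoords_eq hkm)]
    exact hU.map_precomp_eq (f := fun i => Fin.castAdd 3 (block hMk (j, i)))
      (fun a a' h => by simpa using block_injective hMk (Fin.castAdd_injective m 3 h))
      (Fin.castLE_injective hkm)
  have := abs_integral_sub_le hM hc hR hL hF hint j hT hδ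
  rwa [integral_map hfc.aemeasurable hF.aestronglyMeasurable] at this

lemma tendsto_error_bound (C a B I : ℝ) (N : ℕ) (ha : 0 < a) :
    Tendsto (fun u : ℝ => B * (u ^ N * Real.exp (-(a * u))) + (C + 1) * I / u) atTop (𝓝 0) := by
  have h1 : Tendsto (fun u : ℝ => u ^ N * Real.exp (-(a * u))) atTop (𝓝 0) := by
    have := ((Real.tendsto_pow_mul_exp_neg_atTop_nhds_zero N).comp
      (tendsto_id.const_mul_atTop ha)).const_mul ((a ^ N)⁻¹)
    rw [mul_zero] at this
    refine this.congr fun u => ?_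
    simp only [Function.comp, id, mul_pow]
    field_simp
  simpa using (h1.const_mul B).add (tendsto_id.const_div_atTop ((C + 1) * I))

/-- Here `u ^ 4` plays the role of `m + 1` and `u` is the truncation level. The Hoeffding exponent
grows at least linearly in `u`, beating `u ^ (4 * α + 1)`, and the moment order `4 * α + 4` absorbs
the domination factor `u ^ (4 * α)`. The constant `exp (δ ^ 2 / 2)` pays for rounding the number of
blocks. -/
lemma error_le {C I δ u : ℝ} {α k M : ℕ} (hC : 0 ≤ C) (hI : 0 ≤ I) (hu : 1 ≤ u)
    (hM : u ^ 4 ≤ (k + 1) * (M + 1)) :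
    4 * u * (C * (u ^ 4) ^ α) * Real.exp (-(M * δ ^ 2 / (2 * u ^ 2))) +
        (C * (u ^ 4) ^ α + 1) * (I / u ^ (4 * α + 4)) ≤
      4 * C * Real.exp (δ ^ 2 / 2) *
        (u ^ (4 * α + 1) * Real.exp (-(δ ^ 2 / (2 * (k + 1)) * u))) + (C + 1) * I / u := by
  have hu0 : 0 < u := by linarith
  have hp : (u ^ 4) ^ α = u ^ (4 * α) := by rw [pow_mul]
  have hk : (0 : ℝ) < k + 1 := by positivity
  rw [hp]
  refine add_le_add ?_ ?_
  · have hexp : Real.exp (-(M * δ ^ 2 / (2 * u ^ 2))) ≤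
        Real.exp (δ ^ 2 / 2) * Real.exp (-(δ ^ 2 / (2 * (k + 1)) * u)) := by
      rw [← Real.exp_add]
      refine Real.exp_le_exp.2 ?_
      have h1 : u ^ 3 / (k + 1) ≤ M + u ^ 2 := by
        rw [div_le_iff₀ hk]
        have h3 : u ^ 3 ≤ u ^ 4 := pow_le_pow_right₀ hu (by norm_num)
        have h2 : (1 : ℝ) ≤ u ^ 2 := one_le_pow₀ hu
        nlinarith
      have h4 : δ ^ 2 / (2 * (k + 1)) * u = u ^ 3 / (k + 1) * (δ ^ 2 / (2 * u ^ 2)) := by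
        field_simp
      have h5 : M * δ ^ 2 / (2 * u ^ 2) = (M + u ^ 2) * (δ ^ 2 / (2 * u ^ 2)) - δ ^ 2 / 2 := by
        field_simp
        ring
      rw [h4, h5]
      have := mul_le_mul_of_nonneg_right h1 (by positivity : 0 ≤ δ ^ 2 / (2 * u ^ 2))
      linarith
    calc _ = 4 * C * u ^ (4 * α + 1) * Real.exp (-(M * δ ^ 2 / (2 * u ^ 2))) := by ring
      _ ≤ 4 * C * u ^ (4 * α + 1) *
          (Real.exp (δ ^ 2 / 2) * Real.exp (-(δ ^ 2 / (2 * (k + 1)) * u))) := by gcongr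
      _ = _ := by ring
  · have h1 : (1 : ℝ) ≤ u ^ (4 * α) := one_le_pow₀ hu
    calc (C * u ^ (4 * α) + 1) * (I / u ^ (4 * α + 4))
        ≤ (C * u ^ (4 * α) + u ^ (4 * α)) * (I / u ^ (4 * α + 4)) := by gcongr
      _ = (C + 1) * I / u ^ 4 := by
          rw [pow_add]
          field_simp
      _ ≤ (C + 1) * I / u := by
          gcongr
          exact le_self_pow₀ hu (by norm_num)

/-- Integrals of functions of the first `k` coordinates with all moments finite under the product
law converge. -/
theorem tendsto_integral_unif {r s b : ℝ} (hb1 : 1 < b) (hb2 : b ≤ 2)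
    (h : 0 < r ∨ r = 0 ∧ s = 1) (hm : HasMoments r s b) {k : ℕ} {F : (Fin k → ℝ) → ℝ}
    (hF : Measurable F)
    (hint : ∀ j : ℕ, Integrable (fun x => |F x| ^ j) (Measure.pi fun _ => G r s)) :
    Tendsto (fun m => ∫ x, F (firstCoords k x) ∂(unif m b)) atTop
      (𝓝 (∫ x, F x ∂(Measure.pi fun _ => G r s))) := by
  have := hm.isProbabilityMeasure
  obtain ⟨C, α, m₀, hC, hle⟩ := exists_unif_map_le hb1 hb2 h hm
  refine Metric.tendsto_nhds.2 fun δ' hδ' => ?_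
  set δ := δ' / 2 with hδ
  have hδ0 : 0 < δ := by positivity
  set I := ∫ x, |F x| ^ (4 * α + 4 + 1) ∂(Measure.pi fun _ : Fin k => G r s)
  have hI : 0 ≤ I := integral_nonneg fun x => by positivity
  have hu : Tendsto (fun m : ℕ => √√((m : ℝ) + 1)) atTop atTop :=
    Real.tendsto_sqrt_atTop.comp (Real.tendsto_sqrt_atTop.comp
      (tendsto_atTop_add_const_right _ 1 tendsto_natCast_atTop_atTop))
  have herr := (tendsto_error_bound C (δ ^ 2 / (2 * (k + 1))) (4 * C * Real.exp (δ ^ 2 / 2)) I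
    (4 * α + 1) (by positivity)).comp hu
  filter_upwards [herr.eventually (gt_mem_nhds hδ0), eventually_ge_atTop m₀,
    eventually_ge_atTop (k + 1)] with m h1 h2 h3
  set u := √√((m : ℝ) + 1)
  have hu1 : 1 ≤ u := by
    refine Real.one_le_sqrt.2 (Real.one_le_sqrt.2 ?_)
    have : (0 : ℝ) ≤ m := Nat.cast_nonneg m
    linarith
  have hu4 : u ^ 4 = (m : ℝ) + 1 := by
    rw [show (4 : ℕ) = 2 * 2 from rfl, pow_mul, Real.sq_sqrt (Real.sqrt_nonneg _),
      Real.sq_sqrt (by positivity)]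
  -- Dividing by `k + 1` instead of `k` covers `k = 0` as well.
  have hM : 0 < m / (k + 1) := Nat.div_pos h3 k.succ_pos
  have hMk : m / (k + 1) * k ≤ m :=
    (Nat.mul_le_mul_left _ k.le_succ).trans (Nat.div_mul_le_self m (k + 1))
  have hM2 : u ^ 4 ≤ (k + 1) * ((m / (k + 1) : ℕ) + 1) := by
    rw [hu4]
    exact_mod_cast Nat.lt_mul_div_succ m k.succ_pos
  have key := abs_integral_unif_sub_le hb1 hb2 (c := C * (m + 1) ^ α) (by positivity) (hle m h2)
    hM hMk hF hint (4 * α + 4) (T := u) (by linarith) hδ0.le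
  have hE := error_le (δ := δ) (α := α) hC.le hI hu1 hM2
  rw [hu4] at hE
  simp only [Function.comp] at h1
  rw [Real.dist_eq]
  linarith

/-! ### The maximal coordinate -/

/-- Union bound: by exchangeability each coordinate has the law of the first one, which is among the
dominated ones as `m > 0`. -/
lemma unif_exists_gt_le {r s b C : ℝ} {α m : ℕ} (hb1 : 1 < b) (hb2 : b ≤ 2)
    [IsProbabilityMeasure (G r s)] (hm : 0 < m)
    (hle : (unif m b).map (fun x i => x (Fin.castAdd 3 i)) ≤
      ENNReal.ofReal (C * (m + 1) ^ α) • Measure.pi (fun _ : Fin m => G r s)) (t : ℝ) :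
    unif m b {x | ∃ i, t < x i} ≤
      (m + 3 : ℕ) * (ENNReal.ofReal (C * (m + 1) ^ α) * G r s (Set.Ioi t)) := by
  have hU := isUniformOnK_unif (m := m) hb1 hb2
  have hbd : ∀ i, unif m b {x | t < x i} ≤ ENNReal.ofReal (C * (m + 1) ^ α) * G r s (Set.Ioi t) := by
    intro i
    have hS : MeasurableSet {z : Fin 1 → ℝ | t < z 0} :=
      measurableSet_lt measurable_const (measurable_pi_apply _)
    have h1 := congrArg (fun μ => μ {z : Fin 1 → ℝ | t < z 0})
      (hU.map_precomp_eq (κ := Fin 1) (f := fun _ => i) (g := fun _ => Fin.castAdd 3 ⟨0, hm⟩)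
        (Function.injective_of_subsingleton _) (Function.injective_of_subsingleton _))
    rw [Measure.map_apply (by fun_prop) hS, Measure.map_apply (by fun_prop) hS] at h1
    have hA : MeasurableSet {y : Fin m → ℝ | t < y ⟨0, hm⟩} :=
      measurableSet_lt measurable_const (measurable_pi_apply _)
    have h2 := hle {y | t < y ⟨0, hm⟩}
    rw [Measure.map_apply (by fun_prop) hA, Measure.smul_apply, smul_eq_mul] at h2
    have h3 := (measurePreserving_eval (fun _ : Fin m => G r s) ⟨0, hm⟩).measure_preimage
      (measurableSet_Ioi (a := t)).nullMeasurableSet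
    rw [← h3]
    exact h1.trans_le h2
  have hset : {x : Fin (m + 3) → ℝ | ∃ i, t < x i} = ⋃ i, {x | t < x i} := by
    ext
    simp
  rw [hset]
  refine (measure_iUnion_le _).trans ?_
  rw [tsum_fintype]
  refine (Finset.sum_le_card_nsmul _ _ _ fun i _ => hbd i).trans_eq ?_
  simp

lemma G_real_Ioi_le {r s t A : ℝ} {φ : ℝ → ℝ} [IsProbabilityMeasure (G r s)]
    (hφ : Integrable (fun x => Real.exp (φ x)) (G r s))
    (ht : ∀ x, t < x → A ≤ φ x) :
    (G r s).real (Set.Ioi t) ≤ (∫ x, Real.exp (φ x) ∂(G r s)) * Real.exp (-A) := by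
  have h1 := mul_meas_ge_le_integral_of_nonneg
    (Eventually.of_forall fun x => (Real.exp_pos (φ x)).le) hφ (Real.exp A)
  have h2 : (G r s).real (Set.Ioi t) ≤ (G r s).real {x | Real.exp A ≤ Real.exp (φ x)} :=
    measureReal_mono fun x hx => Real.exp_le_exp.2 (ht x hx)
  rw [Real.exp_neg, ← div_eq_mul_inv, le_div_iff₀ (Real.exp_pos A), mul_comm]
  exact (mul_le_mul_of_nonneg_left h2 (Real.exp_pos A).le).trans h1

lemma one_le_log {n : ℕ} (hn : 3 ≤ n) : 1 ≤ Real.log n := by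
  rw [Real.le_log_iff_exp_le (by positivity)]
  have : (3 : ℝ) ≤ n := by exact_mod_cast hn
  linarith [Real.exp_one_lt_three]

/-- At the logarithmic scales the tails of `G r s` decay faster than any prescribed power. -/
lemma exists_G_real_Ioi_le {r s : ℝ} (h : 0 < r ∨ r = 0 ∧ s = 1) (β : ℕ) : ∃ C A : ℝ,
    ∀ n : ℕ, 3 ≤ n →
      (0 < r → (G r s).real (Set.Ioi (C * √(Real.log n))) ≤ A * ((n : ℝ) ^ β)⁻¹) ∧
      (G r s).real (Set.Ioi (C * Real.log n)) ≤ A * ((n : ℝ) ^ β)⁻¹ := by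
  have := isProbabilityMeasure_G (mass_ne_top_of_param h)
  have hexp : ∀ n : ℕ, 3 ≤ n → Real.exp (-(β * Real.log n)) = ((n : ℝ) ^ β)⁻¹ := fun n hn => by
    have : (0 : ℝ) < n := by positivity
    rw [Real.exp_neg, mul_comm, Real.exp_mul, Real.exp_log this, Real.rpow_natCast]
  rcases h with hr | ⟨rfl, rfl⟩
  -- At `x = C √(log n)` the exponent `r / 2 * x ^ 2` equals `β log n`, and `exp (r / 2 * x ^ 2)` is
  -- still integrable.
  · refine ⟨√(2 * β / r), ∫ x, Real.exp (r / 2 * x ^ 2) ∂(G r s), fun n hn => ?_⟩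
    have hl := one_le_log hn
    have hmain : (G r s).real (Set.Ioi (√(2 * β / r) * √(Real.log n))) ≤
        (∫ x, Real.exp (r / 2 * x ^ 2) ∂(G r s)) * ((n : ℝ) ^ β)⁻¹ := by
      rw [← hexp n hn]
      refine G_real_Ioi_le (integrable_exp_sq_G hr) fun x hx => ?_
      have h2 : (√(2 * β / r) * √(Real.log n)) ^ 2 ≤ x ^ 2 :=
        pow_le_pow_left₀ (by positivity) hx.le 2
      rw [mul_pow, Real.sq_sqrt (by positivity), Real.sq_sqrt (by linarith)] at h2
      calc β * Real.log n = r / 2 * (2 * β / r * Real.log n) := by field_simp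
        _ ≤ r / 2 * x ^ 2 := by gcongr
    -- For `n ≥ 3` one has `√(log n) ≤ log n`, so the same `C` serves both scales.
    refine ⟨fun _ => hmain, (measureReal_mono (Set.Ioi_subset_Ioi ?_)).trans hmain⟩
    gcongr
    rw [Real.sqrt_le_left (by linarith)]
    nlinarith
  · refine ⟨2 * β, ∫ x, Real.exp (x / 2) ∂(G 0 1), fun n hn =>
      ⟨fun hr => absurd hr (lt_irrefl _), ?_⟩⟩
    rw [← hexp n hn]
    refine G_real_Ioi_le (φ := fun x => x / 2) integrable_exp_half_G fun x hx => ?_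
    linarith

lemma tendsto_unif_exists_gt {r s b C A : ℝ} {α m₀ : ℕ} (hb1 : 1 < b) (hb2 : b ≤ 2)
    [IsProbabilityMeasure (G r s)] (hC : 0 < C)
    (hle : ∀ m, m₀ ≤ m → (unif m b).map (fun x i => x (Fin.castAdd 3 i)) ≤
      ENNReal.ofReal (C * (m + 1) ^ α) • Measure.pi (fun _ : Fin m => G r s)) {τ : ℕ → ℝ}
    (hτ : ∀ n, 3 ≤ n → (G r s).real (Set.Ioi (τ n)) ≤ A * ((n : ℝ) ^ (α + 2))⁻¹) :
    Tendsto (fun m => unif m b {x | ∃ i, τ (m + 3) < x i}) atTop (𝓝 0) := by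
  have hlim : Tendsto (fun m : ℕ => ENNReal.ofReal (C * A / (m + 3 : ℕ))) atTop (𝓝 0) := by
    have h1 : Tendsto (fun n : ℕ => C * A / (n : ℝ)) atTop (𝓝 0) :=
      tendsto_const_div_atTop_nhds_zero_nat _
    simpa using ENNReal.tendsto_ofReal ((tendsto_add_atTop_iff_nat 3).2 h1)
  refine tendsto_of_tendsto_of_tendsto_of_le_of_le' tendsto_const_nhds hlim
    (Eventually.of_forall fun _ => bot_le) ?_
  filter_upwards [eventually_ge_atTop m₀, eventually_gt_atTop 0] with m h1 h2
  refine (unif_exists_gt_le hb1 hb2 h2 (hle m h1) (τ (m + 3))).trans ?_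
  rw [← ofReal_measureReal, ← ENNReal.ofReal_mul (by positivity), ← ENNReal.ofReal_natCast,
    ← ENNReal.ofReal_mul (by positivity)]
  refine ENNReal.ofReal_le_ofReal ?_
  have h3 := hτ (m + 3) (by omega)
  have hn : (0 : ℝ) < (m + 3 : ℕ) := by positivity
  have h4 : ((m : ℝ) + 1) ≤ (m + 3 : ℕ) := by push_cast; linarith
  calc ((m + 3 : ℕ) : ℝ) * (C * (m + 1) ^ α * (G r s).real (Set.Ioi (τ (m + 3))))
      ≤ (m + 3 : ℕ) * (C * (m + 3 : ℕ) ^ α * (A * (((m + 3 : ℕ) : ℝ) ^ (α + 2))⁻¹)) := by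
        gcongr
    _ = C * A / (m + 3 : ℕ) := by
        rw [pow_add]
        field_simp

lemma measure_iSup_gt_le {Ω : Type*} [MeasurableSpace Ω] {P : Measure Ω} {n : ℕ} (hn : 0 < n)
    {X : Ω → Fin n → ℝ} (hX : AEMeasurable X P) (t : ℝ) :
    P {ω | t < ⨆ i, X ω i} ≤ P.map X {x | ∃ i, t < x i} := by
  have : Nonempty (Fin n) := ⟨⟨0, hn⟩⟩
  refine (measure_mono (t := X ⁻¹' {x | ∃ i, t < x i}) fun ω hω => ?_).trans
    (Measure.le_map_apply hX _)
  exact exists_lt_of_lt_ciSup (show t < ⨆ i, X ω i from hω)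

/-! ### Moments -/

lemma abs_firstCoords_le {n : ℕ} {b : ℝ} {x : Fin n → ℝ} (hx : x ∈ K n b) (k : ℕ) (i : Fin k) :
    |firstCoords k x i| ≤ n := by
  unfold firstCoords
  split_ifs with h
  · rw [abs_of_pos (hx.1 _), ← hx.2.1]
    exact Finset.single_le_sum (f := x) (fun j _ => (hx.1 j).le) (Finset.mem_univ _)
  · simp

lemma IsUniformOnK.integrable_monomial {n : ℕ} {b : ℝ} {P : Measure (Fin n → ℝ)}
    (hP : IsUniformOnK n b P) {k : ℕ} (p : Fin k → ℕ) :
    Integrable (fun x => ∏ i, firstCoords k x i ^ p i) P := by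
  have := hP.isProbabilityMeasure
  have hmeas : Measurable fun x : Fin n → ℝ => ∏ i, firstCoords k x i ^ p i :=
    Finset.measurable_prod _ fun i _ =>
      ((measurable_pi_apply i).comp (measurable_firstCoords k n)).pow_const _
  refine Integrable.of_bound hmeas.aestronglyMeasurable (∏ i, (n : ℝ) ^ p i) ?_
  filter_upwards [hP.ae_mem] with x hx
  rw [Real.norm_eq_abs, Finset.abs_prod]
  refine Finset.prod_le_prod (fun _ _ => abs_nonneg _) fun i _ => ?_
  rw [abs_pow]
  exact pow_le_pow_left₀ (abs_nonneg _) (abs_firstCoords_le hx k i) _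

lemma integrable_abs_monomial_pow {r s : ℝ} (h : 0 < r ∨ r = 0 ∧ s = 1) {k : ℕ} (p : Fin k → ℕ)
    (j : ℕ) :
    Integrable (fun x : Fin k → ℝ => |∏ i, x i ^ p i| ^ j) (Measure.pi fun _ => G r s) := by
  have := isProbabilityMeasure_G (mass_ne_top_of_param h)
  have := Integrable.fintype_prod (μ := fun _ : Fin k => G r s) (f := fun i x => |x ^ (p i * j)|)
    fun i => (integrable_pow_G h _).abs
  refine this.congr (Eventually.of_forall fun x => ?_)
  simp [Finset.abs_prod, abs_pow, pow_mul, Finset.prod_pow]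

lemma map_fin_eq_pi {Ω : Type*} [MeasurableSpace Ω] {P : Measure Ω} [IsProbabilityMeasure P]
    {Z : ℕ → Ω → ℝ} {μ : Measure ℝ} (hZ : ∀ i, HasLaw (Z i) μ P) (hind : iIndepFun Z P) (k : ℕ) :
    P.map (fun ω (i : Fin k) => Z i ω) = Measure.pi fun _ => μ := by
  rw [(iIndepFun_iff_map_fun_eq_pi_map fun i : Fin k => (hZ i).aemeasurable).1
    (hind.precomp Fin.val_injective)]
  simp [(hZ _).map_eq]

end SimplexSphere

end

/-! ### The main theorem -/

theorem theorem1 (b : ℝ) (hb1 : 1 < b) (hb2 : b ≤ 2) :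
    -- existence and uniqueness of the parameters `r, s`
    (∃! rs : ℝ × ℝ, SimplexSphere.HasMoments rs.1 rs.2 b) ∧
    -- the uniform distribution on `K` is well defined
    (∀ n : ℕ, 3 ≤ n → ∃! P : Measure (Fin n → ℝ), SimplexSphere.IsUniformOnK n b P) ∧
    -- the constant `C` depends on `b` only
    ∃ C : ℝ, ∀ (r s : ℝ), SimplexSphere.HasMoments r s b →
      -- `X n` is a random vector with the uniform distribution on `K n b`
      ∀ (Ω : ℕ → Type*) [∀ n, MeasurableSpace (Ω n)] (P : ∀ n, Measure (Ω n))
        [∀ n, IsProbabilityMeasure (P n)] (X : ∀ n, Ω n → Fin n → ℝ),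
      (∀ n, AEMeasurable (X n) (P n)) →
      (∀ n, 3 ≤ n → SimplexSphere.IsUniformOnK n b ((P n).map (X n))) →
      -- `Z 0, Z 1, …` are i.i.d. with law `G r s`
      ∀ (Ω' : Type*) [MeasurableSpace Ω'] (P' : Measure Ω') [IsProbabilityMeasure P']
        (Z : ℕ → Ω' → ℝ),
      (∀ i, HasLaw (Z i) (SimplexSphere.G r s) P') →
      iIndepFun Z P' →
      -- (a) convergence in law
      (∀ k : ℕ, TendstoInDistribution (fun n ω => SimplexSphere.firstCoords k (X n ω)) atTop
        (fun ω (i : Fin k) => Z i ω) P P') ∧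
      -- (b) convergence of all joint moments
      (∀ (k : ℕ) (p : Fin k → ℕ),
        (∀ n, 3 ≤ n →
          Integrable (fun ω => ∏ i, SimplexSphere.firstCoords k (X n ω) i ^ p i) (P n)) ∧
        Integrable (fun ω => ∏ i : Fin k, Z i ω ^ p i) P' ∧
        Tendsto (fun n => ∫ ω, ∏ i, SimplexSphere.firstCoords k (X n ω) i ^ p i ∂(P n)) atTop
          (𝓝 (∫ ω, ∏ i : Fin k, Z i ω ^ p i ∂P'))) ∧
      -- (c) the maximal coordinate for `b < 2`
      (b < 2 → Tendsto (fun n : ℕ => P n {ω | C * √(Real.log n) < ⨆ i, X n ω i}) atTop (𝓝 0)) ∧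
      -- (d) the maximal coordinate for `b = 2`
      (b = 2 → Tendsto (fun n : ℕ => P n {ω | C * Real.log n < ⨆ i, X n ω i}) atTop (𝓝 0)) := by
  refine ⟨SimplexSphere.existsUnique_hasMoments hb1 hb2, fun n hn => SimplexSphere.existsUnique_isUniformOnK hn hb1 hb2, ?_⟩
  obtain ⟨r₀, s₀, hm₀, h, hr⟩ := SimplexSphere.exists_hasMoments hb1 hb2
  have := hm₀.isProbabilityMeasure
  obtain ⟨C₀, α, m₀, hC₀, hle⟩ := SimplexSphere.exists_unif_map_le hb1 hb2 h hm₀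
  -- Of the exponent `α + 2`, `α` pays for the domination and `1` for the union bound; the remaining
  -- power makes the probability `O(1 / n)`.
  obtain ⟨C, A, hCA⟩ := SimplexSphere.exists_G_real_Ioi_le h (α + 2)
  refine ⟨C, fun r s hm Ω _ P _ X hX hXU Ω' _ P' _ Z hZ hind => ?_⟩
  -- The constant was fixed from `r₀, s₀` alone; uniqueness of the parameters makes it valid for the
  -- given `r, s`.
  obtain ⟨rfl, rfl⟩ := hm.unique hm₀
  have hlaw : ∀ m, (P (m + 3)).map (X (m + 3)) = SimplexSphere.unif m b := fun m =>
    (hXU _ (by omega)).unique (SimplexSphere.isUniformOnK_unif hb1 hb2)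
  have hZm : ∀ k, AEMeasurable (fun ω (i : Fin k) => Z i ω) P' := fun k =>
    aemeasurable_pi_lambda _ fun i => (hZ i).aemeasurable
  have hXm : ∀ k n, AEMeasurable (fun ω => SimplexSphere.firstCoords k (X n ω)) (P n) := fun k n =>
    (SimplexSphere.measurable_firstCoords k n).comp_aemeasurable (hX n)
  have hlim : ∀ (k : ℕ) (F : (Fin k → ℝ) → ℝ), Measurable F →
      (∀ j : ℕ, Integrable (fun x => |F x| ^ j) (Measure.pi fun _ => SimplexSphere.G r s)) →
      Tendsto (fun n => ∫ ω, F (SimplexSphere.firstCoords k (X n ω)) ∂(P n)) atTop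
        (𝓝 (∫ ω, F (fun i => Z i ω) ∂P')) := by
    intro k F hF hint
    rw [← integral_map (hZm k) hF.aestronglyMeasurable, SimplexSphere.map_fin_eq_pi hZ hind,
      ← tendsto_add_atTop_iff_nat 3]
    refine (SimplexSphere.tendsto_integral_unif hb1 hb2 h hm hF hint).congr fun m => ?_
    rw [← hlaw]
    exact integral_map (hX _)
      (hF.comp (SimplexSphere.measurable_firstCoords k _)).aestronglyMeasurable
  have hmax : ∀ τ : ℕ → ℝ,
      (∀ n, 3 ≤ n → (SimplexSphere.G r s).real (Set.Ioi (τ n)) ≤ A * ((n : ℝ) ^ (α + 2))⁻¹) →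
      Tendsto (fun n => P n {ω | τ n < ⨆ i, X n ω i}) atTop (𝓝 0) := by
    intro τ hτ
    rw [← tendsto_add_atTop_iff_nat 3]
    refine tendsto_of_tendsto_of_tendsto_of_le_of_le tendsto_const_nhds
      (SimplexSphere.tendsto_unif_exists_gt hb1 hb2 hC₀ hle hτ) (fun _ => bot_le) fun m => ?_
    rw [← hlaw]
    exact SimplexSphere.measure_iSup_gt_le (by omega) (hX _) _
  refine ⟨fun k => ⟨hXm k, hZm k, ?_⟩, fun k p => ⟨fun n hn => ?_, ?_, ?_⟩, fun hb => ?_,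
    fun _ => ?_⟩
  -- Bounded continuous test functions have all moments, so convergence in law is a case of `hlim`,
  -- as is the convergence of monomials.
  · refine ProbabilityMeasure.tendsto_iff_forall_integral_tendsto.2 fun f => ?_
    have hf : Measurable f := f.continuous.measurable
    have := hlim k f hf fun j => Integrable.of_bound (hf.abs.pow_const j).aestronglyMeasurable
      (‖f‖ ^ j) (Eventually.of_forall fun x => by
        rw [norm_pow, Real.norm_eq_abs, abs_abs]
        exact pow_le_pow_left₀ (abs_nonneg _) (f.norm_coe_le_norm x) j)
    simp only [ProbabilityMeasure.coe_mk]
    rw [integral_map (hZm k) hf.aestronglyMeasurable]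
    refine this.congr fun n => ?_
    rw [integral_map (hXm k n) hf.aestronglyMeasurable]
  · exact (hXU n hn).integrable_monomial p |>.comp_aemeasurable (hX n)
  · have h1 := SimplexSphere.integrable_abs_monomial_pow h p 1
    simp only [pow_one] at h1
    have hF : Measurable fun x : Fin k → ℝ => ∏ i, x i ^ p i := by fun_prop
    have h2 := (integrable_norm_iff hF.aestronglyMeasurable).1 h1
    rw [← SimplexSphere.map_fin_eq_pi hZ hind k] at h2
    exact h2.comp_aemeasurable (hZm k)
  · exact hlim k (fun x => ∏ i, x i ^ p i) (by fun_prop) (SimplexSphere.integrable_abs_monomial_pow h p)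
  · exact hmax _ fun n hn => (hCA n hn).1 (hr hb)
  · exact hmax _ fun n hn => (hCA n hn).2
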